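/- **Setting.** Let $T=\mathbb C/\Lambda$ be a complex torus, and let $C_\ell$ be a cyclic group of finite order $\ell$. Write $\mathrm{Aut}(T)$ for the group of biholomorphic self-maps of $T$. Let $\rho:C_\ell\to\mathrm{Aut}(\mathfrak{sl}_2(\mathbb C))$ and $\sigma:C_\ell\to\mathrm{Aut}(T)$ be injective homomorphisms such that $C_\ell$ acts on $T$ by rotations, i.e. $\sigma(\gamma)0=0$ for all $\gamma\in C_\ell$, and such that $T/\sigma(C_\ell)$ has genus $0$. Put $\mathbb T=T\setminus \sigma(C_\ell)\cdot\{0\}$, and let $\mathcal O_{\mathbb T}$ be the algebra of functions that are holomorphic on $\mathbb T$ and meromorphic on $T$. The *automorphic Lie algebra* is $$\mathfrak A=(\mathfrak{sl}_2\otimes_{\mathbb C}\mathcal O_{\mathbb T})^{C_\ell},$$ the Lie algebra of fixed points of the action $\gamma\cdot(A\otimes f)=\rho(\gamma)A\otimes f\circ\sigma(\gamma)^{-1}$ on $\mathfrak{sl}_2\otimes_{\mathbb C}\mathcal O_{\mathbb T}$ with the bracket $[A\otimes f,B\otimes g]=[A,B]\otimes fg$. The *Onsager algebra* $\mathfrak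 O$ is the complex Lie algebra with basis $A_k$ $(k\in\mathbb Z)$, $G_m$ $(m\ge1)$ and brackets $[A_k,A_l]=4G_{k-l}$, $[A_k,G_m]=2(A_{k-m}-A_{k+m})$, $[G_m,G_n]=0$, where $G_{-m}=-G_m$ and $G_0=0$. For $\tau$ in the upper half plane, let $g_2(\tau)=60\sum(a+b\tau)^{-4}$ and $g_3(\tau)=140\sum(a+b\tau)^{-6}$ (sums over $(a,b)\in\mathbb Z^2\setminus\{0\}$), and let $\mathfrak S_\tau=\mathbb C\langle E,F,H\rangle\otimes_{\mathbb C}\mathbb C[x]$ be the Lie algebra whose bracket is $\mathbb C[x]$-linear with $[H,E]=2E$, $[H,F]=-2F$, $[E,F]=H\otimes(4x^3-g_2(\tau)x-g_3(\tau))$. **Theorem.** 1. $\mathfrak A\cong\mathfrak O$ as complex Lie algebras if and only if $\ell\in\{3,4,6\}$. 2. If $\ell=2$, then $\mathfrak A\cong\mathfrak S_\tau$ for every $\tau$ in the upper half plane for which $T$ is biholomorphic to $\mathbb C/(\mathbb Z\oplus\mathbb Z\tau)$, and such $\tau$ exist. 3. Let $\omega_\ell=e^{2\pi i/\ell}$,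 let $e,f,h$ be the standard basis of $\mathfrak{sl}_2$, and let $\wp$ be the Weierstrass function of $\Lambda$. Suppose that a generator $s$ of $C_\ell$ acts by $$\rho(s)\begin{pmatrix}a&b\\c&-a\end{pmatrix}=\begin{pmatrix}a&\omega_\ell b\\ \omega_\ell^{-1}c&-a\end{pmatrix},\qquad \sigma(s)z=\omega_\ell z .$$ For $\ell\in\{3,4,6\}$ the algebra of invariants is $\mathcal O_{\mathbb T}^{C_\ell}=\mathbb C[J]$, and $\mathfrak A=\mathbb C\langle E,F,H\rangle\otimes_{\mathbb C}\mathbb C[J]$, i.e. $\mathfrak A$ is free over $\mathbb C[J]$ with basis $E,F,H$. Its brackets are $[H,E]=2E$, $[H,F]=-2F$, $[E,F]=H\otimes p$ with $p\in\mathbb C[J]$. Here $H=h\otimes1$ and - $\ell=3$: $J=\wp'$, $E=e\otimes\wp$, $F=f\otimes\wp^2$, $p=\wp^3$; - $\ell=4$: $J=\wp^2$, $E=e\otimes\wp'$, $F=f\otimes\wp\wp'$, $p=\wp(\wp')^2$; - $\ell=6$: $J=\wp^3$, $E=e\otimes\wp\wp'$, $F=f\otimes\wp^2\wp'$, $p=\wp^3(\wp')^2$.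 -/

import Mathlib

open scoped Topology TensorProduct PeriodPair

noncomputable section

namespace ALia

/-! ### The Onsager algebra -/

/-- The underlying vector space of the Onsager algebra: the complex vector space with basis
`A k` (`k : ℤ`) and `G m` (`m ≥ 1`). -/
def Onsager : Type := (ℤ ⊕ ℕ+) →₀ ℂ

namespace Onsager

instance : AddCommGroup Onsager := inferInstanceAs (AddCommGroup ((ℤ ⊕ ℕ+) →₀ ℂ))

instance : Module ℂ Onsager := inferInstanceAs (Module ℂ ((ℤ ⊕ ℕ+) →₀ ℂ))

/-- The defining basis of the Onsager algebra. -/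
def basis : Module.Basis (ℤ ⊕ ℕ+) ℂ Onsager := Finsupp.basisSingleOne

/-- The basis elements `A k`. -/
def A (k : ℤ) : Onsager := basis (Sum.inl k)

/-- The elements `G m` for all integers `m`: basis elements for `m > 0`, extended by
`G (-m) = - G m` and `G 0 = 0`. -/
def G (m : ℤ) : Onsager :=
  if h : 0 < m.natAbs then (m.sign : ℂ) • basis (Sum.inr ⟨m.natAbs, h⟩) else 0

/-- The brackets of basis elements. -/
def structureBracket : (ℤ ⊕ ℕ+) → (ℤ ⊕ ℕ+) → Onsager
  | Sum.inl k, Sum.inl l => (4 : ℂ) • G (k - l)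
  | Sum.inl k, Sum.inr m => (2 : ℂ) • (A (k - m) - A (k + m))
  | Sum.inr m, Sum.inl k => -((2 : ℂ) • (A (k - m) - A (k + m)))
  | Sum.inr _, Sum.inr _ => 0

/-- The bilinear extension of `structureBracket`. -/
def bracketHom : Onsager →ₗ[ℂ] Onsager →ₗ[ℂ] Onsager :=
  basis.constr ℂ fun i => basis.constr ℂ (structureBracket i)

instance : Bracket Onsager Onsager := ⟨fun x y => bracketHom x y⟩

theorem bracket_eq (x y : Onsager) : ⁅x, y⁆ = bracketHom x y := rfl

theorem G_neg (m : ℤ) : G (-m) = - G m := by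
  unfold G
  by_cases h : 0 < m.natAbs
  · have h' : 0 < (-m).natAbs := by simpa using h
    rw [dif_pos h, dif_pos h']
    simp only [Int.natAbs_neg, Int.sign_neg, Int.cast_neg, neg_smul]
  · have h' : ¬ 0 < (-m).natAbs := by simpa using h
    rw [dif_neg h, dif_neg h', neg_zero]

theorem G_pos (m : ℕ+) : G (m : ℤ) = basis (Sum.inr m) := by
  have h : 0 < ((m : ℕ) : ℤ).natAbs := by simp
  unfold G
  rw [dif_pos h]
  have : (((m : ℕ) : ℤ)).sign = 1 := Int.sign_eq_one_of_pos (by exact_mod_cast m.pos)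
  rw [this, Int.cast_one, one_smul]
  rfl

theorem bracketHom_A_A (k l : ℤ) : bracketHom (A k) (A l) = (4 : ℂ) • G (k - l) := by
  simp [bracketHom, A, structureBracket]

theorem bracketHom_A_G (k m : ℤ) :
    bracketHom (A k) (G m) = (2 : ℂ) • (A (k - m) - A (k + m)) := by
  have hp : ∀ n : ℕ+, bracketHom (A k) (G (n : ℤ)) = (2 : ℂ) • (A (k - n) - A (k + n)) := by
    intro n
    rw [G_pos]
    simp [bracketHom, A, structureBracket]
  rcases lt_trichotomy m 0 with h | h | h
  · obtain ⟨n, rfl⟩ : ∃ n : ℕ+, m = -(n : ℤ) :=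
      ⟨⟨m.natAbs, by omega⟩, by simp only [PNat.mk_coe]; omega⟩
    rw [G_neg, map_neg, hp, ← smul_neg, neg_sub, sub_neg_eq_add, ← sub_eq_add_neg]
  · subst h; simp [G]
  · obtain ⟨n, rfl⟩ : ∃ n : ℕ+, m = (n : ℤ) :=
      ⟨⟨m.natAbs, by omega⟩, by simp only [PNat.mk_coe]; omega⟩
    exact hp n

theorem bracketHom_G_A (k m : ℤ) :
    bracketHom (G m) (A k) = -((2 : ℂ) • (A (k - m) - A (k + m))) := by
  have hp : ∀ n : ℕ+, bracketHom (G (n : ℤ)) (A k) = -((2 : ℂ) • (A (k - n) - A (k + n))) := by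
    intro n
    rw [G_pos]
    simp [bracketHom, A, structureBracket]
  rcases lt_trichotomy m 0 with h | h | h
  · obtain ⟨n, rfl⟩ : ∃ n : ℕ+, m = -(n : ℤ) :=
      ⟨⟨m.natAbs, by omega⟩, by simp only [PNat.mk_coe]; omega⟩
    rw [G_neg, map_neg, LinearMap.neg_apply, hp, ← smul_neg, neg_sub, sub_neg_eq_add,
      ← sub_eq_add_neg, ← smul_neg, neg_sub]
  · subst h; simp [G]
  · obtain ⟨n, rfl⟩ : ∃ n : ℕ+, m = (n : ℤ) :=
      ⟨⟨m.natAbs, by omega⟩, by simp only [PNat.mk_coe]; omega⟩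
    exact hp n

theorem bracketHom_G_G (m n : ℤ) : bracketHom (G m) (G n) = 0 := by
  unfold G
  split_ifs <;> simp [bracketHom, structureBracket]

theorem bracketHom_skew (x y : Onsager) : bracketHom x y = -bracketHom y x := by
  have : bracketHom = -bracketHom.flip := by
    refine basis.ext fun i => basis.ext fun j => ?_
    rcases i with k | m <;> rcases j with l | n
    · change bracketHom (A k) (A l) = -bracketHom (A l) (A k)
      rw [bracketHom_A_A, bracketHom_A_A, ← neg_sub k l, G_neg, smul_neg, neg_neg]
    · rw [← G_pos]
      change bracketHom (A k) (G n) = -bracketHom (G n) (A k)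
      rw [bracketHom_A_G, bracketHom_G_A, neg_neg]
    · rw [← G_pos]
      change bracketHom (G m) (A l) = -bracketHom (A l) (G m)
      rw [bracketHom_A_G, bracketHom_G_A]
    · rw [← G_pos, ← G_pos]
      change bracketHom (G m) (G n) = -bracketHom (G n) (G m)
      rw [bracketHom_G_G, bracketHom_G_G, neg_zero]
  exact congrArg (fun B : Onsager →ₗ[ℂ] Onsager →ₗ[ℂ] Onsager => B x y) this

theorem induction {P : Onsager → Prop} (hb : ∀ i, P (basis i)) (h0 : P 0)
    (ha : ∀ x y, P x → P y → P (x + y)) (hs : ∀ (c : ℂ) x, P x → P (c • x)) (x : Onsager) :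
    P x := by
  have hx : x ∈ Submodule.span ℂ (Set.range basis) := by rw [basis.span_eq]; trivial
  induction hx using Submodule.span_induction with
  | mem x h => obtain ⟨i, rfl⟩ := h; exact hb i
  | zero => exact h0
  | add x y _ _ hx hy => exact ha x y hx hy
  | smul c x _ hx => exact hs c x hx

theorem bracketHom_jacobi (x y z : Onsager) :
    bracketHom x (bracketHom y z)
      = bracketHom (bracketHom x y) z + bracketHom y (bracketHom x z) := by
  have gA : ∀ i : ℤ, basis (Sum.inl i) = A i := fun _ => rfl
  have gG : ∀ i : ℕ+, basis (Sum.inr i) = G (i : ℤ) := fun i => (G_pos i).symm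
  have eA : ∀ a b : ℤ, a = b → A a = A b := fun a b h => by rw [h]
  have eG : ∀ a b : ℤ, a = -b → G a = -G b := fun a b h => by rw [h, G_neg]
  have eG' : ∀ a b : ℤ, a = b → G a = G b := fun a b h => by rw [h]
  induction x using induction with
  | h0 => simp
  | ha x x' h h' => simp only [map_add, LinearMap.add_apply, h, h']; abel
  | hs c x h => simp only [map_smul, LinearMap.smul_apply, h, smul_add]
  | hb i =>
  induction y using induction with
  | h0 => simp
  | ha x x' h h' => simp only [map_add, LinearMap.add_apply, h, h']; abel
  | hs c x h => simp only [map_smul, LinearMap.smul_apply, h, smul_add]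
  | hb j =>
  induction z using induction with
  | h0 => simp
  | ha x x' h h' => simp only [map_add, h, h']; abel
  | hs c x h => simp only [map_smul, h, smul_add]
  | hb k =>
  rcases i with i | i <;> rcases j with j | j <;> rcases k with k | k <;>
    simp only [gA, gG, bracketHom_A_A, bracketHom_A_G, bracketHom_G_A, bracketHom_G_G,
      map_smul, map_sub, map_neg, map_zero, LinearMap.smul_apply, LinearMap.sub_apply,
      LinearMap.neg_apply, LinearMap.zero_apply, smul_zero, add_zero]
  · rw [eA (k - (i - j)) (j - (i - k)) (by ring), eA (i - (j - k)) (k + (i - j)) (by ring),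
      eA (i + (j - k)) (j + (i - k)) (by ring)]
    module
  · rw [eG (i - (j - k)) (j - (i + k)) (by ring), eG (i - (j + k)) (j - (i - k)) (by ring)]
    module
  · rw [eG' (i - (k - j)) (i + j - k) (by ring), eG' (i - (k + j)) (i - j - k) (by ring)]
    module
  · rw [eA (i - k - j) (i - j - k) (by ring), eA (i - k + j) (i + j - k) (by ring),
      eA (i + k - j) (i - j + k) (by ring), eA (i + k + j) (i + j + k) (by ring)]
    module
  · rw [eG' (j - (k - i)) (j + i - k) (by ring), eG' (j - (k + i)) (j - i - k) (by ring)]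
    module
  · rw [eA (j - k - i) (j - i - k) (by ring), eA (j - k + i) (j + i - k) (by ring),
      eA (j + k - i) (j - i + k) (by ring), eA (j + k + i) (j + i + k) (by ring)]
    module
  · rw [eA (k - j - i) (k - i - j) (by ring), eA (k - j + i) (k + i - j) (by ring),
      eA (k + j - i) (k - i + j) (by ring), eA (k + j + i) (k + i + j) (by ring)]
    module

instance : LieRing Onsager where
  add_lie x y z := by simp [bracket_eq]
  lie_add x y z := by simp [bracket_eq]
  lie_self x := by
    have h := bracketHom_skew x x
    have h2 : (2 : ℂ) • bracketHom x x = 0 := by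
      rw [two_smul]; nth_rewrite 2 [h]; exact add_neg_cancel _
    simpa [bracket_eq] using h2
  leibniz_lie x y z := bracketHom_jacobi x y z

instance : LieAlgebra ℂ Onsager where
  lie_smul c x y := by simp [bracket_eq]

end Onsager

/-! ### The Lie algebras `𝔖_τ` -/

/-- The free `ℂ[x]`-module `ℂ⟨E, F, H⟩ ⊗ ℂ[x]`; the triple `(a, b, c)` stands for
`E ⊗ a + F ⊗ b + H ⊗ c`. It carries the `ℂ[x]`-bilinear bracket with
`[H, E] = 2 E`, `[H, F] = -2 F`, `[E, F] = H ⊗ p`. -/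
def TwistedSl2 (_p : Polynomial ℂ) : Type := Polynomial ℂ × Polynomial ℂ × Polynomial ℂ

namespace TwistedSl2

variable (p : Polynomial ℂ)

instance : AddCommGroup (TwistedSl2 p) :=
  inferInstanceAs (AddCommGroup (Polynomial ℂ × Polynomial ℂ × Polynomial ℂ))

instance : Module ℂ (TwistedSl2 p) :=
  inferInstanceAs (Module ℂ (Polynomial ℂ × Polynomial ℂ × Polynomial ℂ))

/-- The coefficient of `E`. -/
def coeffE (v : TwistedSl2 p) : Polynomial ℂ := v.1

/-- The coefficient of `F`. -/
def coeffF (v : TwistedSl2 p) : Polynomial ℂ := v.2.1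

/-- The coefficient of `H`. -/
def coeffH (v : TwistedSl2 p) : Polynomial ℂ := v.2.2

/-- The element `E ⊗ a + F ⊗ b + H ⊗ c`. -/
def mk (a b c : Polynomial ℂ) : TwistedSl2 p := (a, b, c)

variable {p}

theorem ext {v w : TwistedSl2 p} (h1 : v.coeffE = w.coeffE) (h2 : v.coeffF = w.coeffF)
    (h3 : v.coeffH = w.coeffH) : v = w := Prod.ext h1 (Prod.ext h2 h3)

theorem add_coeffE (v w : TwistedSl2 p) : (v + w).coeffE = v.coeffE + w.coeffE := rfl
theorem add_coeffF (v w : TwistedSl2 p) : (v + w).coeffF = v.coeffF + w.coeffF := rfl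
theorem add_coeffH (v w : TwistedSl2 p) : (v + w).coeffH = v.coeffH + w.coeffH := rfl
theorem zero_coeffE : (0 : TwistedSl2 p).coeffE = 0 := rfl
theorem zero_coeffF : (0 : TwistedSl2 p).coeffF = 0 := rfl
theorem zero_coeffH : (0 : TwistedSl2 p).coeffH = 0 := rfl
theorem smul_coeffE (c : ℂ) (v : TwistedSl2 p) : (c • v).coeffE = c • v.coeffE := rfl
theorem smul_coeffF (c : ℂ) (v : TwistedSl2 p) : (c • v).coeffF = c • v.coeffF := rfl
theorem smul_coeffH (c : ℂ) (v : TwistedSl2 p) : (c • v).coeffH = c • v.coeffH := rfl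

instance : Bracket (TwistedSl2 p) (TwistedSl2 p) where
  bracket v w := mk p (2 * (v.coeffH * w.coeffE - v.coeffE * w.coeffH))
    (-2 * (v.coeffH * w.coeffF - v.coeffF * w.coeffH))
    (p * (v.coeffE * w.coeffF - v.coeffF * w.coeffE))

theorem lie_coeffE (v w : TwistedSl2 p) :
    ⁅v, w⁆.coeffE = 2 * (v.coeffH * w.coeffE - v.coeffE * w.coeffH) := rfl
theorem lie_coeffF (v w : TwistedSl2 p) :
    ⁅v, w⁆.coeffF = -2 * (v.coeffH * w.coeffF - v.coeffF * w.coeffH) := rfl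
theorem lie_coeffH (v w : TwistedSl2 p) :
    ⁅v, w⁆.coeffH = p * (v.coeffE * w.coeffF - v.coeffF * w.coeffE) := rfl

instance : LieRing (TwistedSl2 p) where
  add_lie x y z := by
    apply ext <;> simp only [lie_coeffE, lie_coeffF, lie_coeffH, add_coeffE, add_coeffF,
      add_coeffH] <;> ring
  lie_add x y z := by
    apply ext <;> simp only [lie_coeffE, lie_coeffF, lie_coeffH, add_coeffE, add_coeffF,
      add_coeffH] <;> ring
  lie_self x := by
    apply ext <;> simp only [lie_coeffE, lie_coeffF, lie_coeffH, zero_coeffE, zero_coeffF,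
      zero_coeffH] <;> ring
  leibniz_lie x y z := by
    apply ext <;> simp only [lie_coeffE, lie_coeffF, lie_coeffH, add_coeffE, add_coeffF,
      add_coeffH] <;> ring

instance : LieAlgebra ℂ (TwistedSl2 p) where
  lie_smul c x y := by
    apply ext <;> simp only [lie_coeffE, lie_coeffF, lie_coeffH, smul_coeffE, smul_coeffF,
      smul_coeffH, Polynomial.smul_eq_C_mul] <;> ring

end TwistedSl2

/-- The pair of periods `(1, τ)`, spanning the lattice `ℤ ⊕ ℤ τ`. -/
def tauPeriods (τ : UpperHalfPlane) : PeriodPair where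
  ω₁ := 1
  ω₂ := τ
  indep := by
    rw [LinearIndependent.pair_iff]
    intro s t h
    have him := congrArg Complex.im h
    have hre := congrArg Complex.re h
    simp at him hre
    have ht : t = 0 := him.resolve_right τ.im_ne_zero
    subst ht
    simpa using hre

/-- The Lie algebra `𝔖_τ`. -/
abbrev SLie (τ : UpperHalfPlane) : Type :=
  TwistedSl2 (4 * Polynomial.X ^ 3 - Polynomial.C (tauPeriods τ).g₂ * Polynomial.X
    - Polynomial.C (tauPeriods τ).g₃)

/-! ### Complex tori, their automorphisms and their functions -/

/-- The complex torus `ℂ / Λ`. -/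
abbrev Torus (L : PeriodPair) : Type := ℂ ⧸ L.lattice.toAddSubgroup

/-- The projection `ℂ → ℂ / Λ`. -/
def proj (L : PeriodPair) : ℂ → Torus L := fun z => (z : ℂ ⧸ L.lattice.toAddSubgroup)

/-- A map of complex tori is holomorphic if, locally at every point of `ℂ`, it lifts to a
holomorphic function (the local inverses of `ℂ → ℂ / Λ` being the charts of the torus). -/
def IsHolomorphic {L L' : PeriodPair} (φ : Torus L → Torus L') : Prop :=
  ∀ z : ℂ, ∃ g : ℂ → ℂ, AnalyticAt ℂ g z ∧ ∀ᶠ w in 𝓝 z, φ (proj L w) = proj L' (g w)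

theorem IsHolomorphic.id (L : PeriodPair) : IsHolomorphic (fun x : Torus L => x) := fun _ =>
  ⟨fun w => w, analyticAt_id, Filter.Eventually.of_forall fun _ => rfl⟩

theorem proj_surjective (L : PeriodPair) : Function.Surjective (proj L) :=
  QuotientAddGroup.mk_surjective

theorem IsHolomorphic.comp {L L' L'' : PeriodPair} {ψ : Torus L' → Torus L''}
    {φ : Torus L → Torus L'} (hψ : IsHolomorphic ψ) (hφ : IsHolomorphic φ) :
    IsHolomorphic (fun x => ψ (φ x)) := by
  intro z
  obtain ⟨g, hg, hg'⟩ := hφ z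
  obtain ⟨k, hk, hk'⟩ := hψ (g z)
  refine ⟨fun w => k (g w), hk.comp hg, ?_⟩
  filter_upwards [hg', hg.continuousAt.eventually hk'] with w h1 h2
  rw [h1, h2]

/-- The tori `ℂ / Λ` and `ℂ / Λ'` are biholomorphic. -/
def TorusIso (L L' : PeriodPair) : Prop :=
  ∃ φ : Torus L ≃ Torus L', IsHolomorphic φ ∧ IsHolomorphic φ.symm

/-- The group `Aut(T)` of biholomorphic self-maps of the torus `T = ℂ / Λ`. -/
def torusAut (L : PeriodPair) : Subgroup (Equiv.Perm (Torus L)) where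
  carrier := {φ | IsHolomorphic (L := L) (L' := L) φ ∧ IsHolomorphic (L := L) (L' := L) φ.symm}
  mul_mem' h h' := ⟨h.1.comp h'.1, h'.2.comp h.2⟩
  one_mem' := ⟨IsHolomorphic.id L, IsHolomorphic.id L⟩
  inv_mem' h := ⟨h.2, h.1⟩

/-- The pullback to `ℂ` of a function on `T ∖ S`, with the value `0` over `S`. -/
def pullback (L : PeriodPair) (S : Set (Torus L)) (f : {x : Torus L // x ∉ S} → ℂ) (z : ℂ) : ℂ :=
  open Classical in if h : proj L z ∉ S then f ⟨proj L z, h⟩ else 0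

theorem pullback_of_notMem {L : PeriodPair} {S : Set (Torus L)}
    (f : {x : Torus L // x ∉ S} → ℂ) {z : ℂ} (h : proj L z ∉ S) :
    pullback L S f z = f ⟨proj L z, h⟩ := dif_pos h

theorem pullback_of_mem {L : PeriodPair} {S : Set (Torus L)}
    (f : {x : Torus L // x ∉ S} → ℂ) {z : ℂ} (h : proj L z ∈ S) :
    pullback L S f z = 0 := dif_neg (not_not.mpr h)

theorem proj_eq_zero_iff {L : PeriodPair} {z : ℂ} : proj L z = 0 ↔ z ∈ L.lattice :=
  (QuotientAddGroup.eq_zero_iff z)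

theorem continuous_proj (L : PeriodPair) : Continuous (proj L) := continuous_quotient_mk'

theorem eventually_proj_notMem {L : PeriodPair} {S : Set (Torus L)} (hS : S.Finite) (z : ℂ) :
    ∀ᶠ w in 𝓝[≠] z, proj L w ∉ S := by
  have : IsClosed (L.lattice.toAddSubgroup : Set ℂ) := L.isClosed_lattice
  have : T1Space (Torus L) := inferInstance
  have h1 : ∀ᶠ w in 𝓝 z, proj L w ∉ S \ {proj L z} :=
    (continuous_proj L).continuousAt.eventually
      ((hS.subset Set.sdiff_subset).isClosed.isOpen_compl.mem_nhds (by simp))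
  have h2 : ∀ᶠ w in 𝓝 z, w - z ∉ (L.lattice : Set ℂ) \ {0} := by
    have hc : Filter.Tendsto (fun w : ℂ => w - z) (𝓝 z) (𝓝 0) := by
      have : ContinuousAt (fun w : ℂ => w - z) z := by fun_prop
      simpa [ContinuousAt] using this
    exact hc.eventually (L.compl_lattice_sdiff_singleton_mem_nhds 0)
  filter_upwards [nhdsWithin_le_nhds h1, nhdsWithin_le_nhds h2, self_mem_nhdsWithin]
    with w hw1 hw2 hw3 hw
  have hne : proj L w ≠ proj L z := by
    intro h
    refine hw2 ⟨?_, ?_⟩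
    · refine proj_eq_zero_iff.mp ?_
      change proj L w - proj L z = 0
      rw [h, sub_self]
    · exact sub_ne_zero.mpr hw3
  exact hw1 ⟨hw, hne⟩

theorem eventually_proj_notMem_of_notMem {L : PeriodPair} {S : Set (Torus L)} (hS : S.Finite)
    {z : ℂ} (hz : proj L z ∉ S) : ∀ᶠ w in 𝓝 z, proj L w ∉ S := by
  have : IsClosed (L.lattice.toAddSubgroup : Set ℂ) := L.isClosed_lattice
  have : T1Space (Torus L) := inferInstance
  exact (continuous_proj L).continuousAt.eventually (hS.isClosed.isOpen_compl.mem_nhds hz)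

/-- The algebra of functions on `T ∖ S` that are holomorphic on `T ∖ S` and meromorphic at the
points of the finite set `S`. -/
def regularFunctions (L : PeriodPair) (S : Set (Torus L)) (hS : S.Finite) :
    Subalgebra ℂ ({x : Torus L // x ∉ S} → ℂ) where
  carrier := {f | ∀ z : ℂ, MeromorphicAt (pullback L S f) z ∧
    (proj L z ∉ S → AnalyticAt ℂ (pullback L S f) z)}
  mul_mem' {f g} hf hg z := by
    have : pullback L S (f * g) = pullback L S f * pullback L S g := by
      ext w; by_cases h : proj L w ∈ S
      · simp [pullback_of_mem, h]
      · simp [pullback_of_notMem, h]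
    rw [this]
    exact ⟨(hf z).1.mul (hg z).1, fun h => ((hf z).2 h).mul ((hg z).2 h)⟩
  add_mem' {f g} hf hg z := by
    have : pullback L S (f + g) = pullback L S f + pullback L S g := by
      ext w; by_cases h : proj L w ∈ S
      · simp [pullback_of_mem, h]
      · simp [pullback_of_notMem, h]
    rw [this]
    exact ⟨(hf z).1.add (hg z).1, fun h => ((hf z).2 h).add ((hg z).2 h)⟩
  algebraMap_mem' c z := by
    have h0 : ∀ w, proj L w ∉ S → c = pullback L S (algebraMap ℂ _ c) w := fun w hw => by
      rw [pullback_of_notMem _ hw]; rfl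
    refine ⟨(MeromorphicAt.const c z).congr ?_, fun hz => (analyticAt_const (v := c)).congr ?_⟩
    · filter_upwards [eventually_proj_notMem hS z] with w hw using h0 w hw
    · filter_upwards [eventually_proj_notMem_of_notMem hS hz] with w hw using h0 w hw

/-! ### Automorphic Lie algebras -/

/-- The group `Aut(𝔤)` of automorphisms of a complex Lie algebra. -/
def lieAut (𝔤 : Type*) [LieRing 𝔤] [LieAlgebra ℂ 𝔤] : Subgroup (𝔤 ≃ₗ[ℂ] 𝔤) where
  carrier := {φ | ∀ x y : 𝔤, φ ⁅x, y⁆ = ⁅φ x, φ y⁆}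
  mul_mem' {φ ψ} h h' x y := by
    change φ (ψ ⁅x, y⁆) = ⁅φ (ψ x), φ (ψ y)⁆
    rw [h' x y, h]
  one_mem' _ _ := rfl
  inv_mem' {φ} h x y := by
    change φ.symm ⁅x, y⁆ = ⁅φ.symm x, φ.symm y⁆
    apply φ.injective
    rw [h]
    simp

/-- An automorphism as a homomorphism of Lie algebras. -/
def lieAut.toLieHom {𝔤 : Type*} [LieRing 𝔤] [LieAlgebra ℂ 𝔤] (φ : lieAut 𝔤) : 𝔤 →ₗ⁅ℂ⁆ 𝔤 :=
  { (φ.1 : 𝔤 →ₗ[ℂ] 𝔤) with map_lie' := fun {x y} => φ.2 x y }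

section

variable {L : PeriodPair} {Γ : Type*} [Group Γ]

/-- The action of `γ` on the torus `T = ℂ / Λ` defined by `σ`. -/
def act (σ : Γ →* torusAut L) (γ : Γ) (x : Torus L) : Torus L := (σ γ).1 x

/-- The set of punctures: the orbit of `0` under `Γ`. -/
def punctures (σ : Γ →* torusAut L) : Set (Torus L) := Set.range fun γ => act σ γ 0

theorem act_mul (σ : Γ →* torusAut L) (γ δ : Γ) (x : Torus L) :
    act σ (γ * δ) x = act σ γ (act σ δ x) := by
  simp [act]

theorem act_one (σ : Γ →* torusAut L) (x : Torus L) : act σ 1 x = x := by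
  simp [act]

theorem act_mem_punctures_iff (σ : Γ →* torusAut L) (γ : Γ) (x : Torus L) :
    act σ γ x ∈ punctures σ ↔ x ∈ punctures σ := by
  constructor
  · rintro ⟨δ, hδ⟩
    refine ⟨γ⁻¹ * δ, ?_⟩
    simp only [act_mul] at hδ ⊢
    rw [hδ, ← act_mul, inv_mul_cancel, act_one]
  · rintro ⟨δ, rfl⟩
    exact ⟨γ * δ, act_mul σ γ δ 0⟩

theorem finite_punctures [Finite Γ] (σ : Γ →* torusAut L) : (punctures σ).Finite :=
  Set.finite_range _

theorem zero_mem_punctures (σ : Γ →* torusAut L) : (0 : Torus L) ∈ punctures σ :=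
  ⟨1, act_one σ 0⟩

/-- The equivalence relation on `T` whose classes are the `Γ`-orbits. -/
def orbitSetoid (σ : Γ →* torusAut L) : Setoid (Torus L) where
  r x y := ∃ γ, act σ γ x = y
  iseqv :=
    { refl := fun x => ⟨1, act_one σ x⟩
      symm := by
        rintro x y ⟨γ, rfl⟩
        exact ⟨γ⁻¹, by rw [← act_mul, inv_mul_cancel, act_one]⟩
      trans := by
        rintro x y z ⟨γ, rfl⟩ ⟨δ, rfl⟩
        exact ⟨δ * γ, act_mul σ δ γ x⟩ }

/-- The compact surface `T / σ(Γ)` has genus `0`, i.e. it is homeomorphic to the sphere. -/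
def QuotientHasGenusZero (σ : Γ →* torusAut L) : Prop :=
  Nonempty (Quotient (orbitSetoid σ) ≃ₜ Metric.sphere (0 : EuclideanSpace ℝ (Fin 3)) 1)

/-- The action of `γ⁻¹` on the punctured torus. -/
def actInv (σ : Γ →* torusAut L) (γ : Γ) (x : {x : Torus L // x ∉ punctures σ}) :
    {x : Torus L // x ∉ punctures σ} :=
  ⟨act σ γ⁻¹ x.1, fun h => x.2 ((act_mem_punctures_iff σ γ⁻¹ x.1).mp h)⟩

variable [Finite Γ]

/-- The algebra `𝒪_𝕋` of functions holomorphic on the punctured torus `𝕋 = T ∖ Γ·0` and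
meromorphic at the punctures. -/
abbrev Functions (σ : Γ →* torusAut L) : Type := regularFunctions L (punctures σ) (finite_punctures σ)

theorem comp_actInv_mem (σ : Γ →* torusAut L) (γ : Γ)
    (f : Functions σ) : f.1 ∘ actInv σ γ ∈ regularFunctions L (punctures σ) (finite_punctures σ) := by
  intro z
  obtain ⟨g, hg, hg'⟩ := (σ γ⁻¹).2.1 z
  have key : ∀ w, act σ γ⁻¹ (proj L w) = proj L (g w) →
      pullback L (punctures σ) (f.1 ∘ actInv σ γ) w = pullback L (punctures σ) f.1 (g w) := by
    intro w hw
    by_cases h : proj L w ∈ punctures σ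
    · rw [pullback_of_mem _ h, pullback_of_mem]
      rw [← hw]; exact (act_mem_punctures_iff σ _ _).mpr h
    · have h' : proj L (g w) ∉ punctures σ := by
        rw [← hw]; exact fun h1 => h ((act_mem_punctures_iff σ _ _).mp h1)
      rw [pullback_of_notMem _ h, pullback_of_notMem _ h']
      exact congrArg f.1 (Subtype.ext hw)
  have ev : (fun w => pullback L (punctures σ) f.1 (g w)) =ᶠ[𝓝 z]
      pullback L (punctures σ) (f.1 ∘ actInv σ γ) := by
    filter_upwards [hg'] with w hw
    exact (key w hw).symm
  refine ⟨?_, fun hz => ?_⟩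
  · exact ((f.2 (g z)).1.comp_analyticAt hg).congr (ev.filter_mono nhdsWithin_le_nhds)
  · have hz' : proj L (g z) ∉ punctures σ := by
      rw [← hg'.self_of_nhds]
      exact fun h1 => hz ((act_mem_punctures_iff σ γ⁻¹ _).mp h1)
    exact (((f.2 (g z)).2 hz').comp hg).congr ev

/-- The induced action `σ̃(γ) f = f ∘ σ(γ)⁻¹` on the algebra of functions. -/
def actFun (σ : Γ →* torusAut L) (γ : Γ) : Functions σ →ₐ[ℂ] Functions σ where
  toFun f := ⟨f.1 ∘ actInv σ γ, comp_actInv_mem σ γ f⟩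
  map_one' := rfl
  map_mul' _ _ := rfl
  map_zero' := rfl
  map_add' _ _ := rfl
  commutes' _ := rfl

/-- The algebra of invariant functions `𝒪_𝕋^Γ`. -/
def invariantFunctions (σ : Γ →* torusAut L) : Subalgebra ℂ (Functions σ) where
  carrier := {f | ∀ γ, actFun σ γ f = f}
  mul_mem' h h' γ := by rw [map_mul, h γ, h' γ]
  add_mem' h h' γ := by rw [map_add, h γ, h' γ]
  algebraMap_mem' c γ := (actFun σ γ).commutes c

variable {𝔤 : Type*} [LieRing 𝔤] [LieAlgebra ℂ 𝔤]

/-- The current algebra `𝔤 ⊗ 𝒪_𝕋`, with bracket `[A ⊗ f, B ⊗ g] = [A, B] ⊗ f g` (the factors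
are written in the order customary for extension of scalars). -/
abbrev CurrentAlgebra (𝔤 : Type*) [LieRing 𝔤] [LieAlgebra ℂ 𝔤] (σ : Γ →* torusAut L) : Type _ :=
  Functions σ ⊗[ℂ] 𝔤

/-- The diagonal action `γ · (A ⊗ f) = ρ(γ) A ⊗ σ̃(γ) f` on the current algebra. -/
def actCurrent (ρ : Γ →* lieAut 𝔤) (σ : Γ →* torusAut L) (γ : Γ) :
    CurrentAlgebra 𝔤 σ →ₗ⁅ℂ⁆ CurrentAlgebra 𝔤 σ :=
  LieAlgebra.ExtendScalars.map (actFun σ γ) (lieAut.toLieHom (ρ γ))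

/-- The automorphic Lie algebra `(𝔤 ⊗ 𝒪_𝕋)^Γ`. -/
def automorphicLieAlgebra (ρ : Γ →* lieAut 𝔤) (σ : Γ →* torusAut L) :
    LieSubalgebra ℂ (CurrentAlgebra 𝔤 σ) where
  carrier := {a | ∀ γ, actCurrent ρ σ γ a = a}
  add_mem' h h' γ := by rw [map_add, h γ, h' γ]
  zero_mem' γ := map_zero _
  smul_mem' c a h γ := by rw [map_smul, h γ]
  lie_mem' h h' := fun γ => by rw [LieHom.map_lie, h γ, h' γ]

/-- `(E, F, H)` is a normal form of the subalgebra `𝔄` of the current algebra, with coefficient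
algebra `B` and structure constant `p`: the elements `E, F, H` form a basis of `𝔄` over `B`, that is
`𝔄 = ℂ⟨E, F, H⟩ ⊗ B`, and `[H, E] = 2 E`, `[H, F] = -2 F`, `[E, F] = H ⊗ p` with `p ∈ B`. -/
structure IsNormalForm {σ : Γ →* torusAut L} (𝔄 : LieSubalgebra ℂ (CurrentAlgebra 𝔤 σ))
    (B : Subalgebra ℂ (Functions σ)) (E F H : CurrentAlgebra 𝔤 σ) (p : Functions σ) : Prop where
  mem_iff : ∀ x, x ∈ 𝔄 ↔ ∃ a ∈ B, ∃ b ∈ B, ∃ c ∈ B, x = a • E + b • F + c • H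
  independent : ∀ a ∈ B, ∀ b ∈ B, ∀ c ∈ B,
    a • E + b • F + c • H = 0 → a = 0 ∧ b = 0 ∧ c = 0
  lie_H_E : ⁅H, E⁆ = (2 : ℂ) • E
  lie_H_F : ⁅H, F⁆ = (-2 : ℂ) • F
  lie_E_F : ⁅E, F⁆ = p • H
  p_mem : p ∈ B

/-! ### Weierstrass functions on the punctured torus -/

/-- A `Λ`-periodic function on `ℂ` as a function on the torus. -/
def descend (u : ℂ → ℂ) (hu : ∀ (z : ℂ) (l : L.lattice), u (z + l) = u z) : Torus L → ℂ :=
  Quotient.lift u (by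
    intro a b h
    have h' : -a + b ∈ L.lattice := QuotientAddGroup.leftRel_apply.mp h
    have := hu a ⟨-a + b, h'⟩
    simpa using this.symm)

/-- A `Λ`-periodic function that is meromorphic on `ℂ` and holomorphic outside `Λ` defines an
element of `𝒪_𝕋`. -/
def ofPeriodic (σ : Γ →* torusAut L) (u : ℂ → ℂ)
    (hu : ∀ (z : ℂ) (l : L.lattice), u (z + l) = u z) (hm : Meromorphic u)
    (ha : ∀ z ∉ L.lattice, AnalyticAt ℂ u z) : Functions σ :=
  ⟨fun x => descend u hu x.1, by
    intro z
    have h0 : ∀ w, proj L w ∉ punctures σ →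
        u w = pullback L (punctures σ) (fun x => descend u hu x.1) w := fun w hw => by
      rw [pullback_of_notMem _ hw]; rfl
    refine ⟨(hm z).congr ?_, fun hz => (ha z ?_).congr ?_⟩
    · filter_upwards [eventually_proj_notMem (finite_punctures σ) z] with w hw using h0 w hw
    · intro h
      apply hz
      rw [proj_eq_zero_iff.mpr h]
      exact zero_mem_punctures σ
    · filter_upwards [eventually_proj_notMem_of_notMem (finite_punctures σ) hz] with w hw
        using h0 w hw⟩

/-- The Weierstrass function `℘` of `Λ` as an element of `𝒪_𝕋`. -/
def wp (σ : Γ →* torusAut L) : Functions σ :=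
  ofPeriodic σ ℘[L] L.weierstrassP_add_coe L.meromorphic_weierstrassP
    (fun z hz => L.analyticOnNhd_weierstrassP z hz)

/-- The derivative `℘'` as an element of `𝒪_𝕋`. -/
def wpDeriv (σ : Γ →* torusAut L) : Functions σ :=
  ofPeriodic σ ℘'[L] L.derivWeierstrassP_add_coe L.meromorphic_derivWeierstrassP
    (fun z hz => L.analyticOnNhd_derivWeierstrassP z hz)

end

/-! ### The Lie algebra `𝔰𝔩₂` -/

/-- The Lie algebra `𝔰𝔩₂(ℂ)` of traceless `2 × 2` matrices. -/
abbrev sl2 : Type := LieAlgebra.SpecialLinear.sl (Fin 2) ℂ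

/-- The matrix `e`. -/
def matE : sl2 := ⟨!![0, 1; 0, 0], by simp [LieAlgebra.SpecialLinear.sl]⟩

/-- The matrix `f`. -/
def matF : sl2 := ⟨!![0, 0; 1, 0], by simp [LieAlgebra.SpecialLinear.sl]⟩

/-- The matrix `h`. -/
def matH : sl2 := ⟨!![1, 0; 0, -1], by simp [LieAlgebra.SpecialLinear.sl]⟩

/-- The primitive root of unity `ω_ℓ = exp(2πi/ℓ)`. -/
def omega (l : ℕ) : ℂ := Complex.exp (2 * Real.pi * Complex.I / l)

end ALia

end

noncomputable section

namespace ALia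

/-! ### Addition formulas for Chebyshev polynomials -/

section Chebyshev

open Polynomial
open Polynomial.Chebyshev (T U T_add_two U_add_two T_sub_one U_sub_one T_neg U_neg_sub_one
  T_eq_X_mul_T_sub_pol_U U_eq_X_mul_U_add_T T_ne_zero U_ne_zero degree_U_natCast)

/-! Biholomorphic maps of tori lift to affine maps (`IsHolomorphic.exists_affine`), so a generator
`s` acts on `T` as multiplication by a primitive `ℓ`-th root of unity `a` preserving `Λ`. Hence `ℓ ∈
{1, 2, 3, 4, 6}` (`orderOf_rotation`). An automorphism of `𝔰𝔩₂` of finite order fixes a semisimple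
`h` and is diagonal in a standard basis, with eigenvalues `ζ, ζ⁻¹, 1` (`sl2.exists_diagonal`). For
`ℓ ∈ {2, 3, 4, 6}` the primitive roots are only `a` and `a⁻¹`, so `ζ = a` after possibly exchanging
`e` and `f`. An element of `𝔄` is then a combination of `e, f, h` whose coefficients are
eigenfunctions of `s` with eigenvalues `a⁻¹, a, 1`.

These eigenfunctions are governed by the pole order at `0`: it lies in one residue class mod `ℓ`,
and it is never `1` (`IsReg.order_ne_neg_one`). If `J` is invariant with pole order `ℓ` and `g` has
the least admissible pole order, subtracting multiples of `g J ^ k` removes the pole, and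
Liouville's theorem leaves `g ℂ[J]` as the whole eigenspace (`IsReg.exists_eval_of_isotypic`). Since
`℘` and `℘'` have eigenvalues `a²` and `a³`, monomials in them supply `J` and both generators. Thus
`𝔄` is a twisted `𝔰𝔩₂` over `ℂ[J]` with `[E, F] = H ⊗ p`, `p = g₁ g₂` (`IsRotation.isNormalForm`).

For `ℓ ≥ 3` the generators have pole orders `ℓ - 1` and `ℓ + 1`, so `p` is quadratic in `J`; for `ℓ
= 2` both orders are `3`, and `p = ℘'²` is the Weierstrass cubic in `J = ℘`. For `ℓ ≥ 3` the
rotation kills exactly one of `g₂, g₃`, which makes the two roots of the quadratic distinct. The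
Onsager algebra is the twisted `𝔰𝔩₂` with constant `4 (X² - 1)`, its brackets being the addition
formulas of sine and cosine in Chebyshev form (`Onsager.equivTwisted`); an affine change of variable
reaches every quadratic with distinct roots.

Abelianizations exclude the other orders. That of a twisted `𝔰𝔩₂` maps onto `ℂ[X]/(p)`, of dimension
`3` for a cubic, while that of the Onsager algebra is spanned by `A 0` and `A 1`
(`Onsager.not_equiv_of_cubic`). For `ℓ = 1` the whole current algebra remains; it is perfect, and
the Onsager algebra is not. -/

theorem chebyshev_T_succ (k : ℤ) :
    T ℂ (k + 1) = X * T ℂ k + (X ^ 2 - 1) * U ℂ (k - 1) := by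
  have h := T_eq_X_mul_T_sub_pol_U ℂ (k - 1)
  rw [show k - 1 + 2 = k + 1 by ring, show k - 1 + 1 = k by ring] at h
  rw [h]; ring

theorem chebyshev_U_succ (k : ℤ) : U ℂ k = X * U ℂ (k - 1) + T ℂ k := by
  have h := U_eq_X_mul_U_add_T ℂ (k - 1)
  rwa [show k - 1 + 1 = k by ring] at h

/-- For `X = cos θ` one has `T k = cos kθ` and `U (k - 1) = sin kθ / sin θ`; since `X² - 1 = -sin²
θ`, this is the addition formula for the cosine. -/
theorem chebyshev_T_add (k l : ℤ) :
    T ℂ (k + l) = T ℂ k * T ℂ l + (X ^ 2 - 1) * (U ℂ (k - 1) * U ℂ (l - 1)) := by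
  induction l using Polynomial.Chebyshev.induct with
  | zero => simp
  | one => simp [chebyshev_T_succ]; ring
  | add_two n h1 h2 =>
    have e := T_add_two ℂ (k + n)
    have e1 := U_add_two ℂ ((n : ℤ) - 1)
    rw [show (n : ℤ) - 1 + 1 = n by ring] at e1
    rw [show (n : ℤ) + 1 - 1 = n by ring] at h1
    rw [show k + ((n : ℤ) + 2) = k + n + 2 by ring, e,
      show (n : ℤ) + 2 - 1 = n - 1 + 2 by ring, e1, T_add_two,
      show k + (n : ℤ) + 1 = k + (n + 1) by ring, h1, h2]
    ring
  | neg_add_one n h1 h2 =>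
    have e := T_sub_one ℂ (k + -n)
    have e1 := U_sub_one ℂ (-(n : ℤ) - 1)
    rw [show -(n : ℤ) - 1 + 1 = -n by ring] at e1
    rw [show -(n : ℤ) + 1 - 1 = -n by ring] at h2
    rw [show k + (-(n : ℤ) - 1) = k + -n - 1 by ring, e, e1, T_sub_one,
      show k + -(n : ℤ) + 1 = k + (-n + 1) by ring, h1, h2]
    ring

/-- The addition formula for the sine, divided by `sin θ`. -/
theorem chebyshev_U_add (k l : ℤ) :
    U ℂ (k + l - 1) = U ℂ (k - 1) * T ℂ l + T ℂ k * U ℂ (l - 1) := by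
  induction l using Polynomial.Chebyshev.induct with
  | zero => simp
  | one => simp [chebyshev_U_succ k]; ring
  | add_two n h1 h2 =>
    have e := U_add_two ℂ (k + n - 1)
    have e1 := U_add_two ℂ ((n : ℤ) - 1)
    rw [show (n : ℤ) - 1 + 1 = n by ring] at e1
    rw [show (n : ℤ) + 1 - 1 = n by ring] at h1
    rw [show k + ((n : ℤ) + 2) - 1 = k + n - 1 + 2 by ring, e,
      show (n : ℤ) + 2 - 1 = n - 1 + 2 by ring, e1, T_add_two,
      show k + (n : ℤ) - 1 + 1 = k + (n + 1) - 1 by ring, h1, h2]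
    ring
  | neg_add_one n h1 h2 =>
    have e := U_sub_one ℂ (k + -n - 1)
    have e1 := U_sub_one ℂ (-(n : ℤ) - 1)
    rw [show -(n : ℤ) - 1 + 1 = -n by ring] at e1
    rw [show -(n : ℤ) + 1 - 1 = -n by ring] at h2
    rw [show k + (-(n : ℤ) - 1) - 1 = k + -n - 1 - 1 by ring, e, e1, T_sub_one,
      show k + -(n : ℤ) - 1 + 1 = k + (-n + 1) - 1 by ring, h1, h2]
    ring

theorem chebyshev_T_sub (k l : ℤ) :
    T ℂ (k - l) = T ℂ k * T ℂ l - (X ^ 2 - 1) * (U ℂ (k - 1) * U ℂ (l - 1)) := by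
  rw [sub_eq_add_neg, chebyshev_T_add, T_neg, U_neg_sub_one]; ring

theorem chebyshev_U_sub (k l : ℤ) :
    U ℂ (k - l - 1) = U ℂ (k - 1) * T ℂ l - T ℂ k * U ℂ (l - 1) := by
  rw [sub_eq_add_neg k l, chebyshev_U_add, T_neg, U_neg_sub_one]; ring

/-- The Chebyshev polynomials of the first kind as a basis of `ℂ[X]`. -/
def basisT : Module.Basis ℕ ℂ (Polynomial ℂ) :=
  Polynomial.Sequence.basis ⟨fun n => T ℂ n, fun n => by simp⟩ fun n => by
    refine isUnit_iff_ne_zero.mpr (leadingCoeff_ne_zero.mpr (T_ne_zero ℂ _))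

theorem basisT_apply (n : ℕ) : basisT n = T ℂ n := by
  rw [basisT, Polynomial.Sequence.basis_eq_self]

/-- The Chebyshev polynomials of the second kind as a basis of `ℂ[X]`. -/
def basisU : Module.Basis ℕ ℂ (Polynomial ℂ) :=
  Polynomial.Sequence.basis ⟨fun n => U ℂ n, fun n => by simp [degree_U_natCast]⟩ fun n => by
    refine isUnit_iff_ne_zero.mpr (leadingCoeff_ne_zero.mpr (U_ne_zero ℂ _ (by omega)))

theorem basisU_apply (n : ℕ) : basisU n = U ℂ n := by
  rw [basisU, Polynomial.Sequence.basis_eq_self]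

end Chebyshev

/-! ### The Onsager algebra as a twisted `𝔰𝔩₂` -/

namespace TwistedSl2

variable {p : Polynomial ℂ}

@[simp] theorem mk_coeffE (a b c : Polynomial ℂ) : (mk p a b c).coeffE = a := rfl
@[simp] theorem mk_coeffF (a b c : Polynomial ℂ) : (mk p a b c).coeffF = b := rfl
@[simp] theorem mk_coeffH (a b c : Polynomial ℂ) : (mk p a b c).coeffH = c := rfl

attribute [simp] add_coeffE add_coeffF add_coeffH zero_coeffE zero_coeffF zero_coeffH
  smul_coeffE smul_coeffF smul_coeffH lie_coeffE lie_coeffF lie_coeffH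

@[simp] theorem neg_coeffE (v : TwistedSl2 p) : (-v).coeffE = -v.coeffE := rfl
@[simp] theorem neg_coeffF (v : TwistedSl2 p) : (-v).coeffF = -v.coeffF := rfl
@[simp] theorem neg_coeffH (v : TwistedSl2 p) : (-v).coeffH = -v.coeffH := rfl
@[simp] theorem sub_coeffE (v w : TwistedSl2 p) : (v - w).coeffE = v.coeffE - w.coeffE := rfl
@[simp] theorem sub_coeffF (v w : TwistedSl2 p) : (v - w).coeffF = v.coeffF - w.coeffF := rfl
@[simp] theorem sub_coeffH (v w : TwistedSl2 p) : (v - w).coeffH = v.coeffH - w.coeffH := rfl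

/-- A Lie algebra isomorphism obtained by an affine substitution in the coefficients and a
rescaling of `F`. -/
def affineEquiv (p q : Polynomial ℂ) (a b c : ℂ) (ha : a ≠ 0) (hc : c ≠ 0)
    (h : p.comp (Polynomial.C a * Polynomial.X + Polynomial.C b) = Polynomial.C c * q) :
    TwistedSl2 p ≃ₗ⁅ℂ⁆ TwistedSl2 q where
  toFun v :=
    mk q (v.coeffE.comp (Polynomial.C a * Polynomial.X + Polynomial.C b))
      (Polynomial.C c * v.coeffF.comp (Polynomial.C a * Polynomial.X + Polynomial.C b))
      (v.coeffH.comp (Polynomial.C a * Polynomial.X + Polynomial.C b))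
  invFun v :=
    mk p (v.coeffE.comp (Polynomial.C a⁻¹ * (Polynomial.X - Polynomial.C b)))
      (Polynomial.C c⁻¹ * v.coeffF.comp (Polynomial.C a⁻¹ * (Polynomial.X - Polynomial.C b)))
      (v.coeffH.comp (Polynomial.C a⁻¹ * (Polynomial.X - Polynomial.C b)))
  map_add' v w := by apply ext <;> simp [mul_add]
  map_smul' s v := by apply ext <;> simp [Polynomial.smul_eq_C_mul] <;> ring
  map_lie' {v w} := by
    apply ext
    · simp
    · simp; ring
    -- Only the `H`-coefficient involves the structure constants: the substitution turns `p` into `C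
    -- c * q`, and the rescaling of `F` supplies the constant `c`.
    · simp [h]; ring
  left_inv v := by
    have e : (Polynomial.C a * Polynomial.X + Polynomial.C b).comp
        (Polynomial.C a⁻¹ * (Polynomial.X - Polynomial.C b)) = Polynomial.X := by
      simp [← mul_assoc, ← Polynomial.C_mul, ha]
    apply ext <;> simp [Polynomial.comp_assoc, e, ← mul_assoc, ← Polynomial.C_mul, hc]
  right_inv v := by
    have e : (Polynomial.C a⁻¹ * (Polynomial.X - Polynomial.C b)).comp
        (Polynomial.C a * Polynomial.X + Polynomial.C b) = Polynomial.X := by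
      simp [← mul_assoc, ← Polynomial.C_mul, ha]
    apply ext <;> simp [Polynomial.comp_assoc, e, ← mul_assoc, ← Polynomial.C_mul, hc]

end TwistedSl2

namespace Onsager

open Polynomial
open Polynomial.Chebyshev (T U T_add_two U_add_two T_sub_one U_sub_one T_neg U_neg_sub_one
  T_eq_X_mul_T_sub_pol_U U_eq_X_mul_U_add_T T_ne_zero U_ne_zero degree_U_natCast)

/-- The structure constant of the realisation of the Onsager algebra as a twisted `𝔰𝔩₂`. -/
abbrev twist : Polynomial ℂ := 4 * (X ^ 2 - 1)

/-- The image of `A k`. -/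
def imageA (k : ℤ) : TwistedSl2 twist := .mk _ (-U ℂ (k - 1)) (U ℂ (k - 1)) (2 * T ℂ k)

/-- The image of `G m`. -/
def imageG (m : ℤ) : TwistedSl2 twist := .mk _ (U ℂ (m - 1)) (U ℂ (m - 1)) 0

theorem imageG_neg (m : ℤ) : imageG (-m) = -imageG m := by
  apply TwistedSl2.ext <;> simp [imageG, U_neg_sub_one]

/-- The linear map sending the basis of the Onsager algebra to its images. -/
def toTwisted : Onsager →ₗ[ℂ] TwistedSl2 twist :=
  basis.constr ℂ (Sum.elim imageA fun m => imageG m)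

theorem toTwisted_A (k : ℤ) : toTwisted (A k) = imageA k := by
  simp [toTwisted, A]

theorem toTwisted_G (m : ℤ) : toTwisted (G m) = imageG m := by
  have hp : ∀ n : ℕ+, toTwisted (G (n : ℤ)) = imageG n := fun n => by
    rw [G_pos]; simp [toTwisted]
  rcases lt_trichotomy m 0 with h | h | h
  · obtain ⟨n, rfl⟩ : ∃ n : ℕ+, m = -(n : ℤ) :=
      ⟨⟨m.natAbs, by omega⟩, by simp only [PNat.mk_coe]; omega⟩
    rw [G_neg, map_neg, hp, imageG_neg]
  · subst h
    rw [show G 0 = 0 by simp [G], map_zero]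
    apply TwistedSl2.ext <;> simp [imageG]
  · obtain ⟨n, rfl⟩ : ∃ n : ℕ+, m = (n : ℤ) :=
      ⟨⟨m.natAbs, by omega⟩, by simp only [PNat.mk_coe]; omega⟩
    exact hp n

/-- The `E`- and `F`-coefficients are the subtraction formula for the sine. The `H`-coefficient
vanishes because the `E`- and `F`-coefficients of each `imageA k` are opposite. -/
theorem lie_imageA_imageA (k l : ℤ) : ⁅imageA k, imageA l⁆ = (4 : ℂ) • imageG (k - l) := by
  apply TwistedSl2.ext <;>
    simp [imageA, imageG, chebyshev_U_sub, Polynomial.smul_eq_C_mul, map_ofNat] <;> ring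

/-- Differences of the addition and subtraction formulas; the `H`-coefficient fixes the factor `4`
in `twist`. -/
theorem lie_imageA_imageG (k m : ℤ) :
    ⁅imageA k, imageG m⁆ = (2 : ℂ) • (imageA (k - m) - imageA (k + m)) := by
  apply TwistedSl2.ext <;>
    simp [imageA, imageG, chebyshev_U_sub, chebyshev_U_add, chebyshev_T_sub, chebyshev_T_add,
      Polynomial.smul_eq_C_mul, map_ofNat] <;> ring

theorem lie_imageG_imageG (m n : ℤ) : ⁅imageG m, imageG n⁆ = 0 := by
  apply TwistedSl2.ext <;> simp [imageG]

theorem lie_A_A (k l : ℤ) : ⁅A k, A l⁆ = (4 : ℂ) • G (k - l) := bracketHom_A_A k l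
theorem lie_A_G (k m : ℤ) : ⁅A k, G m⁆ = (2 : ℂ) • (A (k - m) - A (k + m)) := bracketHom_A_G k m
theorem lie_G_G (m n : ℤ) : ⁅G m, G n⁆ = 0 := bracketHom_G_G m n

theorem induction_A_G {P : Onsager → Prop} (hA : ∀ k, P (A k)) (hG : ∀ m, P (G m))
    (ha : ∀ x y, P x → P y → P (x + y)) (hs : ∀ (c : ℂ) x, P x → P (c • x)) (x : Onsager) :
    P x := by
  refine induction (fun i => ?_) ?_ ha hs x
  · rcases i with k | m
    · exact hA k
    · rw [← G_pos]; exact hG m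
  · simpa using hs 0 _ (hA 0)

theorem toTwisted_lie (x y : Onsager) : toTwisted ⁅x, y⁆ = ⁅toTwisted x, toTwisted y⁆ := by
  induction x using induction_A_G with
  | ha x x' h h' => simp only [add_lie, map_add, h, h']
  | hs c x h => simp only [smul_lie, map_smul, h]
  | hA k =>
    induction y using induction_A_G with
    | ha x x' h h' => simp only [lie_add, map_add, h, h']
    | hs c x h => simp only [lie_smul, map_smul, h]
    | hA l => simp only [lie_A_A, map_smul, toTwisted_A, toTwisted_G, lie_imageA_imageA]
    | hG l => simp only [lie_A_G, map_smul, map_sub, toTwisted_A, toTwisted_G, lie_imageA_imageG]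
  | hG k =>
    induction y using induction_A_G with
    | ha x x' h h' => simp only [lie_add, map_add, h, h']
    | hs c x h => simp only [lie_smul, map_smul, h]
    | hA l =>
      rw [← lie_skew, ← lie_skew (toTwisted _)]
      simp only [lie_A_G, map_neg, map_smul, map_sub, toTwisted_A, toTwisted_G, lie_imageA_imageG]
    | hG l => simp only [lie_G_G, map_zero, toTwisted_G, lie_imageG_imageG]

/-- The inverse of `toTwisted`. -/
def ofTwisted : TwistedSl2 twist →ₗ[ℂ] Onsager where
  toFun v :=
    -- Since `T` is even and `U (k - 1)` is odd in `k`, the images of `A k + A (-k)`, `A k - A (-k)`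
    -- and `G k` are `4 T k H`, `2 U (k - 1) (F - E)` and `U (k - 1) (E + F)`; solving for the
    -- coefficients gives the three terms.
    basisT.constr ℂ (fun n => (4⁻¹ : ℂ) • (A n + A (-n))) v.coeffH +
    basisU.constr ℂ (fun n => (4⁻¹ : ℂ) • (A (n + 1) - A (-(n + 1)))) (v.coeffF - v.coeffE) +
    basisU.constr ℂ (fun n => (2⁻¹ : ℂ) • G (n + 1)) (v.coeffF + v.coeffE)
  map_add' v w := by simp only [TwistedSl2.add_coeffE, TwistedSl2.add_coeffF,
    TwistedSl2.add_coeffH, map_add, map_sub]; abel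
  map_smul' c v := by simp [smul_sub, smul_add]

theorem constr_T (k : ℤ) :
    basisT.constr ℂ (fun n : ℕ => (4⁻¹ : ℂ) • (A n + A (-n))) (T ℂ k)
      = (4⁻¹ : ℂ) • (A k + A (-k)) := by
  obtain ⟨n, rfl | rfl⟩ := k.eq_nat_or_neg
  · rw [← basisT_apply, Module.Basis.constr_basis]
  · rw [T_neg, ← basisT_apply, Module.Basis.constr_basis, neg_neg, add_comm]

/-- The basis contains only `U n` with `n ≥ 0`; oddness extends the rule to all indices, `k = 0`
matching `U (-1) = 0`. -/
theorem constr_U {M : Type*} [AddCommGroup M] [Module ℂ M] (f : ℤ → M)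
    (hf : ∀ k, f (-k) = -f k) (k : ℤ) :
    basisU.constr ℂ (fun n : ℕ => f (n + 1)) (U ℂ (k - 1)) = f k := by
  obtain ⟨n, rfl | rfl⟩ := k.eq_nat_or_neg
  · rcases n with _ | n
    · have h0 : f 0 = 0 := by
        have := hf 0
        rw [neg_zero, eq_neg_iff_add_eq_zero, ← two_smul ℂ] at this
        simpa using this
      simp [h0]
    · rw [show ((n + 1 : ℕ) : ℤ) - 1 = n by push_cast; ring, ← basisU_apply,
        Module.Basis.constr_basis]
      push_cast; rfl
  · rw [U_neg_sub_one, map_neg, hf, neg_inj]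
    rcases n with _ | n
    · have h0 : f 0 = 0 := by
        have := hf 0
        rw [neg_zero, eq_neg_iff_add_eq_zero, ← two_smul ℂ] at this
        simpa using this
      simp [h0]
    · rw [show ((n + 1 : ℕ) : ℤ) - 1 = n by push_cast; ring, ← basisU_apply,
        Module.Basis.constr_basis]
      push_cast; rfl

theorem ofTwisted_imageA (k : ℤ) : ofTwisted (imageA k) = A k := by
  have h := constr_U (fun k => (4⁻¹ : ℂ) • (A k - A (-k)))
    (fun k => by rw [← smul_neg, neg_sub, neg_neg]) k
  have e : (2 : Polynomial ℂ) * T ℂ k = (2 : ℂ) • T ℂ k := by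
    simp [Polynomial.smul_eq_C_mul, map_ofNat]
  simp only [ofTwisted, imageA, LinearMap.coe_mk, AddHom.coe_mk, TwistedSl2.mk_coeffE,
    TwistedSl2.mk_coeffF, TwistedSl2.mk_coeffH, sub_neg_eq_add, map_add, map_neg,
    e, map_smul, constr_T, h]
  module

theorem ofTwisted_imageG (m : ℤ) : ofTwisted (imageG m) = G m := by
  have h := constr_U (fun k => (2⁻¹ : ℂ) • G k)
    (fun k => by rw [← smul_neg, G_neg]) m
  simp only [ofTwisted, imageG, LinearMap.coe_mk, AddHom.coe_mk, TwistedSl2.mk_coeffE,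
    TwistedSl2.mk_coeffF, TwistedSl2.mk_coeffH, sub_self, map_zero, map_add, h]
  module

theorem ofTwisted_toTwisted (x : Onsager) : ofTwisted (toTwisted x) = x := by
  induction x using induction_A_G with
  | ha x y h h' => rw [map_add, map_add, h, h']
  | hs c x h => rw [map_smul, map_smul, h]
  | hA k => rw [toTwisted_A, ofTwisted_imageA]
  | hG m => rw [toTwisted_G, ofTwisted_imageG]

/-- The embedding `q ↦ E ⊗ a q + F ⊗ b q + H ⊗ c q`. -/
def lineMap (a b c : ℂ) : Polynomial ℂ →ₗ[ℂ] TwistedSl2 twist where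
  toFun q := .mk _ (a • q) (b • q) (c • q)
  map_add' q r := by apply TwistedSl2.ext <;> simp
  map_smul' s q := by apply TwistedSl2.ext <;> simp [smul_comm s]

theorem toTwisted_ofTwisted (v : TwistedSl2 twist) : toTwisted (ofTwisted v) = v := by
  have hT : toTwisted ∘ₗ basisT.constr ℂ (fun n : ℕ => (4⁻¹ : ℂ) • (A n + A (-n)))
      = lineMap 0 0 1 := by
    refine basisT.ext fun n => ?_
    simp only [LinearMap.comp_apply, Module.Basis.constr_basis, map_smul, map_add, toTwisted_A]
    apply TwistedSl2.ext
    · simp [lineMap, imageA, U_neg_sub_one, basisT_apply]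
    · simp [lineMap, imageA, U_neg_sub_one, basisT_apply]
    · simp only [lineMap, imageA, basisT_apply, TwistedSl2.smul_coeffH, LinearMap.coe_mk,
        AddHom.coe_mk, TwistedSl2.add_coeffH, TwistedSl2.mk_coeffH, T_neg, two_mul]
      module
  have hU : toTwisted ∘ₗ basisU.constr ℂ (fun n : ℕ => (4⁻¹ : ℂ) • (A (n + 1) - A (-(n + 1))))
      = lineMap (-2⁻¹) 2⁻¹ 0 := by
    refine basisU.ext fun n => ?_
    simp only [LinearMap.comp_apply, Module.Basis.constr_basis, map_smul, map_sub, toTwisted_A]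
    apply TwistedSl2.ext
    · simp only [lineMap, imageA, basisU_apply, TwistedSl2.smul_coeffE, LinearMap.coe_mk,
        AddHom.coe_mk, TwistedSl2.sub_coeffE, TwistedSl2.mk_coeffE, U_neg_sub_one,
        add_sub_cancel_right]
      module
    · simp only [lineMap, imageA, basisU_apply, TwistedSl2.smul_coeffF, LinearMap.coe_mk,
        AddHom.coe_mk, TwistedSl2.sub_coeffF, TwistedSl2.mk_coeffF, U_neg_sub_one,
        add_sub_cancel_right]
      module
    · simp only [lineMap, imageA, TwistedSl2.smul_coeffH, LinearMap.coe_mk,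
        AddHom.coe_mk, TwistedSl2.sub_coeffH, TwistedSl2.mk_coeffH, T_neg]
      module
  have hG : toTwisted ∘ₗ basisU.constr ℂ (fun n : ℕ => (2⁻¹ : ℂ) • G (n + 1))
      = lineMap 2⁻¹ 2⁻¹ 0 := by
    refine basisU.ext fun n => ?_
    simp only [LinearMap.comp_apply, Module.Basis.constr_basis, map_smul, toTwisted_G]
    apply TwistedSl2.ext <;> simp [lineMap, imageG, basisU_apply]
  have h1 := congrArg (fun f : Polynomial ℂ →ₗ[ℂ] TwistedSl2 twist => f v.coeffH) hT
  have h2 := congrArg (fun f : Polynomial ℂ →ₗ[ℂ] TwistedSl2 twist => f (v.coeffF - v.coeffE)) hU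
  have h3 := congrArg (fun f : Polynomial ℂ →ₗ[ℂ] TwistedSl2 twist => f (v.coeffF + v.coeffE)) hG
  simp only [LinearMap.comp_apply] at h1 h2 h3
  change toTwisted (_ + _ + _) = v
  rw [map_add, map_add, h1, h2, h3]
  apply TwistedSl2.ext <;>
    simp only [lineMap, LinearMap.coe_mk, AddHom.coe_mk, TwistedSl2.add_coeffE,
      TwistedSl2.add_coeffF, TwistedSl2.add_coeffH, TwistedSl2.mk_coeffE, TwistedSl2.mk_coeffF,
      TwistedSl2.mk_coeffH] <;> module

/-- The Onsager algebra is the twisted `𝔰𝔩₂` with structure constant `4 (X² - 1)`. -/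
def equivTwisted : Onsager ≃ₗ⁅ℂ⁆ TwistedSl2 twist :=
  { toTwisted with
    map_lie' := fun {x y} => toTwisted_lie x y
    invFun := ofTwisted
    left_inv := ofTwisted_toTwisted
    right_inv := toTwisted_ofTwisted }

/-- A quadratic structure constant with distinct roots gives the Onsager algebra. -/
theorem nonempty_equiv_of_quadratic {p : Polynomial ℂ} {a r s : ℂ} (ha : a ≠ 0) (hrs : r ≠ s)
    (hp : p = C a * ((X - C r) * (X - C s))) : Nonempty (TwistedSl2 p ≃ₗ⁅ℂ⁆ Onsager) := by
  have h : r - s ≠ 0 := sub_ne_zero.mpr hrs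
  -- The affine map sends `1, -1`, the roots of `twist`, to `r, s`; the constant is `a ((r - s) /
  -- 2)²` divided by the leading coefficient `4` of `twist`.
  refine ⟨(TwistedSl2.affineEquiv p twist ((r - s) / 2) ((r + s) / 2) (a * (r - s) ^ 2 / 16)
    (by simpa using h)
    (by simpa using ⟨ha, h⟩) ?_).trans equivTwisted.symm⟩
  subst hp
  have e1 : ((r + s) / 2) - r = -((r - s) / 2) := by ring
  have e2 : ((r + s) / 2) - s = ((r - s) / 2) := by ring
  simp only [mul_comp, sub_comp, X_comp, C_comp, add_sub_assoc, ← C_sub, e1, e2]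
  have : (C (a * (r - s) ^ 2 / 16) : Polynomial ℂ) * 4 = C a * C ((r - s) / 2) ^ 2 := by
    rw [← map_ofNat C 4, ← C_pow, ← C_mul, ← C_mul]; congr 1; ring
  rw [← mul_assoc (C _) 4, this, C_neg]
  ring

/-! ### The abelianization of the Onsager algebra -/

/-- A linear functional on the Onsager algebra that vanishes on brackets. -/
theorem exists_functional : ∃ f : Onsager →ₗ[ℂ] ℂ, (∀ x y : Onsager, f ⁅x, y⁆ = 0) ∧ f ≠ 0 := by
  -- Brackets of basis elements are multiples of `G`'s or of differences of two `A`'s, so counting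
  -- the `A`'s with coefficients kills them.
  let f : Onsager →ₗ[ℂ] ℂ := basis.constr ℂ (Sum.elim (fun _ => 1) fun _ => 0)
  have fA : ∀ k, f (A k) = 1 := fun k => by simp [f, A]
  have fG : ∀ m, f (G m) = 0 := fun m => by
    unfold G
    split_ifs
    · rw [map_smul, Module.Basis.constr_basis]
      exact smul_zero _
    · exact map_zero f
  refine ⟨f, fun x y => ?_, fun h => by simpa [h] using fA 0⟩
  induction x using induction_A_G with
  | ha x x' h h' => simp only [add_lie, map_add, h, h', add_zero]
  | hs c x h => simp only [smul_lie, map_smul, h, smul_zero]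
  | hA k =>
    induction y using induction_A_G with
    | ha x x' h h' => simp only [lie_add, map_add, h, h', add_zero]
    | hs c x h => simp only [lie_smul, map_smul, h, smul_zero]
    | hA l => simp [lie_A_A, fG]
    | hG l => simp [lie_A_G, fA]
  | hG k =>
    induction y using induction_A_G with
    | ha x x' h h' => simp only [lie_add, map_add, h, h', add_zero]
    | hs c x h => simp only [lie_smul, map_smul, h, smul_zero]
    | hA l => rw [← lie_skew]; simp [lie_A_G, fA]
    | hG l => simp [lie_G_G]

/-- A linear map on the Onsager algebra that vanishes on brackets has its values in the span of
its values at `A 0` and `A 1`. -/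
theorem mem_span_of_lie_eq_zero {M : Type*} [AddCommGroup M] [Module ℂ M] (f : Onsager →ₗ[ℂ] M)
    (hf : ∀ x y : Onsager, f ⁅x, y⁆ = 0) (x : Onsager) :
    f x ∈ Submodule.span ℂ {f (A 0), f (A 1)} := by
  have hG : ∀ m, f (G m) = 0 := fun m => by
    have := hf (A m) (A 0)
    rw [lie_A_A, map_smul, sub_zero] at this
    simpa using this
  -- The bracket of `A (k + 1)` with `G 1` is `2 (A k - A (k + 2))`, so `f (A k)` depends only on
  -- the parity of `k`.
  have hA : ∀ k, f (A (k + 2)) = f (A k) := fun k => by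
    have := hf (A (k + 1)) (G 1)
    rw [lie_A_G, map_smul, map_sub, show k + 1 - 1 = k by ring,
      show k + 1 + 1 = k + 2 by ring] at this
    have h2 := (smul_eq_zero.mp this).resolve_left two_ne_zero
    exact (sub_eq_zero.mp h2).symm
  have hA' : ∀ n : ℤ, f (A (2 * n)) = f (A 0) ∧ f (A (2 * n + 1)) = f (A 1) := by
    intro n
    induction n using Int.induction_on with
    | zero => simp
    | succ n ih =>
      rw [show 2 * ((n : ℤ) + 1) = 2 * n + 2 by ring, hA,
        show 2 * (n : ℤ) + 2 + 1 = 2 * n + 1 + 2 by ring, hA]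
      exact ih
    | pred n ih =>
      rw [← hA (2 * (-(n : ℤ) - 1)), ← hA (2 * (-(n : ℤ) - 1) + 1)]
      rw [show 2 * (-(n : ℤ) - 1) + 2 = 2 * -n by ring,
        show 2 * (-(n : ℤ) - 1) + 1 + 2 = 2 * -n + 1 by ring]
      exact ih
  induction x using induction_A_G with
  | ha x y h h' => rw [map_add]; exact add_mem h h'
  | hs c x h => rw [map_smul]; exact Submodule.smul_mem _ c h
  | hA k =>
    obtain ⟨n, h | h⟩ := Int.even_or_odd' k
    · rw [h, (hA' n).1]; exact Submodule.subset_span (by simp)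
    · rw [h, (hA' n).2]; exact Submodule.subset_span (by simp)
  | hG m => rw [hG]; exact zero_mem _

/-- A perfect Lie algebra is not isomorphic to the Onsager algebra. -/
theorem not_equiv_of_perfect {𝔤 : Type*} [LieRing 𝔤] [LieAlgebra ℂ 𝔤]
    (h : Submodule.span ℂ {m | ∃ x y : 𝔤, ⁅x, y⁆ = m} = ⊤) : ¬ Nonempty (𝔤 ≃ₗ⁅ℂ⁆ Onsager) := by
  rintro ⟨φ⟩
  obtain ⟨f, hf, hf0⟩ := exists_functional
  apply hf0
  have h0 : f ∘ₗ (φ : 𝔤 →ₗ[ℂ] Onsager) = 0 := by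
    refine LinearMap.ext_on h ?_
    rintro _ ⟨x, y, rfl⟩
    change f (φ ⁅x, y⁆) = 0
    rw [LieEquiv.map_lie, hf]
  ext x
  have := congrArg (fun g : 𝔤 →ₗ[ℂ] ℂ => g (φ.symm x)) h0
  change f (φ (φ.symm x)) = 0 at this
  simpa using this

/-- A twisted `𝔰𝔩₂` whose structure constant is a cubic is not isomorphic to the Onsager
algebra. -/
theorem not_equiv_of_cubic {p : Polynomial ℂ} (hp : p.natDegree = 3) :
    ¬ Nonempty (TwistedSl2 p ≃ₗ⁅ℂ⁆ Onsager) := by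
  rintro ⟨φ⟩
  -- The `H`-coefficient of a bracket is divisible by `p`, so reducing it modulo `p` gives a
  -- surjection onto a space of dimension `3` that kills all brackets.
  let m : TwistedSl2 p →ₗ[ℂ] AdjoinRoot p :=
    (AdjoinRoot.mkₐ p).toLinearMap ∘ₗ LinearMap.snd ℂ _ _ ∘ₗ LinearMap.snd ℂ _ _
  have hm : ∀ v, m v = AdjoinRoot.mk p v.coeffH := fun v => rfl
  let f : Onsager →ₗ[ℂ] AdjoinRoot p := m ∘ₗ (φ.symm : Onsager →ₗ[ℂ] TwistedSl2 p)
  have hf : ∀ x, f x = m (φ.symm x) := fun x => rfl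
  have h0 : ∀ x y : Onsager, f ⁅x, y⁆ = 0 := fun x y => by
    rw [hf, LieEquiv.map_lie, hm, TwistedSl2.lie_coeffH, map_mul, AdjoinRoot.mk_self, zero_mul]
  have hp0 : p ≠ 0 := by rintro rfl; simp at hp
  have htop : (⊤ : Submodule ℂ (AdjoinRoot p)) ≤ Submodule.span ℂ {f (A 0), f (A 1)} := by
    intro x _
    obtain ⟨q, rfl⟩ := AdjoinRoot.mk_surjective x
    have := mem_span_of_lie_eq_zero f h0 (φ (.mk p 0 0 q))
    rwa [hf (φ _), LieEquiv.symm_apply_apply] at this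
  have hfin : Module.finrank ℂ (AdjoinRoot p) = 3 := by
    rw [(AdjoinRoot.powerBasis hp0).finrank, AdjoinRoot.powerBasis_dim, hp]
  have h2 := finrank_span_le_card (R := ℂ) ({f (A 0), f (A 1)} : Set (AdjoinRoot p))
  rw [top_le_iff.mp htop, finrank_top, hfin] at h2
  have h3 : ({f (A 0), f (A 1)} : Set (AdjoinRoot p)).toFinset.card ≤ 2 := by
    rw [Set.toFinset_card, ← Nat.card_eq_fintype_card, Nat.card_coe_set_eq]
    exact (Set.ncard_insert_le _ _).trans (by simp)
  omega

end Onsager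

/-! ### Finite order automorphisms of `𝔰𝔩₂` -/

namespace sl2

theorem apply_one_one (x : sl2) : x.1 1 1 = -x.1 0 0 := by
  have := x.2
  change Matrix.traceLinearMap (Fin 2) ℂ ℂ x.1 = 0 at this
  rw [Matrix.traceLinearMap_apply, Matrix.trace_fin_two] at this
  linear_combination this

theorem ext {x y : sl2} (h1 : x.1 0 1 = y.1 0 1) (h2 : x.1 1 0 = y.1 1 0)
    (h3 : x.1 0 0 = y.1 0 0) : x = y := by
  apply Subtype.ext
  ext i j
  fin_cases i <;> fin_cases j
  · exact h3
  · exact h1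
  · exact h2
  · change x.1 1 1 = y.1 1 1
    rw [apply_one_one, apply_one_one, h3]

theorem lie_apply (x y : sl2) (i j : Fin 2) :
    (⁅x, y⁆ : sl2).1 i j = (x.1 * y.1) i j - (y.1 * x.1) i j := rfl

theorem lie_zero_one (x y : sl2) :
    (⁅x, y⁆ : sl2).1 0 1 = 2 * (x.1 0 0 * y.1 0 1 - x.1 0 1 * y.1 0 0) := by
  simp only [lie_apply, Matrix.mul_apply, Fin.sum_univ_two, apply_one_one]; ring

theorem lie_one_zero (x y : sl2) :
    (⁅x, y⁆ : sl2).1 1 0 = 2 * (x.1 1 0 * y.1 0 0 - x.1 0 0 * y.1 1 0) := by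
  simp only [lie_apply, Matrix.mul_apply, Fin.sum_univ_two, apply_one_one]; ring

theorem lie_zero_zero (x y : sl2) :
    (⁅x, y⁆ : sl2).1 0 0 = x.1 0 1 * y.1 1 0 - x.1 1 0 * y.1 0 1 := by
  simp only [lie_apply, Matrix.mul_apply, Fin.sum_univ_two]; ring

theorem add_apply (x y : sl2) (i j : Fin 2) : (x + y).1 i j = x.1 i j + y.1 i j := rfl
theorem sub_apply (x y : sl2) (i j : Fin 2) : (x - y).1 i j = x.1 i j - y.1 i j := rfl
theorem smul_apply (c : ℂ) (x : sl2) (i j : Fin 2) : (c • x).1 i j = c * x.1 i j := rfl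
theorem zero_apply (i j : Fin 2) : (0 : sl2).1 i j = 0 := rfl

/-- The trace form. -/
def form : sl2 →ₗ[ℂ] sl2 →ₗ[ℂ] ℂ :=
  LinearMap.mk₂ ℂ (fun x y => 2 * x.1 0 0 * y.1 0 0 + x.1 0 1 * y.1 1 0 + x.1 1 0 * y.1 0 1)
    (fun x x' y => by simp only [add_apply]; ring)
    (fun c x y => by simp only [smul_apply, smul_eq_mul]; ring)
    (fun x y y' => by simp only [add_apply]; ring)
    (fun c x y => by simp only [smul_apply, smul_eq_mul]; ring)

theorem form_apply (x y : sl2) :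
    form x y = 2 * x.1 0 0 * y.1 0 0 + x.1 0 1 * y.1 1 0 + x.1 1 0 * y.1 0 1 := rfl

theorem form_comm (x y : sl2) : form x y = form y x := by
  simp only [form_apply]; ring

theorem form_lie (x y z : sl2) : form ⁅x, y⁆ z = form x ⁅y, z⁆ := by
  simp only [form_apply, lie_zero_one, lie_one_zero, lie_zero_zero]; ring

/-- The double cross product identity of three-dimensional geometry. It ties the trace form to `ad
x`, and through it automorphisms are seen to be isometries. -/
theorem lie_lie_self (x y : sl2) :
    ⁅x, ⁅x, y⁆⁆ = (2 * form x x) • y - (2 * form x y) • x := by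
  apply ext <;>
    simp only [form_apply, lie_zero_one, lie_one_zero, lie_zero_zero, sub_apply, smul_apply] <;>
    ring

@[simp] theorem matE_apply : matE.1 = !![0, 1; 0, 0] := rfl
@[simp] theorem matF_apply : matF.1 = !![0, 0; 1, 0] := rfl
@[simp] theorem matH_apply : matH.1 = !![1, 0; 0, -1] := rfl

theorem eq_zero_of_form (x : sl2) (h : ∀ y, form x y = 0) : x = 0 := by
  apply ext
  · simpa [form_apply] using h matF
  · simpa [form_apply] using h matE
  · simpa [form_apply] using h matH

theorem eq_sum (x : sl2) : x = x.1 0 1 • matE + x.1 1 0 • matF + x.1 0 0 • matH := by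
  apply ext <;> simp [add_apply, smul_apply]

/-- The standard coordinates on `𝔰𝔩₂`. -/
def coordEquiv : sl2 ≃ₗ[ℂ] (Fin 3 → ℂ) where
  toFun x := ![x.1 0 1, x.1 1 0, x.1 0 0]
  invFun v := v 0 • matE + v 1 • matF + v 2 • matH
  map_add' x y := by ext i; fin_cases i <;> rfl
  map_smul' c x := by ext i; fin_cases i <;> rfl
  left_inv x := (eq_sum x).symm
  right_inv v := by
    ext i; fin_cases i <;> simp [add_apply, smul_apply]

theorem coordEquiv_apply (x : sl2) (i : Fin 3) :
    coordEquiv x i = ![x.1 0 1, x.1 1 0, x.1 0 0] i := rfl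

theorem finrank_eq : Module.finrank ℂ sl2 = 3 := by
  rw [coordEquiv.finrank_eq]; simp

theorem finite : Module.Finite ℂ sl2 := Module.Finite.equiv coordEquiv.symm

/-- A basis `e, f, h` of `𝔰𝔩₂` with the standard commutation relations. -/
structure IsStandard (b : Module.Basis (Fin 3) ℂ sl2) : Prop where
  lie_h_e : ⁅b 2, b 0⁆ = (2 : ℂ) • b 0
  lie_h_f : ⁅b 2, b 1⁆ = (-2 : ℂ) • b 1
  lie_e_f : ⁅b 0, b 1⁆ = b 2

/-- A triple with the standard relations and a semisimple `h` is a basis. -/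
theorem exists_basis {e f h : sl2} (he : ⁅h, e⁆ = (2 : ℂ) • e) (hf : ⁅h, f⁆ = (-2 : ℂ) • f)
    (hef : ⁅e, f⁆ = h) (hh : form h h = 2) :
    ∃ b : Module.Basis (Fin 3) ℂ sl2, IsStandard b ∧ b 0 = e ∧ b 1 = f ∧ b 2 = h := by
  -- Invariance of the form pairs only opposite weights of `ad h`; the resulting Gram matrix is
  -- nondegenerate, which yields linear independence.
  have fee : form e e = 0 := by
    have := form_lie h e e
    rw [he, lie_self, map_smul, LinearMap.smul_apply, map_zero] at this
    simpa using this
  have fff : form f f = 0 := by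
    have := form_lie h f f
    rw [hf, lie_self, map_smul, LinearMap.smul_apply, map_zero] at this
    simpa using this
  have fhe : form h e = 0 := by
    have := form_lie h h e
    rw [he, lie_self, map_smul, map_zero, LinearMap.zero_apply] at this
    simpa using this.symm
  have fhf : form h f = 0 := by
    have := form_lie h h f
    rw [hf, lie_self, map_smul, map_zero, LinearMap.zero_apply] at this
    simpa using this.symm
  have fef : form e f = 1 := by
    have := form_lie h e f
    rw [he, hef, hh, map_smul, LinearMap.smul_apply, smul_eq_mul] at this
    linear_combination this / 2
  have hli : LinearIndependent ℂ ![e, f, h] := by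
    rw [Fintype.linearIndependent_iff]
    intro g hg
    simp only [Fin.sum_univ_three, Matrix.cons_val] at hg
    have h0 := congrArg (form f) hg
    have h1 := congrArg (form e) hg
    have h2 := congrArg (form h) hg
    simp only [map_add, map_smul, fee, fff, fhe, fhf, fef, hh, map_zero, smul_eq_mul,
      form_comm f e, form_comm f h, form_comm e h] at h0 h1 h2
    intro i
    fin_cases i
    · simpa using h0
    · simpa using h1
    · simpa using h2
  have := finite
  refine ⟨basisOfLinearIndependentOfCardEqFinrank hli (by simp [finrank_eq]), ⟨?_, ?_, ?_⟩, ?_⟩ <;>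
    simp [he, hf, hef]

theorem isStandard_matrices :
    ∃ b : Module.Basis (Fin 3) ℂ sl2, IsStandard b ∧ b 0 = matE ∧ b 1 = matF ∧ b 2 = matH := by
  apply exists_basis
  · apply ext <;> simp [lie_zero_one, lie_one_zero, lie_zero_zero, smul_apply]
  · apply ext <;> simp [lie_zero_one, lie_one_zero, lie_zero_zero]
  · apply ext <;> simp [lie_zero_one, lie_one_zero, lie_zero_zero]
  · simp [form_apply]

/-- A vector of norm `2` is the `h` of a standard basis. -/
theorem exists_isStandard {h : sl2} (hh : form h h = 2) :
    ∃ b : Module.Basis (Fin 3) ℂ sl2, IsStandard b ∧ b 2 = h := by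
  have hq : h.1 0 0 * h.1 0 0 + h.1 0 1 * h.1 1 0 = 1 := by
    rw [form_apply] at hh; linear_combination hh / 2
  -- `ad h` is a root of `t (t - 2) (t + 2)`, so `ad h (ad h + 2)` and `ad h (ad h - 2)` project, up
  -- to scalars, onto the eigenspaces for `2` and `-2`.
  have key : ∀ y : sl2, ⁅h, ⁅h, ⁅h, y⁆⁆⁆ = (4 : ℂ) • ⁅h, y⁆ := fun y => by
    rw [lie_lie_self, ← form_lie, lie_self, hh]
    simp; norm_num
  -- If this operator vanished on `matE` and `matF`, the lower left entry of `h` would be `0`, so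
  -- its diagonal entry would have square `1`, whereas two further entries add up to eight times
  -- that square.
  obtain ⟨y, hy⟩ : ∃ y : sl2, ⁅h, ⁅h, y⁆⁆ + (2 : ℂ) • ⁅h, y⁆ ≠ 0 := by
    by_contra! H
    have h1 := H matE
    have h2 := H matF
    have e1 := congrArg (fun x : sl2 => x.1 1 0) h1
    have e2 := congrArg (fun x : sl2 => x.1 0 1) h1
    have e3 := congrArg (fun x : sl2 => x.1 1 0) h2
    simp [add_apply, smul_apply, lie_zero_one, lie_one_zero, lie_zero_zero, zero_apply] at e1 e2 e3
    rw [e1] at hq e2 e3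
    have : (8 : ℂ) = 0 := by linear_combination (-8 : ℂ) * hq + e2 + e3
    norm_num at this
  set e := ⁅h, ⁅h, y⁆⁆ + (2 : ℂ) • ⁅h, y⁆ with he
  have he2 : ⁅h, e⁆ = (2 : ℂ) • e := by
    rw [he, lie_add, lie_smul, key]; module
  obtain ⟨z, hz⟩ : ∃ z, form e z ≠ 0 := by
    by_contra! H
    exact hy (eq_zero_of_form e H)
  have inv : ∀ w, form e ⁅h, w⁆ = -2 * form e w := fun w => by
    rw [← form_lie, ← lie_skew, he2]; simp
  set f := ⁅h, ⁅h, z⁆⁆ - (2 : ℂ) • ⁅h, z⁆ with hf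
  have hf2 : ⁅h, f⁆ = (-2 : ℂ) • f := by
    rw [hf, lie_sub, lie_smul, key]; module
  -- Under `form e` each `ad h` acts as `-2`, whence `(-2)² - 2 · (-2) = 8`.
  have hef : form e f = 8 * form e z := by
    rw [hf, map_sub, map_smul, inv, inv, smul_eq_mul]; ring
  have hc : form e f ≠ 0 := by rw [hef]; simpa using hz
  -- The weights of `e` and `f` cancel, so `⁅e, f⁆` commutes with `h`, and `lie_lie_self` makes it a
  -- multiple of `h`.
  have hlie : ⁅e, f⁆ = form e f • h := by
    have h0 : ⁅h, ⁅e, f⁆⁆ = 0 := by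
      rw [leibniz_lie, he2, hf2, smul_lie, lie_smul]; module
    have h1 := lie_lie_self h ⁅e, f⁆
    rw [h0, lie_zero, hh, ← form_lie, he2, map_smul, LinearMap.smul_apply, smul_eq_mul] at h1
    have h2 : (4 : ℂ) • ⁅e, f⁆ = (4 : ℂ) • (form e f • h) := by
      rw [eq_comm, sub_eq_zero] at h1
      rw [smul_smul]
      convert h1 using 2 <;> ring
    exact smul_right_injective _ (by norm_num : (4 : ℂ) ≠ 0) h2
  obtain ⟨b, hb, -, -, h3⟩ := exists_basis (e := e) (f := (form e f)⁻¹ • f) (h := h) he2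
    (by rw [lie_smul, hf2, smul_comm]) (by rw [lie_smul, hlie, smul_smul, inv_mul_cancel₀ hc,
      one_smul]) hh
  exact ⟨b, hb, h3⟩

/-! ### Automorphisms of `𝔰𝔩₂` as isometries, and their fixed vectors -/

theorem form_map_self {φ : sl2 ≃ₗ[ℂ] sl2} (hφ : φ ∈ lieAut sl2) (x : sl2) :
    form (φ x) (φ x) = form x x := by
  by_cases hx : x = 0
  · simp [hx]
  -- The cube of `ad x` is `2 form x x` times `ad x`, and `φ` intertwines `ad x` with `ad (φ x)`; so
  -- the two scalars agree unless `φ x` is central, hence zero.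
  have h1 : ∀ y : sl2, (form (φ x) (φ x) - form x x) • ⁅φ x, y⁆ = 0 := fun y => by
    obtain ⟨y, rfl⟩ := φ.surjective y
    have e1 := lie_lie_self (φ x) ⁅φ x, φ y⁆
    have e2 := congrArg φ (lie_lie_self x ⁅x, y⁆)
    rw [← form_lie, lie_self, map_zero, LinearMap.zero_apply, mul_zero, zero_smul, sub_zero]
      at e1 e2
    rw [hφ, hφ, hφ, map_smul, hφ, e1, ← sub_eq_zero, ← sub_smul, ← mul_sub, mul_smul] at e2
    exact (smul_eq_zero.mp e2).resolve_left two_ne_zero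
  by_contra hne
  have h2 : ∀ y : sl2, ⁅φ x, y⁆ = 0 := fun y =>
    (smul_eq_zero.mp (h1 y)).resolve_left (sub_ne_zero.mpr hne)
  apply hx
  rw [← φ.map_eq_zero_iff]
  have hE := h2 matE
  have hF := h2 matF
  have e1 := congrArg (fun x : sl2 => x.1 0 1) hE
  have e2 := congrArg (fun x : sl2 => x.1 0 0) hE
  have e3 := congrArg (fun x : sl2 => x.1 0 0) hF
  simp [lie_zero_one, lie_zero_zero, zero_apply] at e1 e2 e3
  apply ext <;> simp [zero_apply, *]

theorem form_map {φ : sl2 ≃ₗ[ℂ] sl2} (hφ : φ ∈ lieAut sl2) (x y : sl2) :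
    form (φ x) (φ y) = form x y := by
  have h := form_map_self hφ (x + y)
  simp only [map_add, LinearMap.add_apply, form_map_self hφ, form_comm (φ y) (φ x),
    form_comm y x] at h
  linear_combination h / 2

-- An isometry of determinant `1` in odd dimension has eigenvalue `1`.
open Matrix in
theorem exists_fixed {φ : sl2 ≃ₗ[ℂ] sl2} (hφ : φ ∈ lieAut sl2) : ∃ x, x ≠ 0 ∧ φ x = x := by
  let c : Fin 3 → sl2 := ![matE, matF, matH]
  let M : Matrix (Fin 3) (Fin 3) ℂ := Matrix.of fun i j => coordEquiv (φ (c j)) i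
  let Q : Matrix (Fin 3) (Fin 3) ℂ := !![0, 1, 0; 1, 0, 0; 0, 0, 2]
  have hQ : Mᵀ * Q * M = Q := by
    ext i j
    have h1 := form_map hφ (c i) (c j)
    have h2 : form (c i) (c j) = Q i j := by
      fin_cases i <;> fin_cases j <;> simp [c, Q, form_apply]
    rw [← h2, ← h1]
    simp [Matrix.mul_apply, Fin.sum_univ_three, M, Q, coordEquiv_apply, form_apply]
    ring
  -- The determinant is read off from the triple product `form h ⁅e, f⁆`, which `φ` preserves.
  have hM : M.det = 1 := by
    have h1 : form (φ matH) ⁅φ matE, φ matF⁆ = form matH ⁅matE, matF⁆ := by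
      rw [← hφ, form_map hφ]
    rw [Matrix.det_fin_three]
    simp [M, c, coordEquiv_apply]
    simp [form_apply, lie_zero_one, lie_one_zero, lie_zero_zero] at h1
    linear_combination h1 / 2
  have hQ0 : Q.det = -2 := by simp [Q, Matrix.det_fin_three]
  have hdet : (M - 1).det = 0 := by
    -- In dimension `3` determinants turn this into `det (M - 1) = -det (M - 1)`.
    have h1 : (M - 1)ᵀ * Q * M = -(Q * (M - 1)) := by
      rw [Matrix.transpose_sub, Matrix.sub_mul, Matrix.sub_mul, hQ, Matrix.mul_sub]
      simp
    have h2 := congrArg Matrix.det h1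
    rw [Matrix.det_mul, Matrix.det_mul, Matrix.det_transpose, Matrix.det_neg, Matrix.det_mul, hM,
      hQ0] at h2
    norm_num at h2
    linear_combination -h2 / 4
  obtain ⟨v, hv, hv0⟩ := Matrix.exists_mulVec_eq_zero_iff.mpr hdet
  rw [Matrix.sub_mulVec, Matrix.one_mulVec, sub_eq_zero] at hv0
  refine ⟨coordEquiv.symm v, by simpa using hv, ?_⟩
  apply coordEquiv.injective
  rw [LinearEquiv.apply_symm_apply]
  refine Eq.trans ?_ hv0
  ext i
  simp [Matrix.mulVec, dotProduct, Fin.sum_univ_three, M, c]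
  change coordEquiv (φ (v 0 • matE + v 1 • matF + v 2 • matH)) i = _
  simp
  ring

theorem pow_mem {φ : sl2 ≃ₗ[ℂ] sl2} (hφ : φ ∈ lieAut sl2) (n : ℕ) : φ ^ n ∈ lieAut sl2 :=
  Subgroup.pow_mem _ hφ n

/-- A finite order automorphism has a fixed vector of norm `2`. -/
theorem exists_fixed_form_eq_two {φ : sl2 ≃ₗ[ℂ] sl2} (hφ : φ ∈ lieAut sl2) {n : ℕ} (hn : 0 < n)
    (hφn : φ ^ n = 1) : ∃ h, φ h = h ∧ form h h = 2 := by
  suffices H : ∃ h, φ h = h ∧ form h h ≠ 0 by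
    obtain ⟨h, h1, h2⟩ := H
    obtain ⟨s, hs⟩ := IsAlgClosed.exists_pow_nat_eq (2 / form h h) two_pos
    refine ⟨s • h, by rw [map_smul, h1], ?_⟩
    simp only [map_smul, LinearMap.smul_apply, smul_eq_mul]
    rw [← mul_assoc, ← sq, hs, div_mul_cancel₀ _ h2]
  obtain ⟨x, hx0, hx⟩ := exists_fixed hφ
  by_cases hq : form x x = 0
  swap
  · exact ⟨x, hx, hq⟩
  -- When the fixed vector `x` is isotropic, the orbit sum `z` of a `y` not orthogonal to `x` is
  -- fixed with `form x z ≠ 0`; then `z` or `x + z` is not isotropic.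
  obtain ⟨y, hy⟩ : ∃ y, form x y ≠ 0 := by
    by_contra! H
    exact hx0 (eq_zero_of_form x H)
  have hpow : ∀ k : ℕ, (φ ^ k) x = x := fun k => by
    induction k with
    | zero => rfl
    | succ k ih => rw [pow_succ, LinearEquiv.mul_apply, hx, ih]
  set z := ∑ k ∈ Finset.range n, (φ ^ k) y with hz
  have hz1 : φ z = z := by
    rw [hz, map_sum]
    have : ∀ k, φ ((φ ^ k) y) = (φ ^ (k + 1)) y := fun k => by
      rw [pow_succ', LinearEquiv.mul_apply]
    simp only [this]
    have h1 := Finset.sum_range_succ (fun k => (φ ^ k) y) n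
    rw [Finset.sum_range_succ', hφn] at h1
    simpa using h1
  have hz2 : form x z ≠ 0 := by
    rw [hz, map_sum]
    have : ∀ k, form x ((φ ^ k) y) = form x y := fun k => by
      conv_lhs => rw [← hpow k]
      exact form_map (pow_mem hφ k) x y
    simp [this, hy, hn.ne']
  by_cases hqz : form z z = 0
  · refine ⟨x + z, by rw [map_add, hx, hz1], ?_⟩
    simp only [map_add, LinearMap.add_apply, hq, hqz, form_comm z x]
    intro h0
    apply hz2
    linear_combination h0 / 2
  · exact ⟨z, hz1, hqz⟩

/-- A finite order automorphism is diagonal in a standard basis. -/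
theorem exists_diagonal {φ : sl2 ≃ₗ[ℂ] sl2} (hφ : φ ∈ lieAut sl2) {n : ℕ} (hn : 0 < n)
    (hφn : φ ^ n = 1) : ∃ b : Module.Basis (Fin 3) ℂ sl2, IsStandard b ∧ ∃ ζ : ℂ, ζ ≠ 0 ∧
      φ (b 0) = ζ • b 0 ∧ φ (b 1) = ζ⁻¹ • b 1 ∧ φ (b 2) = b 2 := by
  obtain ⟨h, hh, h2⟩ := exists_fixed_form_eq_two hφ hn hφn
  obtain ⟨b, hb, rfl⟩ := exists_isStandard h2
  have expand : ∀ x, x = b.repr x 0 • b 0 + b.repr x 1 • b 1 + b.repr x 2 • b 2 := fun x => by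
    conv_lhs => rw [← b.sum_repr x, Fin.sum_univ_three]
  have hlie : ∀ x, ⁅b 2, x⁆ = (2 * b.repr x 0) • b 0 + (-2 * b.repr x 1) • b 1 := fun x => by
    conv_lhs => rw [expand x]
    simp only [lie_add, lie_smul, hb.lie_h_e, hb.lie_h_f, lie_self]
    module
  have r2 : ∀ (x : sl2) (i : Fin 3), b.repr ⁅b 2, x⁆ i = ![2 * b.repr x 0, -2 * b.repr x 1, 0] i :=
    fun x i => by
      rw [hlie]
      fin_cases i <;> simp
  -- As `φ` fixes `h`, it commutes with `ad h` and preserves its one-dimensional eigenspaces.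
  have he : ⁅b 2, φ (b 0)⁆ = (2 : ℂ) • φ (b 0) := by
    conv_lhs => rw [← hh, ← hφ, hb.lie_h_e, map_smul]
  have hf : ⁅b 2, φ (b 1)⁆ = (-2 : ℂ) • φ (b 1) := by
    conv_lhs => rw [← hh, ← hφ, hb.lie_h_f, map_smul]
  have he' : φ (b 0) = b.repr (φ (b 0)) 0 • b 0 := by
    have e1 := r2 (φ (b 0)) 1
    have e2 := r2 (φ (b 0)) 2
    rw [he] at e1 e2
    simp at e1 e2
    have e1' : b.repr (φ (b 0)) 1 = 0 := by linear_combination e1 / 4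
    have := expand (φ (b 0))
    rwa [e1', e2, zero_smul, zero_smul, add_zero, add_zero] at this
  have hf' : φ (b 1) = b.repr (φ (b 1)) 1 • b 1 := by
    have e1 := r2 (φ (b 1)) 0
    have e2 := r2 (φ (b 1)) 2
    rw [hf] at e1 e2
    simp at e1 e2
    have e1' : b.repr (φ (b 1)) 0 = 0 := by linear_combination -e1 / 4
    have := expand (φ (b 1))
    rwa [e1', e2, zero_smul, zero_smul, add_zero, zero_add] at this
  have hprod : b.repr (φ (b 0)) 0 * b.repr (φ (b 1)) 1 = 1 := by
    have h1 := hh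
    rw [← hb.lie_e_f, hφ, he', hf', smul_lie, lie_smul, smul_smul, hb.lie_e_f] at h1
    have h3 := congrArg (fun x => b.repr x 2) h1
    simpa using h3
  have h0 : b.repr (φ (b 0)) 0 ≠ 0 := left_ne_zero_of_mul_eq_one hprod
  exact ⟨b, hb, _, h0, he', by
    rwa [inv_eq_of_mul_eq_one_right hprod], hh⟩

/-- Interchanging `e` and `f` and changing the sign of `h` gives another standard basis. -/
theorem IsStandard.exists_swap {b : Module.Basis (Fin 3) ℂ sl2} (hb : IsStandard b) :
    ∃ b' : Module.Basis (Fin 3) ℂ sl2, IsStandard b' ∧ b' 0 = b 1 ∧ b' 1 = b 0 ∧ b' 2 = -b 2 := by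
  -- The norm of `h` is recovered from the eigenvalue `4` of `(ad h)²` on `e`.
  have fef : form (b 2) (b 2) = 2 := by
    by_contra hne
    have h1 := lie_lie_self (b 2) (b 0)
    have h2 := form_lie (b 2) (b 2) (b 0)
    rw [hb.lie_h_e, lie_self, map_smul, map_zero, LinearMap.zero_apply] at h2
    have h3 : form (b 2) (b 0) = 0 := by simpa using h2.symm
    rw [hb.lie_h_e, lie_smul, hb.lie_h_e, h3, mul_zero, zero_smul, sub_zero, smul_smul,
      ← sub_eq_zero, ← sub_smul] at h1
    have h4 := (smul_eq_zero.mp h1).resolve_right (b.ne_zero 0)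
    exact hne (by linear_combination -h4 / 2)
  apply exists_basis
  · rw [neg_lie, hb.lie_h_f]; module
  · rw [neg_lie, hb.lie_h_e]; module
  · rw [← lie_skew, hb.lie_e_f]
  · simpa using fef

/-- A linear automorphism that is diagonal in a basis with eigenvalues `ζ, ζ⁻¹, 1` has the order
of `ζ`. -/
theorem orderOf_eq_of_diagonal {φ : sl2 ≃ₗ[ℂ] sl2} {b : Module.Basis (Fin 3) ℂ sl2} {ζ : ℂ}
    (h0 : φ (b 0) = ζ • b 0) (h1 : φ (b 1) = ζ⁻¹ • b 1) (h2 : φ (b 2) = b 2) :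
    orderOf φ = orderOf ζ := by
  have p0 : ∀ k : ℕ, (φ ^ k) (b 0) = ζ ^ k • b 0 := fun k => by
    induction k with
    | zero => simp
    | succ k ih => rw [pow_succ, LinearEquiv.mul_apply, h0, map_smul, ih, smul_smul, pow_succ']
  have p1 : ∀ k : ℕ, (φ ^ k) (b 1) = ζ⁻¹ ^ k • b 1 := fun k => by
    induction k with
    | zero => simp
    | succ k ih => rw [pow_succ, LinearEquiv.mul_apply, h1, map_smul, ih, smul_smul, pow_succ']
  have p2 : ∀ k : ℕ, (φ ^ k) (b 2) = b 2 := fun k => by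
    induction k with
    | zero => simp
    | succ k ih => rw [pow_succ, LinearEquiv.mul_apply, h2, ih]
  refine orderOf_eq_orderOf_iff.mpr fun k => ⟨fun h => ?_, fun h => ?_⟩
  · have := p0 k
    rw [h, LinearEquiv.coe_one, id_eq] at this
    have h3 := congrArg (fun x => b.repr x 0) this
    simpa using h3.symm
  · apply LinearEquiv.toLinearMap_injective
    refine b.ext fun i => ?_
    change (φ ^ k) (b i) = b i
    fin_cases i
    · simpa [h] using p0 k
    · simpa [h, inv_pow] using p1 k
    · exact p2 k

end sl2

/-! ### Periodic functions with poles in the lattice -/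

/-- If two meromorphic functions have the same finite order at a point, a linear combination has
larger order. -/
theorem exists_order_sub_lt {u v : ℂ → ℂ} {x : ℂ} {n : ℤ} (hu : MeromorphicAt u x)
    (hv : MeromorphicAt v x) (hun : meromorphicOrderAt u x = n) (hvn : meromorphicOrderAt v x = n) :
    ∃ c : ℂ, (n : WithTop ℤ) < meromorphicOrderAt (u - c • v) x := by
  obtain ⟨g, hg, hg0, hgu⟩ := (meromorphicOrderAt_eq_int_iff hu).mp hun
  obtain ⟨k, hk, hk0, hkv⟩ := (meromorphicOrderAt_eq_int_iff hv).mp hvn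
  -- The quotient of the leading coefficients.
  refine ⟨g x / k x, ?_⟩
  have e : (u - (g x / k x) • v) =ᶠ[𝓝[≠] x]
      (fun z => (z - x) ^ n) * fun z => g z - (g x / k x) * k z := by
    filter_upwards [hgu, hkv] with z h1 h2
    simp only [Pi.sub_apply, Pi.smul_apply, Pi.mul_apply, smul_eq_mul, h1, h2]
    ring
  have ha : AnalyticAt ℂ (fun z => g z - (g x / k x) * k z) x := by fun_prop
  have h0 : 0 < meromorphicOrderAt (fun z => g z - (g x / k x) * k z) x := by
    rw [← tendsto_zero_iff_meromorphicOrderAt_pos ha.meromorphicAt]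
    have := ha.continuousAt.tendsto.mono_left (nhdsWithin_le_nhds (s := {x}ᶜ))
    simpa [div_mul_cancel₀ _ hk0] using this
  rw [meromorphicOrderAt_congr e, meromorphicOrderAt_mul (by fun_prop) ha.meromorphicAt]
  have h1 : meromorphicOrderAt (fun z : ℂ => (z - x) ^ n) x = n := by
    exact meromorphicOrderAt_zpow_id_sub_const
  rw [h1]
  generalize meromorphicOrderAt (fun z => g z - (g x / k x) * k z) x = t at h0
  induction t with
  | top => simp
  | coe t => norm_cast at h0 ⊢; omega

/-- A meromorphic function that is multiplied by `χ` under the rotation by `a` has an order `n`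
at the origin with `aⁿ = χ`. -/
theorem zpow_order_eq {u : ℂ → ℂ} (hu : MeromorphicAt u 0) {n : ℤ}
    (hn : meromorphicOrderAt u 0 = n) {a χ : ℂ} (ha : a ≠ 0)
    (h : ∀ᶠ z in 𝓝[≠] (0 : ℂ), u (a * z) = χ * u z) : a ^ n = χ := by
  obtain ⟨g, hg, hg0, hgu⟩ := (meromorphicOrderAt_eq_int_iff hu).mp hn
  have ht : Filter.Tendsto (fun z : ℂ => a * z) (𝓝[≠] 0) (𝓝[≠] 0) := by
    refine tendsto_nhdsWithin_iff.mpr ⟨?_, ?_⟩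
    · have : ContinuousAt (fun z : ℂ => a * z) 0 := by fun_prop
      simpa [ContinuousAt] using this.tendsto.mono_left (nhdsWithin_le_nhds (s := {0}ᶜ))
    · filter_upwards [self_mem_nhdsWithin] with z hz
      exact mul_ne_zero ha hz
  -- Cancel `z ^ n` and let `z` tend to `0`: this compares leading coefficients.
  have h1 : ∀ᶠ z in 𝓝[≠] (0 : ℂ), a ^ n * g (a * z) = χ * g z := by
    filter_upwards [hgu, ht.eventually hgu, h, self_mem_nhdsWithin] with z e1 e2 e3 hz
    have hz' : z ^ n ≠ 0 := zpow_ne_zero n hz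
    rw [e2, e1, sub_zero, sub_zero, smul_eq_mul, smul_eq_mul, mul_zpow] at e3
    exact mul_left_cancel₀ hz' (by linear_combination e3)
  have hc : Filter.Tendsto g (𝓝[≠] 0) (𝓝 (g 0)) :=
    hg.continuousAt.tendsto.mono_left nhdsWithin_le_nhds
  have l1 := (hc.comp ht).const_mul (a ^ n)
  have l2 := hc.const_mul χ
  exact mul_right_cancel₀ hg0 (tendsto_nhds_unique (l1.congr' h1) l2)

/-- `Λ`-periodic functions that are meromorphic on `ℂ` and holomorphic outside `Λ`. -/
structure IsReg (L : PeriodPair) (u : ℂ → ℂ) : Prop where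
  periodic : ∀ (z : ℂ), ∀ l ∈ L.lattice, u (z + l) = u z
  meromorphicAt : ∀ z, MeromorphicAt u z
  analyticAt : ∀ z ∉ L.lattice, AnalyticAt ℂ u z

namespace IsReg

variable {L : PeriodPair} {u v : ℂ → ℂ}

theorem const (c : ℂ) : IsReg L fun _ => c :=
  ⟨fun _ _ _ => rfl, fun _ => MeromorphicAt.const _ _, fun _ _ => analyticAt_const⟩

theorem one : IsReg L 1 := const 1

theorem add (hu : IsReg L u) (hv : IsReg L v) : IsReg L (u + v) :=
  ⟨fun z l hl => by simp [hu.periodic z l hl, hv.periodic z l hl],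
    fun z => (hu.meromorphicAt z).add (hv.meromorphicAt z),
    fun z hz => (hu.analyticAt z hz).add (hv.analyticAt z hz)⟩

theorem mul (hu : IsReg L u) (hv : IsReg L v) : IsReg L (u * v) :=
  ⟨fun z l hl => by simp [hu.periodic z l hl, hv.periodic z l hl],
    fun z => (hu.meromorphicAt z).mul (hv.meromorphicAt z),
    fun z hz => (hu.analyticAt z hz).mul (hv.analyticAt z hz)⟩

theorem smul (c : ℂ) (hu : IsReg L u) : IsReg L (c • u) := (const c).mul hu

theorem sub (hu : IsReg L u) (hv : IsReg L v) : IsReg L (u - v) := by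
  have := hu.add (hv.smul (-1))
  rwa [neg_one_smul, ← sub_eq_add_neg] at this

theorem pow (hu : IsReg L u) (n : ℕ) : IsReg L (u ^ n) := by
  induction n with
  | zero => rw [pow_zero]; exact one
  | succ n ih => rw [pow_succ]; exact ih.mul hu

theorem deriv (hu : IsReg L u) : IsReg L (deriv u) := by
  refine ⟨fun z l hl => ?_, fun z => (hu.meromorphicAt z).deriv, fun z hz =>
    (hu.analyticAt z hz).deriv⟩
  rw [← deriv_comp_add_const]
  congr 1
  ext w
  exact hu.periodic w l hl

theorem comp_neg (hu : IsReg L u) : IsReg L fun z => u (-z) := by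
  refine ⟨fun z l hl => ?_, fun z => ?_, fun z hz => ?_⟩
  · rw [neg_add, hu.periodic _ _ (neg_mem hl)]
  · exact (hu.meromorphicAt (-z)).comp_analyticAt (f := u) (g := fun z => -z) (by fun_prop)
  · exact (hu.analyticAt (-z) (by simpa using hz)).comp (f := fun z => -z) (g := u) (by fun_prop)

theorem wp : IsReg L ℘[L] :=
  ⟨fun z l hl => L.weierstrassP_add_coe z ⟨l, hl⟩, fun z => L.meromorphic_weierstrassP z,
    fun z hz => L.analyticOnNhd_weierstrassP z hz⟩

theorem wpDeriv : IsReg L ℘'[L] :=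
  ⟨fun z l hl => L.derivWeierstrassP_add_coe z ⟨l, hl⟩, fun z => L.meromorphic_derivWeierstrassP z,
    fun z hz => L.analyticOnNhd_derivWeierstrassP z hz⟩

theorem eventually_notMem (L : PeriodPair) : ∀ᶠ z in 𝓝[≠] (0 : ℂ), z ∉ L.lattice := by
  filter_upwards [self_mem_nhdsWithin, mem_nhdsWithin_of_mem_nhds
    (L.compl_lattice_sdiff_singleton_mem_nhds 0)] with w hw hw' h
  exact hw' ⟨h, hw⟩

/-- Liouville's theorem. -/
theorem exists_eq_const (hu : IsReg L u) (h : 0 ≤ meromorphicOrderAt u 0) :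
    ∃ c, ∀ z ∉ L.lattice, u z = c := by
  classical
  obtain ⟨c, hc⟩ := tendsto_nhds_of_meromorphicOrderAt_nonneg (hu.meromorphicAt 0) h
  -- Values of `u` on the lattice are unconstrained; with the limit `c` filled in there the function
  -- becomes entire, and periodicity bounds it.
  let v : ℂ → ℂ := fun z => if z ∈ L.lattice then c else u z
  have hv0 : ∀ᶠ z in 𝓝[≠] (0 : ℂ), u z = v z := by
    filter_upwards [eventually_notMem L] with z hz
    simp [v, hz]
  have hva : AnalyticAt ℂ v 0 := by
    refine ((hu.meromorphicAt 0).congr hv0).analyticAt ?_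
    rw [continuousAt_iff_punctured_nhds]
    have e : v 0 = c := by simp [v]
    rw [e]
    exact hc.congr' hv0
  have hvp : ∀ z, ∀ l ∈ L.lattice, v (z + l) = v z := fun z l hl => by
    simp only [v, hu.periodic z l hl, L.lattice.add_mem_iff_left hl]
  have hvall : ∀ z, AnalyticAt ℂ v z := fun z => by
    by_cases hz : z ∈ L.lattice
    · have e : v = v ∘ fun w => w - z := by
        ext w
        have := hvp (w - z) z hz
        rwa [sub_add_cancel] at this
      rw [e]
      exact AnalyticAt.comp (by simpa using hva) (by fun_prop)
    · refine (hu.analyticAt z hz).congr ?_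
      filter_upwards [L.isClosed_lattice.isOpen_compl.mem_nhds hz] with w hw
      have hw' : w ∉ L.lattice := hw
      simp [v, hw']
  have hd : Differentiable ℂ v := fun z => (hvall z).differentiableAt
  refine ⟨c, fun z hz => ?_⟩
  have h1 := hd.apply_eq_apply_of_bounded
    (IsZLattice.isCompact_range_of_periodic L.lattice v hd.continuous hvp).isBounded z 0
  simpa [v, hz] using h1

theorem eq_zero (hu : IsReg L u) (h : 0 < meromorphicOrderAt u 0) : ∀ z ∉ L.lattice, u z = 0 := by
  obtain ⟨c, hc⟩ := hu.exists_eq_const h.le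
  have h1 := tendsto_zero_of_meromorphicOrderAt_pos h
  have h2 : Filter.Tendsto u (𝓝[≠] 0) (𝓝 c) := by
    refine tendsto_const_nhds.congr' ?_
    filter_upwards [eventually_notMem L] with z hz
    rw [hc z hz]
  rw [tendsto_nhds_unique h1 h2]
  exact hc

theorem order_eq_top (h : ∀ z ∉ L.lattice, u z = 0) : meromorphicOrderAt u 0 = ⊤ := by
  rw [meromorphicOrderAt_eq_top_iff]
  filter_upwards [eventually_notMem L] with z hz using h z hz

/-- Orders at `0` add up, so the order of `u` is infinite. This cancels a factor such as `℘'` in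
spite of its zeros. -/
theorem eq_zero_of_mul (hu : IsReg L u) (hv : MeromorphicAt v 0) (hv0 : meromorphicOrderAt v 0 ≠ ⊤)
    (h : ∀ z ∉ L.lattice, u z * v z = 0) : ∀ z ∉ L.lattice, u z = 0 := by
  refine hu.eq_zero ?_
  have := order_eq_top (u := u * v) h
  rw [meromorphicOrderAt_mul (hu.meromorphicAt 0) hv] at this
  rw [(WithTop.add_eq_top.mp this).resolve_right hv0]
  exact WithTop.coe_lt_top 0

/-! ### Pole orders at the origin, and functions generated by them -/

theorem order_wp : meromorphicOrderAt ℘[L] 0 = ((-2 : ℤ) : WithTop ℤ) := by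
  rw [L.order_weierstrassP 0 (zero_mem _)]; rfl

theorem order_wpDeriv : meromorphicOrderAt ℘'[L] 0 = ((-3 : ℤ) : WithTop ℤ) := by
  rw [← L.deriv_weierstrassP, meromorphicOrderAt_deriv_eq_sub_one (n := -2) (by norm_num) order_wp]
  rfl

/-- The order is written as `-0` to fit the pattern `-n` for the generator `g = 1` of the invariant
functions. -/
theorem order_one : meromorphicOrderAt (1 : ℂ → ℂ) 0 = ((-(0 : ℕ) : ℤ) : WithTop ℤ) := by
  classical
  have := meromorphicOrderAt_const (0 : ℂ) (1 : ℂ)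
  rw [if_neg one_ne_zero] at this
  exact this

/-- The order of a polynomial in a function with a pole. -/
theorem order_eval {J : ℂ → ℂ} (hJ : MeromorphicAt J 0) {m : ℕ} (hm : 0 < m)
    (hJm : meromorphicOrderAt J 0 = ((-m : ℤ) : WithTop ℤ)) (P : Polynomial ℂ) (hP : P ≠ 0) :
    MeromorphicAt (fun z => P.eval (J z)) 0 ∧
    meromorphicOrderAt (fun z => P.eval (J z)) 0 = ((-(m * P.natDegree) : ℤ) : WithTop ℤ) := by
  classical
  induction hd : P.natDegree generalizing P with
  | zero =>
    obtain ⟨a, rfl⟩ := Polynomial.natDegree_eq_zero.mp hd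
    have ha : a ≠ 0 := by simpa using hP
    simp only [Polynomial.eval_C]
    refine ⟨MeromorphicAt.const _ _, ?_⟩
    rw [meromorphicOrderAt_const, if_neg ha]; simp
  | succ d ih =>
    have h1 : P.divX.natDegree = d := by
      rw [Polynomial.natDegree_divX_eq_natDegree_tsub_one, hd]; rfl
    have h2 : P.divX ≠ 0 := by
      intro h
      rw [Polynomial.divX_eq_zero_iff] at h
      rw [h, Polynomial.natDegree_C] at hd
      omega
    obtain ⟨i1, i2⟩ := ih P.divX h2 h1
    -- Horner's scheme: the product has a pole, so adding the constant coefficient does not change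
    -- its order.
    have e : (fun z => P.eval (J z))
        = (fun z => P.divX.eval (J z)) * J + fun _ => P.coeff 0 := by
      ext z
      conv_lhs => rw [← P.divX_mul_X_add]
      simp
    have hmero : MeromorphicAt ((fun z => P.divX.eval (J z)) * J) 0 := i1.mul hJ
    have ho : meromorphicOrderAt ((fun z => P.divX.eval (J z)) * J) 0
        = ((-(m * (d + 1 : ℕ)) : ℤ) : WithTop ℤ) := by
      rw [meromorphicOrderAt_mul i1 hJ, i2, hJm, ← WithTop.coe_add]
      congr 1; push_cast; ring
    rw [e]
    refine ⟨hmero.add (MeromorphicAt.const _ _), ?_⟩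
    rw [meromorphicOrderAt_add_eq_left_of_lt (MeromorphicAt.const _ _), ho]
    rw [ho, meromorphicOrderAt_const]
    split_ifs
    · exact WithTop.coe_lt_top _
    · norm_cast
      have : (0 : ℤ) < m * (d + 1 : ℕ) := by positivity
      omega

/-- A function with a pole is transcendental. -/
theorem eq_zero_of_eval {J : ℂ → ℂ} (hJ : MeromorphicAt J 0) {m : ℕ} (hm : 0 < m)
    (hJm : meromorphicOrderAt J 0 = ((-m : ℤ) : WithTop ℤ)) (P : Polynomial ℂ)
    (h : ∀ z ∉ L.lattice, P.eval (J z) = 0) : P = 0 := by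
  by_contra hP
  have h1 := (order_eval hJ hm hJm P hP).2
  rw [order_eq_top h] at h1
  exact WithTop.top_ne_coe h1

/-- A space of functions whose orders are realised by the products `g * J ^ k` consists of
`ℂ[J]`-multiples of `g`. -/
theorem exists_eval_of_orders {J g : ℂ → ℂ} (hJ : IsReg L J) (hg : IsReg L g) {m n : ℕ}
    (hJm : meromorphicOrderAt J 0 = ((-m : ℤ) : WithTop ℤ))
    (hgn : meromorphicOrderAt g 0 = ((-n : ℤ) : WithTop ℤ))
    (V : Submodule ℂ (ℂ → ℂ)) (hV : ∀ u ∈ V, IsReg L u) (hmem : ∀ k : ℕ, g * J ^ k ∈ V)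
    (hord : ∀ u ∈ V, ∀ N : ℕ, meromorphicOrderAt u 0 = ((-N : ℤ) : WithTop ℤ) →
      ∃ k : ℕ, N = n + m * k) (hu : u ∈ V) :
    ∃ P : Polynomial ℂ, ∀ z ∉ L.lattice, u z = g z * P.eval (J z) := by
  -- Induction on a strict bound `M` for the pole order: a suitable multiple of `g * J ^ k` cancels
  -- the leading term, and for `M = 0` the function vanishes at the origin, hence everywhere off the
  -- lattice.
  suffices H : ∀ M : ℕ, ∀ u ∈ V, ((-M : ℤ) : WithTop ℤ) < meromorphicOrderAt u 0 →
      ∃ P : Polynomial ℂ, ∀ z ∉ L.lattice, u z = g z * P.eval (J z) by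
    rcases h : meromorphicOrderAt u 0 with _ | n
    · exact H 0 u hu (by rw [h]; exact WithTop.coe_lt_top _)
    · refine H (n.natAbs + 1) u hu ?_
      rw [h]
      change ((_ : ℤ) : WithTop ℤ) < ((n : ℤ) : WithTop ℤ)
      rw [WithTop.coe_lt_coe]; omega
  intro M
  induction M with
  | zero =>
    intro u hu h
    refine ⟨0, fun z hz => ?_⟩
    rw [(hV u hu).eq_zero (by simpa using h) z hz]; simp
  | succ M ih =>
    intro u hu h
    by_cases h1 : ((-M : ℤ) : WithTop ℤ) < meromorphicOrderAt u 0
    · exact ih u hu h1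
    have h2 : meromorphicOrderAt u 0 = ((-M : ℤ) : WithTop ℤ) := by
      generalize meromorphicOrderAt u 0 = t at h h1
      induction t with
      | top => exact absurd (WithTop.coe_lt_top _) h1
      | coe t => rw [WithTop.coe_lt_coe] at h h1; rw [WithTop.coe_inj]; push_cast at h; omega
    obtain ⟨k, hk⟩ := hord u hu M h2
    have h3 : meromorphicOrderAt (g * J ^ k) 0 = ((-M : ℤ) : WithTop ℤ) := by
      rw [meromorphicOrderAt_mul (hg.meromorphicAt 0) ((hJ.pow k).meromorphicAt 0), hgn,
        meromorphicOrderAt_pow (hJ.meromorphicAt 0), hJm, hk]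
      have : (k : WithTop ℤ) = ((k : ℤ) : WithTop ℤ) := rfl
      rw [this, ← WithTop.coe_mul, ← WithTop.coe_add]
      congr 1; push_cast; ring
    obtain ⟨c, hc⟩ := exists_order_sub_lt ((hV u hu).meromorphicAt 0)
      ((hV _ (hmem k)).meromorphicAt 0) h2 h3
    obtain ⟨P, hP⟩ := ih _ (V.sub_mem hu (V.smul_mem c (hmem k))) hc
    refine ⟨P + Polynomial.C c * Polynomial.X ^ k, fun z hz => ?_⟩
    have := hP z hz
    simp only [Pi.sub_apply, Pi.smul_apply, Pi.mul_apply, Pi.pow_apply, smul_eq_mul] at this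
    simp only [Polynomial.eval_add, Polynomial.eval_mul, Polynomial.eval_C, Polynomial.eval_pow,
      Polynomial.eval_X]
    linear_combination this

/-- Even functions are polynomials in `℘`. -/
theorem exists_eval_of_even (hu : IsReg L u) (he : ∀ z, u (-z) = u z) :
    ∃ P : Polynomial ℂ, ∀ z ∉ L.lattice, u z = P.eval (℘[L] z) := by
  let V : Submodule ℂ (ℂ → ℂ) :=
    { carrier := {u | IsReg L u ∧ ∀ z, u (-z) = u z}
      add_mem' := fun h h' => ⟨h.1.add h'.1, fun z => by simp [h.2, h'.2]⟩
      zero_mem' := ⟨const 0, fun _ => rfl⟩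
      smul_mem' := fun c u h => ⟨h.1.smul c, fun z => by simp [h.2]⟩ }
  obtain ⟨P, hP⟩ := exists_eval_of_orders (u := u) (J := ℘[L]) (g := 1) (m := 2) (n := 0) wp one
    order_wp (order_one) V (fun u hu => hu.1)
    (fun k => ⟨one.mul (wp.pow k), fun z => by simp⟩) (fun u hu N hN => by
      -- Evenness is invariance under the rotation by `-1`, so the pole order is even.
      have h1 := zpow_order_eq (hu.1.meromorphicAt 0) hN (a := -1) (χ := 1) (by simp)
        (Filter.Eventually.of_forall fun z => by simpa using hu.2 z)
      rw [zpow_neg, inv_eq_one, zpow_natCast, neg_one_pow_eq_one_iff_even (by norm_num)] at h1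
      obtain ⟨k, hk⟩ := h1
      exact ⟨k, by omega⟩) ⟨hu, he⟩
  exact ⟨P, fun z hz => by simp [hP z hz]⟩

/-! ### The second order equation of `℘`, half periods and simple poles -/

/-- The differential equation of second order for `℘`. -/
theorem deriv_wpDeriv (z : ℂ) (hz : z ∉ L.lattice) :
    _root_.deriv ℘'[L] z = 6 * ℘[L] z ^ 2 - L.g₂ / 2 := by
  let F : ℂ → ℂ := _root_.deriv ℘'[L] - ((6 : ℂ) • ℘[L] ^ 2 - fun _ => L.g₂ / 2)
  have hF : IsReg L F :=
    wpDeriv.deriv.sub (((wp.pow 2).smul 6).sub (const _))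
  -- Differentiating `℘'² = 4 ℘³ - g₂ ℘ - g₃` gives the claim multiplied by `2 ℘'`.
  have h0 : ∀ z ∉ L.lattice,
      F z * ℘'[L] z = 0 := by
    intro z hz
    have e : (fun w => ℘'[L] w ^ 2) =ᶠ[𝓝 z]
        fun w => 4 * ℘[L] w ^ 3 - L.g₂ * ℘[L] w - L.g₃ := by
      filter_upwards [L.isClosed_lattice.isOpen_compl.mem_nhds hz] with w hw
      exact L.derivWeierstrassP_sq w hw
    have d1 : HasDerivAt ℘'[L] (_root_.deriv ℘'[L] z) z :=
      (wpDeriv.analyticAt z hz).differentiableAt.hasDerivAt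
    have d2 : HasDerivAt ℘[L] (℘'[L] z) z := by
      rw [← L.deriv_weierstrassP]
      exact (wp.analyticAt z hz).differentiableAt.hasDerivAt
    have d3 := e.deriv_eq
    have d4 := (((d2.fun_pow 3).const_mul 4).sub (d2.const_mul L.g₂)).sub_const L.g₃
    have d5 := d1.fun_pow 2
    have d6 := d4.unique (d5.congr_of_eventuallyEq e.symm)
    simp only [F, Pi.sub_apply, Pi.smul_apply, Pi.pow_apply, smul_eq_mul]
    push_cast at d6
    linear_combination -d6 / 2
  have := hF.eq_zero_of_mul (wpDeriv.meromorphicAt 0)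
    (by rw [order_wpDeriv]; exact WithTop.coe_ne_top)
    h0 z hz
  simp only [F, Pi.sub_apply, Pi.smul_apply, Pi.pow_apply, smul_eq_mul] at this
  linear_combination this

/-- A solution of `u'' = h u` with vanishing initial values vanishes. -/
theorem eventually_eq_zero_of_deriv_deriv {u h : ℂ → ℂ} {x : ℂ} (hu : AnalyticAt ℂ u x)
    (hh : AnalyticAt ℂ h x) (h0 : u x = 0) (h1 : _root_.deriv u x = 0)
    (e : _root_.deriv (_root_.deriv u) =ᶠ[𝓝 x] h * u) : ∀ᶠ z in 𝓝 x, u z = 0 := by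
  rw [← analyticOrderAt_eq_top]
  by_contra hne
  -- With `t` the order of `u'` and `s` that of `h`, `u` has order `t + 1` and `u''` order `s + t +
  -- 1`; hence `t = s + t + 2`, impossible for finite orders.
  have a1 := hu.analyticOrderAt_deriv_add_one
  have a2 := hu.deriv.analyticOrderAt_deriv_add_one
  rw [h0] at a1
  rw [h1, analyticOrderAt_congr e, analyticOrderAt_mul hh hu] at a2
  simp only [sub_zero] at a1 a2
  rw [← a1] at a2 hne
  generalize analyticOrderAt h x = s at a2
  generalize analyticOrderAt (_root_.deriv u) x = t at a2 hne
  have ht : t ≠ ⊤ := by rintro rfl; simp at hne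
  lift t to ℕ using ht
  have hs : s ≠ ⊤ := by rintro rfl; simp at a2
  lift s to ℕ using hs
  norm_cast at a2
  omega

/-- The values of `℘` and `℘'` determine a point modulo the lattice. -/
theorem sub_mem_of_wp_eq {a b : ℂ} (ha : a ∉ L.lattice) (hb : b ∉ L.lattice)
    (h : ℘[L] a = ℘[L] b) (h' : ℘'[L] a = ℘'[L] b) : b - a ∈ L.lattice := by
  have an : ∀ c ∉ L.lattice, AnalyticAt ℂ (fun z => ℘[L] (z + c)) 0 := fun c hc =>
    AnalyticAt.comp (g := ℘[L]) (f := fun z => z + c)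
      (by simpa using wp.analyticAt c hc) (by fun_prop)
  have d1 : ∀ z, _root_.deriv (fun z => ℘[L] (z + a)) z = ℘'[L] (z + a) := fun z => by
    rw [deriv_comp_add_const, L.deriv_weierstrassP]
  have d2 : ∀ z, _root_.deriv (fun z => ℘[L] (z + b)) z = ℘'[L] (z + b) := fun z => by
    rw [deriv_comp_add_const, L.deriv_weierstrassP]
  -- In the difference of two translates the constant `g₂ / 2` cancels and `u'' = 6 (℘(z + a) + ℘(z
  -- + b)) u`; the hypotheses say that both initial values vanish.
  let u : ℂ → ℂ := (fun z => ℘[L] (z + a)) - fun z => ℘[L] (z + b)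
  have hu : AnalyticAt ℂ u 0 := (an a ha).sub (an b hb)
  have nm : ∀ c ∉ L.lattice, ∀ᶠ z in 𝓝 (0 : ℂ), z + c ∉ L.lattice := fun c hc => by
    have hcont : ContinuousAt (fun z : ℂ => z + c) 0 := by fun_prop
    exact hcont.eventually (L.isClosed_lattice.isOpen_compl.mem_nhds (by simpa using hc))
  have hdu : _root_.deriv u =ᶠ[𝓝 0] fun z => ℘'[L] (z + a) - ℘'[L] (z + b) := by
    filter_upwards [(an a ha).eventually_analyticAt, (an b hb).eventually_analyticAt] with z h1 h2
    simp only [u]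
    rw [deriv_sub h1.differentiableAt h2.differentiableAt, d1, d2]
  have hddu : _root_.deriv (_root_.deriv u) =ᶠ[𝓝 0]
      (fun z => 6 * (℘[L] (z + a) + ℘[L] (z + b))) * u := by
    filter_upwards [hdu.eventuallyEq_nhds, nm a ha, nm b hb] with z h1 h2 h3
    have da : DifferentiableAt ℂ (fun z => ℘'[L] (z + a)) z :=
      (AnalyticAt.comp (g := ℘'[L]) (f := fun z => z + a)
        (wpDeriv.analyticAt _ h2) (by fun_prop)).differentiableAt
    have db : DifferentiableAt ℂ (fun z => ℘'[L] (z + b)) z :=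
      (AnalyticAt.comp (g := ℘'[L]) (f := fun z => z + b)
        (wpDeriv.analyticAt _ h3) (by fun_prop)).differentiableAt
    rw [h1.deriv_eq, deriv_fun_sub da db, deriv_comp_add_const, deriv_comp_add_const,
      deriv_wpDeriv _ h2, deriv_wpDeriv _ h3]
    simp only [u, Pi.mul_apply, Pi.sub_apply]
    ring
  have hz := eventually_eq_zero_of_deriv_deriv hu
    (h := fun z => 6 * (℘[L] (z + a) + ℘[L] (z + b)))
    (((an a ha).add (an b hb)).const_smul (c := (6 : ℂ))) (by simp [u, h])
    (by rw [hdu.self_of_nhds]; simp [h']) hddu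
  have mer : ∀ c, Meromorphic fun z => ℘[L] (z + c) := fun c z =>
    (wp.meromorphicAt (z + c)).comp_analyticAt (f := ℘[L]) (g := fun z => z + c) (by fun_prop)
  have hmu : MeromorphicOn u Set.univ := fun z _ => (mer a z).sub (mer b z)
  have htop : meromorphicOrderAt u 0 = ⊤ :=
    meromorphicOrderAt_eq_top_iff.mpr (hz.filter_mono nhdsWithin_le_nhds)
  -- The identity theorem carries the vanishing of `u` to `-a`, where `℘(z + a)` has a double pole
  -- while `℘(z + b)` is analytic if `b - a ∉ Λ`.
  have htop' : meromorphicOrderAt u (-a) = ⊤ := by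
    by_contra hne
    exact hmu.meromorphicOrderAt_ne_top_of_isPreconnected (x := -a) (y := 0)
      isPreconnected_univ trivial trivial hne htop
  by_contra hba
  have hb' : AnalyticAt ℂ (fun z => ℘[L] (z + b)) (-a) :=
    AnalyticAt.comp (g := ℘[L]) (f := fun z => z + b)
      (wp.analyticAt _ (by rwa [neg_add_eq_sub])) (by fun_prop)
  have ho : meromorphicOrderAt (fun z => ℘[L] (z + a)) (-a) = ((-2 : ℤ) : WithTop ℤ) := by
    have := meromorphicOrderAt_comp_add_const_eq_meromorphicOrderAt (f := ℘[L]) (c := a) (x := -a)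
    rw [neg_add_cancel, order_wp] at this
    exact this
  have e : (fun z => ℘[L] (z + a)) = u + fun z => ℘[L] (z + b) := by simp [u]
  have h1 := meromorphicOrderAt_add (hmu (-a) trivial) hb'.meromorphicAt
  rw [← e, ho, htop', min_eq_right le_top] at h1
  have h2 := hb'.meromorphicOrderAt_nonneg.trans h1
  have h3 : (0 : ℤ) ≤ -2 := WithTop.coe_le_coe.mp h2
  omega

/-- `℘'` vanishes at the half periods. -/
theorem eq_zero_of_odd (hu : IsReg L u) (ho : ∀ z, u (-z) = -u z) {w : ℂ}
    (hw : 2 * w ∈ L.lattice) : u w = 0 := by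
  have h1 := hu.periodic (-w) (2 * w) hw
  rw [show -w + 2 * w = w by ring, ho] at h1
  linear_combination h1 / 2

/-- The three half periods have distinct values under `℘`. -/
theorem exists_half_periods (L : PeriodPair) : ∃ w : Fin 3 → ℂ, (∀ i, w i ∉ L.lattice) ∧
    (∀ i, 2 * w i ∈ L.lattice) ∧ Function.Injective fun i => ℘[L] (w i) := by
  -- `℘'` is odd and vanishes at both half periods, so equal values of `℘` would make them
  -- congruent.
  have key : ∀ a b : ℂ, a ∉ L.lattice → b ∉ L.lattice → 2 * a ∈ L.lattice → 2 * b ∈ L.lattice →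
      b - a ∉ L.lattice → ℘[L] a ≠ ℘[L] b := fun a b ha hb ha2 hb2 hab h => by
    refine hab (sub_mem_of_wp_eq ha hb h ?_)
    rw [wpDeriv.eq_zero_of_odd L.derivWeierstrassP_neg ha2,
      wpDeriv.eq_zero_of_odd L.derivWeierstrassP_neg hb2]
  have n3 : (L.ω₁ + L.ω₂) / 2 ∉ L.lattice := by
    have := L.mul_ω₁_add_mul_ω₂_mem_lattice (α := 1 / 2) (β := 1 / 2)
    have e : (((1 / 2 : ℚ)) * L.ω₁ + ((1 / 2 : ℚ)) * L.ω₂ : ℂ) = (L.ω₁ + L.ω₂) / 2 := by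
      push_cast; ring
    rw [e] at this
    rw [this]
    norm_num [Rat.den_eq_one_iff]
  have m1 : 2 * (L.ω₁ / 2) ∈ L.lattice := by
    rw [mul_div_cancel₀ _ two_ne_zero]; exact L.ω₁_mem_lattice
  have m2 : 2 * (L.ω₂ / 2) ∈ L.lattice := by
    rw [mul_div_cancel₀ _ two_ne_zero]; exact L.ω₂_mem_lattice
  have m3 : 2 * ((L.ω₁ + L.ω₂) / 2) ∈ L.lattice := by
    rw [mul_div_cancel₀ _ two_ne_zero]; exact add_mem L.ω₁_mem_lattice L.ω₂_mem_lattice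
  have h12 : ℘[L] (L.ω₁ / 2) ≠ ℘[L] (L.ω₂ / 2) := by
    refine key _ _ L.ω₁_div_two_notMem_lattice L.ω₂_div_two_notMem_lattice m1 m2 fun h => n3 ?_
    have := add_mem h L.ω₁_mem_lattice
    rwa [show L.ω₂ / 2 - L.ω₁ / 2 + L.ω₁ = (L.ω₁ + L.ω₂) / 2 by ring] at this
  have h13 : ℘[L] (L.ω₁ / 2) ≠ ℘[L] ((L.ω₁ + L.ω₂) / 2) := by
    refine key _ _ L.ω₁_div_two_notMem_lattice n3 m1 m3 fun h => L.ω₂_div_two_notMem_lattice ?_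
    rwa [show (L.ω₁ + L.ω₂) / 2 - L.ω₁ / 2 = L.ω₂ / 2 by ring] at h
  have h23 : ℘[L] (L.ω₂ / 2) ≠ ℘[L] ((L.ω₁ + L.ω₂) / 2) := by
    refine key _ _ L.ω₂_div_two_notMem_lattice n3 m2 m3 fun h => L.ω₁_div_two_notMem_lattice ?_
    rwa [show (L.ω₁ + L.ω₂) / 2 - L.ω₂ / 2 = L.ω₁ / 2 by ring] at h
  refine ⟨![L.ω₁ / 2, L.ω₂ / 2, (L.ω₁ + L.ω₂) / 2], ?_, ?_, ?_⟩
  · intro i; fin_cases i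
    exacts [L.ω₁_div_two_notMem_lattice, L.ω₂_div_two_notMem_lattice, n3]
  · intro i; fin_cases i
    exacts [m1, m2, m3]
  · intro i j hij
    fin_cases i <;> fin_cases j <;> simp_all [eq_comm]

/-- There is no function with a single simple pole. -/
theorem order_ne_neg_one (hu : IsReg L u) : meromorphicOrderAt u 0 ≠ ((-1 : ℤ) : WithTop ℤ) := by
  intro h
  -- The difference `u(z) - u(-z)` is odd and keeps the simple pole. Its product with `℘'` is even
  -- with a pole of order `4`, so a quadratic polynomial in `℘`; but it vanishes at three half
  -- periods with distinct values of `℘`.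
  have hv : IsReg L (u - fun z => u (-z)) := hu.sub hu.comp_neg
  have hvo : ∀ z, (u - fun z => u (-z)) (-z) = -(u - fun z => u (-z)) z := fun z => by simp
  have hvm : meromorphicOrderAt (u - fun z => u (-z)) 0 = ((-1 : ℤ) : WithTop ℤ) := by
    obtain ⟨g, hg, hg0, hgu⟩ := (meromorphicOrderAt_eq_int_iff (hu.meromorphicAt 0)).mp h
    have hg' : AnalyticAt ℂ (fun z => g (-z)) 0 :=
      AnalyticAt.comp (g := g) (f := fun z => -z) (by simpa using hg) (by fun_prop)
    rw [meromorphicOrderAt_eq_int_iff (hv.meromorphicAt 0)]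
    refine ⟨fun z => g z + g (-z), hg.add hg', by simpa [← two_mul] using hg0, ?_⟩
    have ht : Filter.Tendsto (fun z : ℂ => -z) (𝓝[≠] 0) (𝓝[≠] 0) := by
      refine tendsto_nhdsWithin_iff.mpr ⟨?_, ?_⟩
      · have : ContinuousAt (fun z : ℂ => -z) 0 := by fun_prop
        simpa [ContinuousAt] using this.tendsto.mono_left (nhdsWithin_le_nhds (s := {0}ᶜ))
      · filter_upwards [self_mem_nhdsWithin] with z hz
        simpa using hz
    filter_upwards [hgu, ht.eventually hgu] with z h1 h2
    simp only [Pi.sub_apply, h1, h2, sub_zero, zpow_neg_one, smul_eq_mul, inv_neg]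
    ring
  obtain ⟨P, hP⟩ := (hv.mul wpDeriv).exists_eval_of_even fun z => by
    simp only [Pi.mul_apply, hvo, L.derivWeierstrassP_neg]; ring
  have hord : meromorphicOrderAt (fun z => P.eval (℘[L] z)) 0 = ((-4 : ℤ) : WithTop ℤ) := by
    have e : ((u - fun z => u (-z)) * ℘'[L]) =ᶠ[𝓝[≠] 0] fun z => P.eval (℘[L] z) := by
      filter_upwards [eventually_notMem L] with z hz using hP z hz
    rw [← meromorphicOrderAt_congr e, meromorphicOrderAt_mul (hv.meromorphicAt 0)
      (wpDeriv.meromorphicAt 0), hvm, order_wpDeriv]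
    rfl
  have hP0 : P ≠ 0 := by
    rintro rfl
    simp only [Polynomial.eval_zero] at hord
    rw [meromorphicOrderAt_eq_top_iff.mpr (by simp)] at hord
    exact WithTop.top_ne_coe hord
  have hdeg : P.natDegree = 2 := by
    have := (order_eval (m := 2) ((wp (L := L)).meromorphicAt 0) two_pos order_wp P hP0).2
    rw [hord, WithTop.coe_inj] at this
    omega
  obtain ⟨w, w1, w2, w3⟩ := exists_half_periods L
  have := Polynomial.eq_zero_of_natDegree_lt_card_of_eval_eq_zero P w3 (fun i => by
    rw [← hP _ (w1 i), Pi.mul_apply, wpDeriv.eq_zero_of_odd L.derivWeierstrassP_neg (w2 i),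
      mul_zero]) (by simp [hdeg])
  exact hP0 this

/-- At least one of the invariants `g₂, g₃` does not vanish. -/
theorem g₂_ne_zero_or_g₃_ne_zero (L : PeriodPair) : L.g₂ ≠ 0 ∨ L.g₃ ≠ 0 := by
  by_contra! h
  obtain ⟨w, w1, w2, w3⟩ := exists_half_periods L
  -- With `g₂ = g₃ = 0` the equation is `℘'² = 4 ℘³`, and `℘'` is zero at half periods.
  have h0 : ∀ i, ℘[L] (w i) = 0 := fun i => by
    have := L.derivWeierstrassP_sq (w i) (w1 i)
    rw [wpDeriv.eq_zero_of_odd L.derivWeierstrassP_neg (w2 i), h.1, h.2] at this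
    simpa using this.symm
  have : (0 : Fin 3) = 1 := w3 (by simp [h0])
  simp at this

/-! ### Rotations of the lattice -/

/-- A rotation of the lattice as a permutation. -/
def rotationEquiv {a : ℂ} (ha : a ≠ 0) (hL : ∀ z, a * z ∈ L.lattice ↔ z ∈ L.lattice) :
    L.lattice ≃ L.lattice where
  toFun l := ⟨a * l, (hL l).mpr l.2⟩
  invFun l := ⟨a⁻¹ * l, (hL _).mp (by rw [mul_inv_cancel_left₀ ha]; exact l.2)⟩
  left_inv l := Subtype.ext (inv_mul_cancel_left₀ ha _)
  right_inv l := Subtype.ext (mul_inv_cancel_left₀ ha _)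

variable {a : ℂ}

/-- The rotation permutes the lattice points of the sum, whose terms are homogeneous of degree `-2`.
-/
theorem wp_mul (ha : a ≠ 0) (hL : ∀ z, a * z ∈ L.lattice ↔ z ∈ L.lattice) (z : ℂ) :
    ℘[L] (a * z) = (a ^ 2)⁻¹ * ℘[L] z := by
  rw [PeriodPair.weierstrassP, PeriodPair.weierstrassP, ← (rotationEquiv ha hL).tsum_eq,
    ← tsum_mul_left]
  congr 1
  ext l
  simp only [rotationEquiv, Equiv.coe_fn_mk, ← mul_sub, mul_pow, one_div, mul_inv]

theorem wpDeriv_mul (ha : a ≠ 0) (hL : ∀ z, a * z ∈ L.lattice ↔ z ∈ L.lattice) (z : ℂ) :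
    ℘'[L] (a * z) = (a ^ 3)⁻¹ * ℘'[L] z := by
  rw [PeriodPair.derivWeierstrassP, PeriodPair.derivWeierstrassP,
    ← (rotationEquiv ha hL).tsum_eq, mul_neg, ← tsum_mul_left]
  congr 2
  ext l
  simp only [rotationEquiv, Equiv.coe_fn_mk, ← mul_sub, mul_pow, div_eq_mul_inv, mul_inv]
  ring

/-- Permuting the lattice by `a` multiplies the Eisenstein sum by `(a ^ n)⁻¹`. -/
theorem G_eq_zero (ha : a ≠ 0) (hL : ∀ z, a * z ∈ L.lattice ↔ z ∈ L.lattice) {n : ℕ}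
    (h : a ^ n ≠ 1) : L.G n = 0 := by
  have h1 : L.G n = (a ^ n)⁻¹ * L.G n := by
    conv_lhs => rw [PeriodPair.G, ← (rotationEquiv ha hL).tsum_eq]
    rw [PeriodPair.G, ← tsum_mul_left]
    congr 1
    ext l
    simp only [rotationEquiv, Equiv.coe_fn_mk, mul_pow, mul_inv]
  by_contra h0
  have h2 : (a ^ n)⁻¹ = 1 := mul_right_cancel₀ h0 (by rw [← h1, one_mul])
  exact h (inv_eq_one.mp h2)

/-- Isotypic functions are `ℂ[J]`-multiples of a function `g` of minimal order. -/
theorem exists_eval_of_isotypic {m n : ℕ} (ha : IsPrimitiveRoot a m) (hm : 0 < m) {J g : ℂ → ℂ}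
    (hJ : IsReg L J) (hg : IsReg L g)
    (hJm : meromorphicOrderAt J 0 = ((-m : ℤ) : WithTop ℤ))
    (hgn : meromorphicOrderAt g 0 = ((-n : ℤ) : WithTop ℤ)) {χ : ℂ}
    (hJa : ∀ z ∉ L.lattice, J (a * z) = J z) (hga : ∀ z ∉ L.lattice, g (a * z) = χ * g z)
    (hn : ∀ N : ℕ, N ≠ 1 → N ≡ n [MOD m] → n ≤ N)
    (hu : IsReg L u) (hua : ∀ z ∉ L.lattice, u (a * z) = χ * u z) :
    ∃ P : Polynomial ℂ, ∀ z ∉ L.lattice, u z = g z * P.eval (J z) := by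
  have ha0 : a ≠ 0 := ha.ne_zero hm.ne'
  let V : Submodule ℂ (ℂ → ℂ) :=
    { carrier := {u | IsReg L u ∧ ∀ z ∉ L.lattice, u (a * z) = χ * u z}
      add_mem' := fun h h' => ⟨h.1.add h'.1, fun z hz => by
        simp only [Pi.add_apply, h.2 z hz, h'.2 z hz]; ring⟩
      zero_mem' := ⟨const 0, fun z _ => by simp⟩
      smul_mem' := fun c u h => ⟨h.1.smul c, fun z hz => by
        simp only [Pi.smul_apply, h.2 z hz, smul_eq_mul]; ring⟩ }
  refine exists_eval_of_orders (V := V) hJ hg hJm hgn (fun u hu => hu.1) (fun k =>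
    ⟨hg.mul (hJ.pow k), fun z hz => by simp [hJa z hz, hga z hz, mul_assoc]⟩) (fun u hu N hN => ?_)
    ⟨hu, hua⟩
  -- Leading coefficients give `a ^ (-N) = χ = a ^ (-n)`, so `N ≡ n` modulo `m`; since `N = 1`
  -- cannot occur, minimality of `n` is needed only among the other orders.
  have h1 := zpow_order_eq (hu.1.meromorphicAt 0) hN ha0 (χ := χ) (by
    filter_upwards [eventually_notMem L] with z hz using hu.2 z hz)
  have h2 := zpow_order_eq (hg.meromorphicAt 0) hgn ha0 (χ := χ) (by
    filter_upwards [eventually_notMem L] with z hz using hga z hz)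
  rw [← h2, zpow_neg, zpow_neg, inv_inj, zpow_natCast, zpow_natCast] at h1
  have h3 : N ≡ n [MOD m] := by
    rw [ha.eq_orderOf]
    exact (ha.isOfFinOrder hm.ne').pow_eq_pow_iff_modEq.mp h1
  have hN1 : N ≠ 1 := by
    rintro rfl
    exact hu.1.order_ne_neg_one hN
  have h4 := hn N hN1 h3
  obtain ⟨k, hk⟩ := (Nat.modEq_iff_dvd' h4).mp h3.symm
  exact ⟨k, by omega⟩

end IsReg

/-! ### Holomorphic maps of complex tori -/

theorem proj_eq_iff {L : PeriodPair} {z w : ℂ} : proj L z = proj L w ↔ z - w ∈ L.lattice := by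
  rw [← proj_eq_zero_iff, ← sub_eq_zero]; rfl

/-- The lattice is discrete. -/
theorem eventually_eq_of_sub_mem {L : PeriodPair} {d : ℂ → ℂ} {w : ℂ} (hd : ContinuousAt d w)
    (h : ∀ᶠ v in 𝓝 w, d v ∈ L.lattice) : ∀ᶠ v in 𝓝 w, d v = d w := by
  filter_upwards [h, hd.eventually (L.compl_lattice_sdiff_singleton_mem_nhds (d w))] with v h1 h2
  by_contra hne
  exact h2 ⟨h1, hne⟩

/-- Two local lifts of the same map differ by a locally constant lattice vector. -/
theorem deriv_eq_of_proj_eq {L : PeriodPair} {f g : ℂ → ℂ} {w : ℂ} (hf : AnalyticAt ℂ f w)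
    (hg : AnalyticAt ℂ g w) (h : ∀ᶠ v in 𝓝 w, proj L (f v) = proj L (g v)) :
    deriv f w = deriv g w := by
  have h1 := eventually_eq_of_sub_mem (L := L) (d := fun v => f v - g v)
    (hf.continuousAt.sub hg.continuousAt) (h.mono fun v hv => proj_eq_iff.mp hv)
  have h2 : f =ᶠ[𝓝 w] fun v => g v + (f w - g w) := by
    filter_upwards [h1] with v hv
    linear_combination hv
  rw [h2.deriv_eq, deriv_add_const]

/-- Holomorphic maps of complex tori are affine. -/
theorem IsHolomorphic.exists_affine {L L' : PeriodPair} {φ : Torus L → Torus L'}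
    (hφ : IsHolomorphic φ) : ∃ a b : ℂ, ∀ z, φ (proj L z) = proj L' (a * z + b) := by
  choose g hg hg' using hφ
  -- Derivatives of the local lifts do not depend on the lift, so they glue to an entire
  -- `Λ`-periodic function, constant by Liouville.
  let D : ℂ → ℂ := fun z => deriv (g z) z
  have hD : ∀ z, D =ᶠ[𝓝 z] deriv (g z) := fun z => by
    filter_upwards [(hg z).eventually_analyticAt, (hg' z).eventually_nhds] with w h1 h2
    refine deriv_eq_of_proj_eq (L := L') (hg w) h1 ?_
    filter_upwards [hg' w, h2] with v h3 h4
    rw [← h3, h4]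
  have hDa : ∀ z, AnalyticAt ℂ D z := fun z => (hg z).deriv.congr (hD z).symm
  have hDd : Differentiable ℂ D := fun z => (hDa z).differentiableAt
  have hDp : ∀ z l, l ∈ L.lattice → D (z + l) = D z := fun z l hl => by
    have ht : ContinuousAt (fun v : ℂ => v + l) z := by fun_prop
    have h1 : AnalyticAt ℂ (fun v => g (z + l) (v + l)) z :=
      AnalyticAt.comp (g := g (z + l)) (f := fun v => v + l) (hg (z + l)) (by fun_prop)
    have h2 := deriv_eq_of_proj_eq (L := L') h1 (hg z) (by
      filter_upwards [ht.eventually (hg' (z + l)), hg' z] with v h3 h4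
      rw [← h3, ← h4]
      congr 1
      rw [proj_eq_iff]; simpa using hl)
    rwa [deriv_comp_add_const] at h2
  have hDc : ∀ z, D z = D 0 := fun z => hDd.apply_eq_apply_of_bounded
    (IsZLattice.isCompact_range_of_periodic L.lattice D hDd.continuous hDp).isBounded z 0
  obtain ⟨b, hb⟩ := proj_surjective L' (φ (proj L 0))
  refine ⟨D 0, b, ?_⟩
  -- Local lifts have constant derivative `D 0`, so the difference from the affine map is locally
  -- constant on the connected plane.
  have hloc : IsLocallyConstant fun z => φ (proj L z) - proj L' (D 0 * z + b) := by
    rw [IsLocallyConstant.iff_eventually_eq]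
    intro z
    have hconst : ∀ᶠ w in 𝓝 z, g z w - D 0 * w = g z z - D 0 * z := by
      obtain ⟨r, hr, hball⟩ := Metric.eventually_nhds_iff_ball.mp
        ((hg z).eventually_analyticAt.and (hD z))
      filter_upwards [Metric.ball_mem_nhds z hr] with w hw
      have hdiff : DifferentiableOn ℂ (fun w => g z w - D 0 * w) (Metric.ball z r) := fun v hv =>
        ((hball v hv).1.differentiableAt.sub (by fun_prop)).differentiableWithinAt
      refine Metric.isOpen_ball.is_const_of_deriv_eq_zero
        (convex_ball z r).isPreconnected hdiff (fun v hv => ?_) hw (Metric.mem_ball_self hr)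
      have hlin : deriv (fun w => D 0 * w) v = D 0 := by
        rw [deriv_const_mul_field, deriv_id'', mul_one]
      rw [deriv_fun_sub (hball v hv).1.differentiableAt (by fun_prop), hlin, ← (hball v hv).2, hDc]
      exact sub_self _
    filter_upwards [hconst, hg' z] with w h1 h2
    rw [h2, (hg' z).self_of_nhds]
    change proj L' (g z w - (D 0 * w + b)) = proj L' (g z z - (D 0 * z + b))
    rw [← sub_sub, h1, sub_sub]
  intro z
  have h1 := hloc.apply_eq_of_preconnectedSpace z 0
  have h2 : φ (proj L 0) - proj L' (D 0 * 0 + b) = 0 := by rw [mul_zero, zero_add, hb, sub_self]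
  exact sub_eq_zero.mp (h1.trans h2)

theorem eq_zero_of_forall_mul_mem {L : PeriodPair} {c : ℂ} (h : ∀ z, c * z ∈ L.lattice) :
    c = 0 := by
  by_contra hc
  apply L.ω₁_div_two_notMem_lattice
  have := h (c⁻¹ * (L.ω₁ / 2))
  rwa [mul_inv_cancel_left₀ hc] at this

/-- Both sides say that `z` and `0` have the same image under `φ ∘ proj L`. -/
theorem mem_lattice_iff_of_injective {L L' : PeriodPair} {φ : Torus L → Torus L'}
    (hφ : Function.Injective φ) {a b : ℂ} (h : ∀ z, φ (proj L z) = proj L' (a * z + b)) (z : ℂ) :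
    a * z ∈ L'.lattice ↔ z ∈ L.lattice := by
  rw [← proj_eq_zero_iff (L := L), show (0 : Torus L) = proj L 0 from rfl, ← hφ.eq_iff, h, h,
    proj_eq_iff]
  simp

theorem TorusIso.exists_mul {L L' : PeriodPair} (h : TorusIso L L') :
    ∃ a : ℂ, a ≠ 0 ∧ ∀ z, a * z ∈ L'.lattice ↔ z ∈ L.lattice := by
  obtain ⟨φ, h1, -⟩ := h
  obtain ⟨a, b, hab⟩ := h1.exists_affine
  have hL := mem_lattice_iff_of_injective φ.injective hab
  refine ⟨a, ?_, hL⟩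
  rintro rfl
  have := (hL (L.ω₁ / 2)).mp (by simp)
  exact L.ω₁_div_two_notMem_lattice this

theorem TorusIso.of_mul {L L' : PeriodPair} {a : ℂ} (ha : a ≠ 0)
    (hL : ∀ z, a * z ∈ L'.lattice ↔ z ∈ L.lattice) : TorusIso L L' := by
  have h1 : L.lattice.toAddSubgroup ≤ L'.lattice.toAddSubgroup.comap (AddMonoidHom.mulLeft a) :=
    fun z hz => (hL z).mpr hz
  have h2 : L'.lattice.toAddSubgroup ≤ L.lattice.toAddSubgroup.comap (AddMonoidHom.mulLeft a⁻¹) :=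
    fun z hz => (hL (a⁻¹ * z)).mp (by rw [mul_inv_cancel_left₀ ha]; exact hz)
  refine ⟨⟨QuotientAddGroup.map _ _ _ h1, QuotientAddGroup.map _ _ _ h2, fun x => ?_, fun x => ?_⟩,
    fun z => ⟨fun w => a * w, by fun_prop, Filter.Eventually.of_forall fun w => rfl⟩,
    fun z => ⟨fun w => a⁻¹ * w, by fun_prop, Filter.Eventually.of_forall fun w => rfl⟩⟩
  · obtain ⟨z, rfl⟩ := proj_surjective L x
    change proj L (a⁻¹ * (a * z)) = proj L z
    rw [inv_mul_cancel_left₀ ha]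
  · obtain ⟨z, rfl⟩ := proj_surjective L' x
    change proj L' (a * (a⁻¹ * z)) = proj L' z
    rw [mul_inv_cancel_left₀ ha]

/-- Homogeneity of the Eisenstein series. -/
theorem G_eq_mul_of_mul {L L' : PeriodPair} {a : ℂ} (ha : a ≠ 0)
    (hL : ∀ z, a * z ∈ L'.lattice ↔ z ∈ L.lattice) (n : ℕ) : L.G n = a ^ n * L'.G n := by
  let e : L.lattice ≃ L'.lattice :=
    { toFun := fun l => ⟨a * l, (hL l).mpr l.2⟩
      invFun := fun l => ⟨a⁻¹ * l, (hL _).mp (by rw [mul_inv_cancel_left₀ ha]; exact l.2)⟩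
      left_inv := fun l => Subtype.ext (inv_mul_cancel_left₀ ha _)
      right_inv := fun l => Subtype.ext (mul_inv_cancel_left₀ ha _) }
  rw [PeriodPair.G, PeriodPair.G, ← e.tsum_eq, ← tsum_mul_left]
  congr 1
  ext l
  simp only [e, Equiv.coe_fn_mk, mul_pow, mul_inv]
  rw [mul_inv_cancel_left₀ (pow_ne_zero n ha)]

theorem exists_torusIso_tauPeriods (L : PeriodPair) :
    ∃ τ : UpperHalfPlane, TorusIso L (tauPeriods τ) := by
  have h1 : L.ω₁ ≠ 0 := fun h => L.indep.ne_zero 0 (by simpa using h)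
  have him : (L.ω₂ / L.ω₁).im ≠ 0 := by
    intro h
    have h2 : ((L.ω₂ / L.ω₁).re : ℂ) = L.ω₂ / L.ω₁ := Complex.ext rfl (by simpa using h.symm)
    have h3 := LinearIndependent.pair_iff.mp L.indep (L.ω₂ / L.ω₁).re (-1) (by
      rw [Complex.real_smul, h2, div_mul_cancel₀ _ h1]; simp)
    simp at h3
  -- Changing the sign of `ω₂` leaves the lattice unchanged and moves the quotient into the upper
  -- half plane.
  obtain ⟨ε, hε, hpos⟩ : ∃ ε : ℤ, ε * ε = 1 ∧ 0 < ((ε : ℂ) * (L.ω₂ / L.ω₁)).im := by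
    rcases lt_or_gt_of_ne him with h | h
    · exact ⟨-1, by norm_num, by simpa using h⟩
    · exact ⟨1, by norm_num, by simpa using h⟩
  have hεε : (ε : ℂ) * ε = 1 := by exact_mod_cast hε
  refine ⟨⟨_, hpos⟩, TorusIso.of_mul (inv_ne_zero h1) fun z => ?_⟩
  rw [PeriodPair.mem_lattice, PeriodPair.mem_lattice]
  constructor
  · rintro ⟨m, n, h⟩
    refine ⟨m, n * ε, ?_⟩
    change (m : ℂ) * 1 + n * (ε * (L.ω₂ / L.ω₁)) = L.ω₁⁻¹ * z at h
    field_simp at h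
    push_cast
    linear_combination h
  · rintro ⟨m, n, h⟩
    refine ⟨m, n * ε, ?_⟩
    change (m : ℂ) * 1 + (n * ε : ℤ) * (ε * (L.ω₂ / L.ω₁)) = L.ω₁⁻¹ * z
    rw [← h]
    field_simp
    push_cast
    linear_combination (n * L.ω₂) * hεε

/-! ### Finite rotation groups of lattices -/

theorem re_eq_half_of_trace {a : ℂ} (him : a.im ≠ 0) {t d : ℤ} (h : a ^ 2 - t * a + d = 0) :
    2 * a.re = t := by
  have h1 := congrArg Complex.im h
  simp [sq] at h1
  have h2 : a.im * (2 * a.re - t) = 0 := by linear_combination h1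
  linarith [(mul_eq_zero.mp h2).resolve_left him]

/-- The crystallographic restriction. -/
theorem orderOf_rotation {L : PeriodPair} {a : ℂ} {n : ℕ} (hn : 0 < n) (ha : IsPrimitiveRoot a n)
    (hL : ∀ z ∈ L.lattice, a * z ∈ L.lattice) : n ∈ ({1, 2, 3, 4, 6} : Set ℕ) := by
  have hnorm : ‖a‖ = 1 := Complex.norm_eq_one_of_pow_eq_one ha.pow_eq_one hn.ne'
  have hsq : a.re * a.re + a.im * a.im = 1 := by
    rw [← Complex.normSq_apply, Complex.normSq_eq_norm_sq, hnorm, one_pow]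
  have hdvd : ∀ k : ℕ, a ^ k = 1 → n ∣ k := fun k hk => ha.dvd_of_pow_eq_one k hk
  by_cases him : a.im = 0
  · have h2 : a ^ 2 = 1 := by
      rw [him] at hsq
      apply Complex.ext <;> simp [sq, him]
      linarith
    have h3 := Nat.le_of_dvd two_pos (hdvd 2 h2)
    interval_cases n <;> simp
  obtain ⟨p, q, h1⟩ := PeriodPair.mem_lattice.mp (hL _ L.ω₁_mem_lattice)
  obtain ⟨r, s, h2⟩ := PeriodPair.mem_lattice.mp (hL _ L.ω₂_mem_lattice)
  have hw : L.ω₁ ≠ 0 := fun h => L.indep.ne_zero 0 (by simpa using h)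
  -- Cayley–Hamilton for the integral matrix of multiplication by `a` in the basis `ω₁, ω₂`.
  have hchar : a ^ 2 - (p + s : ℤ) * a + (p * s - q * r : ℤ) = 0 := by
    have : (a ^ 2 - (p + s : ℤ) * a + (p * s - q * r : ℤ)) * L.ω₁ = 0 := by
      push_cast
      linear_combination (s - a) * h1 - q * h2
    exact (mul_eq_zero.mp this).resolve_right hw
  have htr := re_eq_half_of_trace him hchar
  generalize p + s = t at htr
  -- A non-real point of the unit circle has `t = 2 Re a` strictly between `-2` and `2`; the
  -- integers `-1, 0, 1` give `a³ = 1`, `a⁴ = 1`, `a⁶ = 1`.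
  have hquad : a ^ 2 = t * a - 1 := by
    apply Complex.ext
    · simp [sq]; linear_combination htr * a.re - hsq
    · simp [sq]; linear_combination htr * a.im
  have him2 : 0 < a.im * a.im := mul_self_pos.mpr him
  have hlt : (t : ℝ) < 2 := by rw [← htr]; nlinarith
  have hgt : -2 < (t : ℝ) := by rw [← htr]; nlinarith
  have hlt' : t < 2 := by exact_mod_cast hlt
  have hgt' : -2 < t := by exact_mod_cast hgt
  have hne1 : n ≠ 0 := hn.ne'
  interval_cases t
  · have h3 : a ^ 3 = 1 := by push_cast at hquad; linear_combination (a - 1) * hquad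
    have h4 := Nat.le_of_dvd (by norm_num) (hdvd 3 h3)
    interval_cases n <;> simp
  · have h3 : a ^ 4 = 1 := by push_cast at hquad; linear_combination (a ^ 2 - 1) * hquad
    have h4 := Nat.le_of_dvd (by norm_num) (hdvd 4 h3)
    interval_cases n <;> simp
  · have h3 : a ^ 6 = 1 := by
      push_cast at hquad; linear_combination (a ^ 3 - 1) * (a + 1) * hquad
    have h4 := hdvd 6 h3
    have h5 := Nat.le_of_dvd (by norm_num) h4
    interval_cases n <;> simp at h4 ⊢

/-! ### Group elements acting as rotations -/

section

variable {L : PeriodPair} {Γ : Type*} [Group Γ] {σ : Γ →* torusAut L}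

theorem act_injective (σ : Γ →* torusAut L) (γ : Γ) : Function.Injective (act σ γ) :=
  (σ γ).1.injective

/-- A group element fixing the origin acts by a rotation. -/
theorem exists_rotation {γ : Γ} (h : act σ γ 0 = 0) : ∃ a : ℂ, a ≠ 0 ∧
    (∀ z, act σ γ (proj L z) = proj L (a * z)) ∧ ∀ z, a * z ∈ L.lattice ↔ z ∈ L.lattice := by
  obtain ⟨a, b, hab⟩ := (σ γ).2.1.exists_affine
  have hab' : ∀ z, act σ γ (proj L z) = proj L (a * z + b) := hab
  have hL := mem_lattice_iff_of_injective (act_injective σ γ) hab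
  refine ⟨a, ?_, fun z => ?_, hL⟩
  · rintro rfl
    exact L.ω₁_div_two_notMem_lattice ((hL (L.ω₁ / 2)).mp (by simp))
  · have h0 := hab' 0
    rw [show proj L 0 = 0 from rfl, h, mul_zero, zero_add, eq_comm, proj_eq_zero_iff] at h0
    rw [hab', proj_eq_iff]
    simpa using h0

theorem act_pow_proj {γ : Γ} {a : ℂ} (h : ∀ z, act σ γ (proj L z) = proj L (a * z)) (k : ℕ)
    (z : ℂ) : act σ (γ ^ k) (proj L z) = proj L (a ^ k * z) := by
  induction k with
  | zero => simp [act_one]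
  | succ k ih => rw [pow_succ', act_mul, ih, h, ← mul_assoc, ← pow_succ']

/-- If `γ ^ k = 1`, then `(1 - a ^ k) z` lies in `Λ` for every `z`, which forces `a ^ k = 1`. The
converse is faithfulness of the action. -/
theorem orderOf_eq_of_rotation (hσ : Function.Injective σ) {γ : Γ} {a : ℂ}
    (h : ∀ z, act σ γ (proj L z) = proj L (a * z)) : orderOf γ = orderOf a := by
  refine orderOf_eq_orderOf_iff.mpr fun k => ⟨fun hk => ?_, fun hk => ?_⟩
  · refine sub_eq_zero.mp (eq_zero_of_forall_mul_mem (L := L) fun z => ?_)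
    have := act_pow_proj h k z
    rw [hk, act_one, eq_comm, proj_eq_iff] at this
    rwa [sub_mul, one_mul]
  · apply hσ
    apply Subtype.ext
    apply Equiv.ext
    intro x
    obtain ⟨z, rfl⟩ := proj_surjective L x
    have := act_pow_proj h k z
    rw [hk, one_mul] at this
    rw [map_one]
    exact this

end

/-- A standard basis of eigenvectors of `φ`, with eigenvalues `a`, `a⁻¹`, `1`. -/
structure sl2.IsEigenbasis (φ : sl2 ≃ₗ[ℂ] sl2) (a : ℂ) (b : Module.Basis (Fin 3) ℂ sl2) : Prop
    extends sl2.IsStandard b where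
  apply_e : φ (b 0) = a • b 0
  apply_f : φ (b 1) = a⁻¹ • b 1
  apply_h : φ (b 2) = b 2

/-! ### Functions on the punctured torus as periodic functions -/

section

variable {L : PeriodPair} {Γ : Type*} [Group Γ] {σ : Γ →* torusAut L}

theorem proj_mem_punctures_iff (hrot : ∀ γ, act σ γ 0 = 0) (z : ℂ) :
    proj L z ∈ punctures σ ↔ z ∈ L.lattice := by
  rw [← proj_eq_zero_iff]
  constructor
  · rintro ⟨γ, h⟩
    simp only [hrot] at h
    exact h.symm
  · intro h
    rw [h]
    exact zero_mem_punctures σ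

theorem act_mul_inv_eq {γ : Γ} {a : ℂ} (ha : a ≠ 0)
    (h : ∀ z, act σ γ (proj L z) = proj L (a * z)) (z : ℂ) :
    act σ γ⁻¹ (proj L z) = proj L (a⁻¹ * z) := by
  have h1 := h (a⁻¹ * z)
  rw [mul_inv_cancel_left₀ ha] at h1
  rw [← h1, ← act_mul, inv_mul_cancel, act_one]

/-- A generator `s` of a finite group of rotations of the torus acts by the primitive root of
unity `a`. -/
structure IsRotation (σ : Γ →* torusAut L) (s : Γ) (a : ℂ) (m : ℕ) : Prop where
  generates : ∀ γ, γ ∈ Subgroup.zpowers s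
  fixes_zero : ∀ γ, act σ γ 0 = 0
  primitive : IsPrimitiveRoot a m
  pos : 0 < m
  act_proj : ∀ z, act σ s (proj L z) = proj L (a * z)
  mul_mem_iff : ∀ z, a * z ∈ L.lattice ↔ z ∈ L.lattice

theorem IsRotation.ne_zero {s : Γ} {a : ℂ} {m : ℕ} (h : IsRotation σ s a m) : a ≠ 0 :=
  h.primitive.ne_zero h.pos.ne'

variable [Finite Γ]

/-- The pullback to `ℂ` of an element of `𝒪_𝕋`. -/
def lift (f : Functions σ) : ℂ → ℂ := pullback L (punctures σ) f.1

theorem lift_apply (hrot : ∀ γ, act σ γ 0 = 0) (f : Functions σ) {z : ℂ} (hz : z ∉ L.lattice) :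
    lift f z = f.1 ⟨proj L z, fun h => hz ((proj_mem_punctures_iff hrot z).mp h)⟩ :=
  pullback_of_notMem _ _

theorem isReg_lift (hrot : ∀ γ, act σ γ 0 = 0) (f : Functions σ) : IsReg L (lift f) := by
  refine ⟨fun z l hl => ?_, fun z => (f.2 z).1, fun z hz =>
    (f.2 z).2 fun h => hz ((proj_mem_punctures_iff hrot z).mp h)⟩
  have : proj L (z + l) = proj L z := by rw [proj_eq_iff]; simpa using hl
  classical
  exact congrArg (fun x : Torus L => if h : x ∉ punctures σ then f.1 ⟨x, h⟩ else 0) this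

/-- Lifts take the default value `0` on the lattice, which carries no information; all comparisons
are made off it. -/
theorem functions_ext (hrot : ∀ γ, act σ γ 0 = 0) {f g : Functions σ}
    (h : ∀ z ∉ L.lattice, lift f z = lift g z) : f = g := by
  apply Subtype.ext
  funext ⟨x, hx⟩
  obtain ⟨z, rfl⟩ := proj_surjective L x
  have hz : z ∉ L.lattice := fun hz => hx ((proj_mem_punctures_iff hrot z).mpr hz)
  have := h z hz
  rwa [lift_apply hrot f hz, lift_apply hrot g hz] at this

theorem lift_mul (hrot : ∀ γ, act σ γ 0 = 0) (f g : Functions σ) {z : ℂ} (hz : z ∉ L.lattice) :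
    lift (f * g) z = lift f z * lift g z := by
  simp only [lift_apply hrot _ hz]; rfl

theorem lift_smul (hrot : ∀ γ, act σ γ 0 = 0) (c : ℂ) (f : Functions σ) {z : ℂ}
    (hz : z ∉ L.lattice) : lift (c • f) z = c * lift f z := by
  simp only [lift_apply hrot _ hz]; rfl

theorem lift_zero (hrot : ∀ γ, act σ γ 0 = 0) {z : ℂ} (hz : z ∉ L.lattice) :
    lift (0 : Functions σ) z = 0 := by
  simp only [lift_apply hrot _ hz]; rfl

theorem lift_one (hrot : ∀ γ, act σ γ 0 = 0) {z : ℂ} (hz : z ∉ L.lattice) :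
    lift (1 : Functions σ) z = 1 := by
  simp only [lift_apply hrot _ hz]; rfl

/-- Evaluation at a point outside the lattice. -/
def evalAt (hrot : ∀ γ, act σ γ 0 = 0) {z : ℂ} (hz : z ∉ L.lattice) : Functions σ →ₐ[ℂ] ℂ :=
  (Pi.evalAlgHom ℂ (fun _ : {x : Torus L // x ∉ punctures σ} => ℂ)
    ⟨proj L z, fun h => hz ((proj_mem_punctures_iff hrot z).mp h)⟩).comp (Subalgebra.val _)

theorem lift_aeval (hrot : ∀ γ, act σ γ 0 = 0) (J : Functions σ) (P : Polynomial ℂ) {z : ℂ}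
    (hz : z ∉ L.lattice) : lift (Polynomial.aeval J P) z = P.eval (lift J z) := by
  rw [lift_apply hrot _ hz, lift_apply hrot _ hz]
  change evalAt hrot hz (Polynomial.aeval J P) = P.eval (evalAt hrot hz J)
  rw [← Polynomial.aeval_algHom_apply, Polynomial.coe_aeval_eq_eval]

theorem lift_wp (hrot : ∀ γ, act σ γ 0 = 0) {z : ℂ} (hz : z ∉ L.lattice) :
    lift (wp σ) z = ℘[L] z := by
  rw [lift_apply hrot _ hz]; rfl

theorem lift_wpDeriv (hrot : ∀ γ, act σ γ 0 = 0) {z : ℂ} (hz : z ∉ L.lattice) :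
    lift (wpDeriv σ) z = ℘'[L] z := by
  rw [lift_apply hrot _ hz]; rfl

theorem lift_actFun (hrot : ∀ γ, act σ γ 0 = 0) {γ : Γ} {a : ℂ} (ha : a ≠ 0)
    (h : ∀ z, act σ γ (proj L z) = proj L (a * z))
    (hL : ∀ z, a * z ∈ L.lattice ↔ z ∈ L.lattice) (f : Functions σ) {z : ℂ} (hz : z ∉ L.lattice) :
    lift (actFun σ γ f) (a * z) = lift f z := by
  rw [lift_apply hrot _ hz, lift_apply hrot _ (fun h => hz ((hL z).mp h))]
  refine congrArg f.1 (Subtype.ext ?_)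
  change act σ γ⁻¹ (proj L (a * z)) = proj L z
  rw [act_mul_inv_eq ha h, inv_mul_cancel_left₀ ha]

theorem actFun_mul (γ δ : Γ) (f : Functions σ) :
    actFun σ (γ * δ) f = actFun σ γ (actFun σ δ f) := by
  apply Subtype.ext
  funext x
  refine congrArg f.1 (Subtype.ext ?_)
  change act σ (γ * δ)⁻¹ x.1 = act σ δ⁻¹ (act σ γ⁻¹ x.1)
  rw [mul_inv_rev, act_mul]

theorem actFun_one (f : Functions σ) : actFun σ 1 f = f := by
  apply Subtype.ext
  funext x
  refine congrArg f.1 (Subtype.ext ?_)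
  change act σ 1⁻¹ x.1 = x.1
  rw [inv_one, act_one]

/-- In a finite group the natural powers of a generator already exhaust the group. -/
theorem mem_invariantFunctions_iff {s : Γ} (hs : ∀ γ, γ ∈ Subgroup.zpowers s) (f : Functions σ) :
    f ∈ invariantFunctions σ ↔ actFun σ s f = f := by
  refine ⟨fun h => h s, fun h γ => ?_⟩
  obtain ⟨n, rfl⟩ := mem_powers_iff_mem_zpowers.mpr (hs γ)
  change actFun σ (s ^ n) f = f
  induction n with
  | zero => rw [pow_zero, actFun_one]
  | succ n ih => rw [pow_succ, actFun_mul, h, ih]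

theorem actFun_aeval {s : Γ} {J : Functions σ} (hJ : actFun σ s J = J) (P : Polynomial ℂ) :
    actFun σ s (Polynomial.aeval J P) = Polynomial.aeval J P := by
  rw [← Polynomial.aeval_algHom_apply, hJ]

variable {𝔤 : Type*} [LieRing 𝔤] [LieAlgebra ℂ 𝔤]

theorem actCurrent_tmul (ρ : Γ →* lieAut 𝔤) (σ : Γ →* torusAut L) (γ : Γ) (f : Functions σ)
    (A : 𝔤) : actCurrent ρ σ γ (f ⊗ₜ A) = actFun σ γ f ⊗ₜ (ρ γ).1 A := rfl

theorem actCurrent_mul (ρ : Γ →* lieAut 𝔤) (γ δ : Γ) (x : CurrentAlgebra 𝔤 σ) :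
    actCurrent ρ σ (γ * δ) x = actCurrent ρ σ γ (actCurrent ρ σ δ x) := by
  induction x using TensorProduct.induction_on with
  | zero => simp
  | add x y hx hy => simp only [map_add, hx, hy]
  | tmul f A => rw [actCurrent_tmul, actCurrent_tmul, actCurrent_tmul, actFun_mul, map_mul]; rfl

theorem actCurrent_one (ρ : Γ →* lieAut 𝔤) (x : CurrentAlgebra 𝔤 σ) :
    actCurrent ρ σ 1 x = x := by
  induction x using TensorProduct.induction_on with
  | zero => simp
  | add x y hx hy => simp only [map_add, hx, hy]
  | tmul f A => rw [actCurrent_tmul, actFun_one, map_one]; rfl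

theorem mem_automorphicLieAlgebra_iff (ρ : Γ →* lieAut 𝔤) {s : Γ}
    (hs : ∀ γ, γ ∈ Subgroup.zpowers s) (x : CurrentAlgebra 𝔤 σ) :
    x ∈ automorphicLieAlgebra ρ σ ↔ actCurrent ρ σ s x = x := by
  refine ⟨fun h => h s, fun h γ => ?_⟩
  obtain ⟨n, rfl⟩ := mem_powers_iff_mem_zpowers.mpr (hs γ)
  change actCurrent ρ σ (s ^ n) x = x
  induction n with
  | zero => rw [pow_zero, actCurrent_one]
  | succ n ih => rw [pow_succ, actCurrent_mul, h, ih]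

/-! ### Isotypic functions -/

namespace IsRotation

variable {s : Γ} {a : ℂ} {m : ℕ}

theorem lift_mul_of_actFun (h : IsRotation σ s a m) {f : Functions σ} {χ : ℂ} (hχ : χ ≠ 0)
    (hf : actFun σ s f = χ • f)
    {z : ℂ} (hz : z ∉ L.lattice) : lift f (a * z) = χ⁻¹ * lift f z := by
  have h1 := lift_actFun h.fixes_zero h.ne_zero h.act_proj h.mul_mem_iff f hz
  rw [hf, lift_smul h.fixes_zero _ _ (fun h' => hz ((h.mul_mem_iff z).mp h'))] at h1
  rw [← h1, inv_mul_cancel_left₀ hχ]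

theorem actFun_of_lift_mul (h : IsRotation σ s a m) {f : Functions σ} {χ : ℂ}
    (hf : ∀ z ∉ L.lattice, lift f z = χ * lift f (a * z)) : actFun σ s f = χ • f := by
  refine functions_ext h.fixes_zero fun z hz => ?_
  have hz' : a⁻¹ * z ∉ L.lattice := fun h' => hz (by
    rw [← mul_inv_cancel_left₀ h.ne_zero z]; exact (h.mul_mem_iff _).mpr h')
  have h1 := lift_actFun h.fixes_zero h.ne_zero h.act_proj h.mul_mem_iff f hz'
  have h2 := hf _ hz'
  rw [mul_inv_cancel_left₀ h.ne_zero] at h1 h2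
  rw [h1, lift_smul h.fixes_zero _ _ hz, h2]

/-- The action composes with `a⁻¹`, which turns homogeneity of degree `-2` into the eigenvalue `a ^
2`. -/
theorem actFun_wp (h : IsRotation σ s a m) : actFun σ s (wp σ) = (a ^ 2) • wp σ := by
  refine h.actFun_of_lift_mul fun z hz => ?_
  rw [lift_wp h.fixes_zero hz, lift_wp h.fixes_zero (fun h' => hz ((h.mul_mem_iff z).mp h')),
    IsReg.wp_mul h.ne_zero h.mul_mem_iff, mul_inv_cancel_left₀ (pow_ne_zero 2 h.ne_zero)]

theorem actFun_wpDeriv (h : IsRotation σ s a m) : actFun σ s (wpDeriv σ) = (a ^ 3) • wpDeriv σ := by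
  refine h.actFun_of_lift_mul fun z hz => ?_
  rw [lift_wpDeriv h.fixes_zero hz,
    lift_wpDeriv h.fixes_zero (fun h' => hz ((h.mul_mem_iff z).mp h')),
    IsReg.wpDeriv_mul h.ne_zero h.mul_mem_iff, mul_inv_cancel_left₀ (pow_ne_zero 3 h.ne_zero)]

/-- Isotypic elements of `𝒪_𝕋` are `ℂ[J]`-multiples of an element of minimal order. -/
theorem exists_eq_mul_aeval (h : IsRotation σ s a m) {n : ℕ} {J g : Functions σ}
    (hJ : actFun σ s J = J) {χ : ℂ}
    (hχ : χ ≠ 0) (hg : actFun σ s g = χ • g)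
    (hJm : meromorphicOrderAt (lift J) 0 = ((-m : ℤ) : WithTop ℤ))
    (hgn : meromorphicOrderAt (lift g) 0 = ((-n : ℤ) : WithTop ℤ))
    (hn : ∀ N : ℕ, N ≠ 1 → N ≡ n [MOD m] → n ≤ N) {f : Functions σ} (hf : actFun σ s f = χ • f) :
    ∃ P : Polynomial ℂ, f = g * Polynomial.aeval J P := by
  have hJ1 : actFun σ s J = (1 : ℂ) • J := by rw [hJ, one_smul]
  obtain ⟨P, hP⟩ := IsReg.exists_eval_of_isotypic (n := n) (χ := χ⁻¹) h.primitive h.pos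
    (isReg_lift h.fixes_zero J)
    (isReg_lift h.fixes_zero g) hJm hgn
    (fun z hz => by rw [h.lift_mul_of_actFun one_ne_zero hJ1 hz]; simp)
    (fun z hz => h.lift_mul_of_actFun hχ hg hz) hn (isReg_lift h.fixes_zero f)
    (fun z hz => h.lift_mul_of_actFun hχ hf hz)
  refine ⟨P, functions_ext h.fixes_zero fun z hz => ?_⟩
  rw [hP z hz, lift_mul h.fixes_zero _ _ hz, lift_aeval h.fixes_zero _ _ hz]

theorem eq_zero_of_mul_eq_zero (h : IsRotation σ s a m) {f g : Functions σ}
    (hg : meromorphicOrderAt (lift g) 0 ≠ ⊤)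
    (h0 : f * g = 0) : f = 0 := by
  refine functions_ext h.fixes_zero fun z hz => ?_
  rw [lift_zero h.fixes_zero hz]
  refine (isReg_lift h.fixes_zero f).eq_zero_of_mul
    ((isReg_lift h.fixes_zero g).meromorphicAt 0) hg (fun z hz => ?_) z hz
  rw [← lift_mul h.fixes_zero _ _ hz, h0, lift_zero h.fixes_zero hz]

theorem aeval_injective (h : IsRotation σ s a m) {J : Functions σ}
    (hJm : meromorphicOrderAt (lift J) 0 = ((-m : ℤ) : WithTop ℤ)) :
    Function.Injective (Polynomial.aeval J : Polynomial ℂ →ₐ[ℂ] Functions σ) := by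
  rw [injective_iff_map_eq_zero]
  intro P hP
  refine IsReg.eq_zero_of_eval (L := L) ((isReg_lift h.fixes_zero J).meromorphicAt 0) h.pos hJm P
    fun z hz => ?_
  rw [← lift_aeval h.fixes_zero _ _ hz, hP, lift_zero h.fixes_zero hz]

theorem order_lift_one (h : IsRotation σ s a m) :
    meromorphicOrderAt (lift (1 : Functions σ)) 0 = ((-(0 : ℕ) : ℤ) : WithTop ℤ) := by
  rw [← IsReg.order_one]
  refine meromorphicOrderAt_congr ?_
  filter_upwards [IsReg.eventually_notMem L] with z hz
  rw [lift_one h.fixes_zero hz]; rfl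

theorem order_lift_mul (h : IsRotation σ s a m) (f g : Functions σ) :
    meromorphicOrderAt (lift (f * g)) 0 =
    meromorphicOrderAt (lift f) 0 + meromorphicOrderAt (lift g) 0 := by
  rw [← meromorphicOrderAt_mul ((isReg_lift h.fixes_zero f).meromorphicAt 0)
    ((isReg_lift h.fixes_zero g).meromorphicAt 0)]
  refine meromorphicOrderAt_congr ?_
  filter_upwards [IsReg.eventually_notMem L] with z hz
  rw [lift_mul h.fixes_zero _ _ hz]; rfl

theorem order_lift_wp (h : IsRotation σ s a m) :
    meromorphicOrderAt (lift (wp σ)) 0 = ((-2 : ℤ) : WithTop ℤ) := by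
  rw [← IsReg.order_wp (L := L)]
  refine meromorphicOrderAt_congr ?_
  filter_upwards [IsReg.eventually_notMem L] with z hz
  rw [lift_wp h.fixes_zero hz]

theorem order_lift_wpDeriv (h : IsRotation σ s a m) :
    meromorphicOrderAt (lift (wpDeriv σ)) 0 = ((-3 : ℤ) : WithTop ℤ) := by
  rw [← IsReg.order_wpDeriv (L := L)]
  refine meromorphicOrderAt_congr ?_
  filter_upwards [IsReg.eventually_notMem L] with z hz
  rw [lift_wpDeriv h.fixes_zero hz]

theorem invariantFunctions_eq (h : IsRotation σ s a m) {J : Functions σ} (hJ : actFun σ s J = J)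
    (hJm : meromorphicOrderAt (lift J) 0 = ((-m : ℤ) : WithTop ℤ)) :
    invariantFunctions σ = Algebra.adjoin ℂ {J} := by
  apply le_antisymm
  · intro f hf
    rw [mem_invariantFunctions_iff h.generates] at hf
    obtain ⟨P, rfl⟩ := h.exists_eq_mul_aeval (g := 1) (n := 0) hJ one_ne_zero
      (by rw [map_one, one_smul]) hJm h.order_lift_one (fun N _ _ => N.zero_le)
      (by rw [hf, one_smul])
    rw [one_mul]
    exact Polynomial.aeval_mem_adjoin_singleton ℂ J
  · rw [Algebra.adjoin_le_iff, Set.singleton_subset_iff]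
    exact (mem_invariantFunctions_iff h.generates J).mpr hJ

/-- Normal form of the automorphic Lie algebra. -/
theorem isNormalForm (h : IsRotation σ s a m) (ρ : Γ →* lieAut sl2) {b : Module.Basis (Fin 3) ℂ sl2}
    (hb : sl2.IsEigenbasis (ρ s).1 a b) {J g₁ g₂ : Functions σ} {n₁ n₂ : ℕ} (hJ : actFun σ s J = J)
    (hJm : meromorphicOrderAt (lift J) 0 = ((-m : ℤ) : WithTop ℤ))
    (hg₁ : actFun σ s g₁ = a⁻¹ • g₁)
    (hg₁n : meromorphicOrderAt (lift g₁) 0 = ((-n₁ : ℤ) : WithTop ℤ))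
    (hn₁ : ∀ N : ℕ, N ≠ 1 → N ≡ n₁ [MOD m] → n₁ ≤ N)
    (hg₂ : actFun σ s g₂ = a • g₂)
    (hg₂n : meromorphicOrderAt (lift g₂) 0 = ((-n₂ : ℤ) : WithTop ℤ))
    (hn₂ : ∀ N : ℕ, N ≠ 1 → N ≡ n₂ [MOD m] → n₂ ≤ N) :
    IsNormalForm (automorphicLieAlgebra ρ σ) (invariantFunctions σ)
      (g₁ ⊗ₜ b 0) (g₂ ⊗ₜ b 1) (1 ⊗ₜ b 2) (g₁ * g₂) := by
  -- The eigenbasis is a basis of the current algebra over `𝒪_𝕋`, so invariance can be tested on the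
  -- three coefficients.
  let B := Algebra.TensorProduct.basis (Functions σ) b
  have hB : ∀ x y z : Functions σ, x ⊗ₜ[ℂ] b 0 + y ⊗ₜ[ℂ] b 1 + z ⊗ₜ[ℂ] b 2
      = x • B 0 + y • B 1 + z • B 2 := fun x y z => by
    simp [B, TensorProduct.smul_tmul']
  have hBinj : ∀ x y z x' y' z' : Functions σ,
      x ⊗ₜ[ℂ] b 0 + y ⊗ₜ[ℂ] b 1 + z ⊗ₜ[ℂ] b 2 = x' ⊗ₜ[ℂ] b 0 + y' ⊗ₜ[ℂ] b 1 + z' ⊗ₜ[ℂ] b 2 →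
      x = x' ∧ y = y' ∧ z = z' := fun x y z x' y' z' hxy => by
    rw [hB, hB] at hxy
    refine ⟨?_, ?_, ?_⟩
    · simpa using congrArg (fun v => B.repr v 0) hxy
    · simpa using congrArg (fun v => B.repr v 1) hxy
    · simpa using congrArg (fun v => B.repr v 2) hxy
  have hact : ∀ x y z : Functions σ,
      actCurrent ρ σ s (x ⊗ₜ[ℂ] b 0 + y ⊗ₜ[ℂ] b 1 + z ⊗ₜ[ℂ] b 2) =
      (a • actFun σ s x) ⊗ₜ[ℂ] b 0 + (a⁻¹ • actFun σ s y) ⊗ₜ[ℂ] b 1 +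
        actFun σ s z ⊗ₜ[ℂ] b 2 := fun x y z => by
    rw [map_add, map_add, actCurrent_tmul, actCurrent_tmul, actCurrent_tmul, hb.apply_e, hb.apply_f,
      hb.apply_h]
    simp only [TensorProduct.tmul_smul, TensorProduct.smul_tmul']
  have hsm : ∀ x y z : Functions σ, x • (g₁ ⊗ₜ[ℂ] b 0) + y • (g₂ ⊗ₜ[ℂ] b 1)
      + z • ((1 : Functions σ) ⊗ₜ[ℂ] b 2)
      = (x * g₁) ⊗ₜ[ℂ] b 0 + (y * g₂) ⊗ₜ[ℂ] b 1 + z ⊗ₜ[ℂ] b 2 := fun x y z => by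
    simp only [TensorProduct.smul_tmul', smul_eq_mul, mul_one]
  have ha := h.ne_zero
  have hpoly : ∀ P : Polynomial ℂ, Polynomial.aeval J P ∈ invariantFunctions σ := fun P =>
    (mem_invariantFunctions_iff h.generates _).mpr (actFun_aeval hJ P)
  refine ⟨fun x => ⟨fun hx => ?_, ?_⟩, ?_, ?_, ?_, ?_, ?_⟩
  · rw [mem_automorphicLieAlgebra_iff ρ h.generates] at hx
    obtain ⟨u, v, w, rfl⟩ : ∃ u v w : Functions σ,
        x = u ⊗ₜ[ℂ] b 0 + v ⊗ₜ[ℂ] b 1 + w ⊗ₜ[ℂ] b 2 :=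
      ⟨B.repr x 0, B.repr x 1, B.repr x 2, by
        rw [hB]; conv_lhs => rw [← B.sum_repr x, Fin.sum_univ_three]⟩
    rw [hact] at hx
    obtain ⟨hu, hv, hw⟩ := hBinj _ _ _ _ _ _ hx
    -- As `b 0` has eigenvalue `a`, its coefficient in an invariant element has eigenvalue `a⁻¹`;
    -- for `b 1` the roles are exchanged.
    obtain ⟨P, hP⟩ := h.exists_eq_mul_aeval hJ (inv_ne_zero ha) hg₁ hJm hg₁n hn₁ (f := u)
      (by conv_rhs => rw [← hu, smul_smul, inv_mul_cancel₀ ha, one_smul])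
    obtain ⟨Q, hQ⟩ := h.exists_eq_mul_aeval hJ ha hg₂ hJm hg₂n hn₂ (f := v)
      (by conv_rhs => rw [← hv, smul_smul, mul_inv_cancel₀ ha, one_smul])
    refine ⟨_, hpoly P, _, hpoly Q, w, (mem_invariantFunctions_iff h.generates _).mpr hw, ?_⟩
    rw [hsm, mul_comm _ g₁, mul_comm _ g₂, ← hP, ← hQ]
  · rintro ⟨u, hu, v, hv, w, hw, rfl⟩
    rw [mem_automorphicLieAlgebra_iff ρ h.generates, hsm, hact, map_mul, map_mul, hu s, hv s,
      hw s, hg₁, hg₂, mul_smul_comm, mul_smul_comm, smul_smul, smul_smul, mul_inv_cancel₀ ha,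
      inv_mul_cancel₀ ha, one_smul, one_smul]
  · intro u _ v _ w _ h0
    rw [hsm] at h0
    obtain ⟨e1, e2, e3⟩ := hBinj _ _ _ 0 0 0 (by rw [h0]; simp)
    exact ⟨h.eq_zero_of_mul_eq_zero (by rw [hg₁n]; exact WithTop.coe_ne_top) e1,
      h.eq_zero_of_mul_eq_zero (by rw [hg₂n]; exact WithTop.coe_ne_top) e2, e3⟩
  · rw [LieAlgebra.ExtendScalars.bracket_tmul, hb.lie_h_e, one_mul, TensorProduct.tmul_smul]
  · rw [LieAlgebra.ExtendScalars.bracket_tmul, hb.lie_h_f, one_mul, TensorProduct.tmul_smul]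
  · rw [LieAlgebra.ExtendScalars.bracket_tmul, hb.lie_e_f, TensorProduct.smul_tmul', smul_eq_mul,
      mul_one]
  · rw [mem_invariantFunctions_iff h.generates, map_mul, hg₁, hg₂, smul_mul_smul_comm,
      inv_mul_cancel₀ ha, one_smul]

end IsRotation

/-! ### From normal forms to twisted `𝔰𝔩₂` -/

theorem lie_of_normalForm {R 𝔏 : Type*} [CommRing R] [LieRing 𝔏] [LieAlgebra R 𝔏] {p : R}
    {E F H : 𝔏} (hHE : ⁅H, E⁆ = (2 : R) • E) (hHF : ⁅H, F⁆ = (-2 : R) • F) (hEF : ⁅E, F⁆ = p • H)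
    (a b c a' b' c' : R) : ⁅a • E + b • F + c • H, a' • E + b' • F + c' • H⁆ =
      (2 * (c * a' - a * c')) • E + (-2 * (c * b' - b * c')) • F + (p * (a * b' - b * a')) • H := by
  have hEH : ⁅E, H⁆ = (-2 : R) • E := by rw [← lie_skew, hHE]; module
  have hFH : ⁅F, H⁆ = (2 : R) • F := by rw [← lie_skew, hHF]; module
  have hFE : ⁅F, E⁆ = -(p • H) := by rw [← lie_skew, hEF]
  simp only [lie_add, add_lie, smul_lie, lie_smul, lie_self, hHE, hHF, hEF, hEH, hFH, hFE]
  module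

/-- A Lie algebra in normal form over `ℂ[J]`, with `J` transcendental, is a twisted `𝔰𝔩₂`. -/
theorem IsNormalForm.nonempty_equiv {𝔄 : LieSubalgebra ℂ (CurrentAlgebra 𝔤 σ)} {J : Functions σ}
    {E F H : CurrentAlgebra 𝔤 σ} {P : Polynomial ℂ}
    (h : IsNormalForm 𝔄 (Algebra.adjoin ℂ {J}) E F H (Polynomial.aeval J P))
    (hJ : Function.Injective (Polynomial.aeval J : Polynomial ℂ →ₐ[ℂ] Functions σ)) :
    Nonempty (𝔄 ≃ₗ⁅ℂ⁆ TwistedSl2 P) := by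
  have hmem : ∀ Q : Polynomial ℂ, Polynomial.aeval J Q ∈ Algebra.adjoin ℂ {J} := fun Q =>
    Polynomial.aeval_mem_adjoin_singleton ℂ J
  let φ : TwistedSl2 P →ₗ[ℂ] CurrentAlgebra 𝔤 σ :=
    { toFun := fun v => Polynomial.aeval J v.coeffE • E + Polynomial.aeval J v.coeffF • F +
        Polynomial.aeval J v.coeffH • H
      map_add' := fun v w => by
        simp only [TwistedSl2.add_coeffE, TwistedSl2.add_coeffF, TwistedSl2.add_coeffH, map_add,
          add_smul]
        abel
      map_smul' := fun c v => by
        simp only [TwistedSl2.smul_coeffE, TwistedSl2.smul_coeffF, TwistedSl2.smul_coeffH,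
          map_smul, smul_assoc, smul_add, RingHom.id_apply] }
  have hφ : ∀ v, φ v = Polynomial.aeval J v.coeffE • E + Polynomial.aeval J v.coeffF • F +
    Polynomial.aeval J v.coeffH • H := fun v => rfl
  have hφA : ∀ v, φ v ∈ 𝔄 := fun v => (h.mem_iff _).mpr ⟨_, hmem _, _, hmem _, _, hmem _, rfl⟩
  have hφlie : ∀ v w, φ ⁅v, w⁆ = ⁅φ v, φ w⁆ := fun v w => by
    have c2 : ∀ (c : ℂ) (X : CurrentAlgebra 𝔤 σ), c • X = (algebraMap ℂ (Functions σ) c) • X :=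
      fun c X => (algebraMap_smul _ c X).symm
    have key := lie_of_normalForm (R := Functions σ) (𝔏 := CurrentAlgebra 𝔤 σ)
      (p := Polynomial.aeval J P) (E := E) (F := F) (H := H)
      (by rw [← map_ofNat (algebraMap ℂ (Functions σ)) 2, ← c2]; exact h.lie_H_E)
      (by rw [← map_ofNat (algebraMap ℂ (Functions σ)) 2, ← map_neg, ← c2]; exact h.lie_H_F)
      h.lie_E_F (Polynomial.aeval J v.coeffE) (Polynomial.aeval J v.coeffF)
      (Polynomial.aeval J v.coeffH) (Polynomial.aeval J w.coeffE) (Polynomial.aeval J w.coeffF)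
      (Polynomial.aeval J w.coeffH)
    refine Eq.trans ?_ key.symm
    rw [hφ, TwistedSl2.lie_coeffE, TwistedSl2.lie_coeffF, TwistedSl2.lie_coeffH]
    simp only [map_mul, map_sub, map_neg, map_ofNat]
  let ψ : TwistedSl2 P →ₗ⁅ℂ⁆ 𝔄 :=
    { toFun := fun v => ⟨φ v, hφA v⟩
      map_add' := fun v w => Subtype.ext (φ.map_add v w)
      map_smul' := fun c v => Subtype.ext (φ.map_smul c v)
      map_lie' := fun {v w} => Subtype.ext (hφlie v w) }
  have hψ : Function.Bijective ψ := by
    constructor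
    · rw [injective_iff_map_eq_zero]
      intro v hv
      have h0 : φ v = 0 := congrArg Subtype.val hv
      obtain ⟨e1, e2, e3⟩ := h.independent _ (hmem _) _ (hmem _) _ (hmem _) h0
      exact TwistedSl2.ext (hJ (by rw [e1]; exact (map_zero _).symm))
        (hJ (by rw [e2]; exact (map_zero _).symm)) (hJ (by rw [e3]; exact (map_zero _).symm))
    · rintro ⟨x, hx⟩
      obtain ⟨u, hu, v, hv, w, hw, rfl⟩ := (h.mem_iff x).mp hx
      rw [Algebra.adjoin_singleton_eq_range_aeval] at hu hv hw
      obtain ⟨u, rfl⟩ := hu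
      obtain ⟨v, rfl⟩ := hv
      obtain ⟨w, rfl⟩ := hw
      exact ⟨.mk P u v w, Subtype.ext rfl⟩
  exact ⟨(LieEquiv.ofBijective ψ hψ).symm⟩

end

open Polynomial

/-! ### Explicit normal forms -/

theorem orderOf_rho {Γ : Type*} [Group Γ] {s : Γ} {ρ : Γ →* lieAut sl2} (hρ : Function.Injective ρ)
    (hs : ∀ γ, γ ∈ Subgroup.zpowers s) : orderOf (ρ s).1 = Nat.card Γ := by
  rw [Subgroup.orderOf_coe, orderOf_injective ρ hρ, orderOf_eq_card_of_forall_mem_zpowers hs]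

section

variable {L : PeriodPair} {Γ : Type*} [Group Γ] [Finite Γ] {σ : Γ →* torusAut L} {s : Γ} {a : ℂ}

theorem wpDeriv_sq (hrot : ∀ γ, act σ γ 0 = 0) :
    wpDeriv σ ^ 2 = 4 * wp σ ^ 3 - L.g₂ • wp σ - algebraMap ℂ (Functions σ) L.g₃ := by
  have h1 : aeval (wp σ) (4 * X ^ 3 - C L.g₂ * X - C L.g₃) =
      4 * wp σ ^ 3 - L.g₂ • wp σ - algebraMap ℂ (Functions σ) L.g₃ := by
    simp only [map_sub, map_mul, map_pow, aeval_X, aeval_C, map_ofNat, ← Algebra.smul_def]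
  rw [← h1]
  refine functions_ext hrot fun z hz => ?_
  rw [lift_aeval hrot _ _ hz, pow_two, lift_mul hrot _ _ hz, lift_wpDeriv hrot hz, lift_wp hrot hz,
    ← pow_two, L.derivWeierstrassP_sq z hz]
  simp

namespace IsRotation

theorem actFun_wp_two (h : IsRotation σ s a 2) : actFun σ s (wp σ) = wp σ := by
  rw [h.actFun_wp, h.primitive.pow_eq_one, one_smul]

theorem invariantFunctions_two (h : IsRotation σ s a 2) :
    invariantFunctions σ = Algebra.adjoin ℂ {wp σ} :=
  h.invariantFunctions_eq h.actFun_wp_two h.order_lift_wp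

theorem nonempty_equiv_two (h : IsRotation σ s a 2) {ρ : Γ →* lieAut sl2}
    {b : Module.Basis (Fin 3) ℂ sl2}
    (hb : sl2.IsEigenbasis (ρ s).1 a b) : Nonempty (automorphicLieAlgebra ρ σ ≃ₗ⁅ℂ⁆
      TwistedSl2 (4 * X ^ 3 - C L.g₂ * X - C L.g₃)) := by
  have h2 := h.primitive.pow_eq_one
  have ha : a⁻¹ = a := inv_eq_of_mul_eq_one_left (by rw [← pow_two, h2])
  have h3 : actFun σ s (wpDeriv σ) = a • wpDeriv σ := by
    rw [h.actFun_wpDeriv, show a ^ 3 = a ^ 2 * a by ring, h2, one_mul]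
  -- Odd pole orders start at `3`, as `1` is excluded; `℘'` serves both `E` and `F` since `a⁻¹ = a`.
  have hN : ∀ N : ℕ, N ≠ 1 → N ≡ 3 [MOD 2] → 3 ≤ N := fun N h1 h2 => by
    change N % 2 = 3 % 2 at h2; omega
  have key := h.isNormalForm ρ hb (n₁ := 3) (n₂ := 3) h.actFun_wp_two h.order_lift_wp
    (by rw [ha]; exact h3) h.order_lift_wpDeriv hN h3 h.order_lift_wpDeriv hN
  rw [h.invariantFunctions_two] at key
  have hp : wpDeriv σ * wpDeriv σ = aeval (wp σ) (4 * X ^ 3 - C L.g₂ * X - C L.g₃) := by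
    rw [← pow_two, wpDeriv_sq h.fixes_zero]
    simp only [map_sub, map_mul, map_pow, aeval_X, aeval_C, map_ofNat, ← Algebra.smul_def]
  rw [hp] at key
  exact key.nonempty_equiv (h.aeval_injective h.order_lift_wp)

theorem actFun_wpDeriv_three (h : IsRotation σ s a 3) : actFun σ s (wpDeriv σ) = wpDeriv σ := by
  rw [h.actFun_wpDeriv, h.primitive.pow_eq_one, one_smul]

theorem invariantFunctions_three (h : IsRotation σ s a 3) :
    invariantFunctions σ = Algebra.adjoin ℂ {wpDeriv σ} :=
  h.invariantFunctions_eq h.actFun_wpDeriv_three h.order_lift_wpDeriv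

theorem isNormalForm_three (h : IsRotation σ s a 3) {ρ : Γ →* lieAut sl2}
    {b : Module.Basis (Fin 3) ℂ sl2}
    (hb : sl2.IsEigenbasis (ρ s).1 a b) :
    IsNormalForm (automorphicLieAlgebra ρ σ) (invariantFunctions σ)
      (wp σ ⊗ₜ b 0) ((wp σ ^ 2) ⊗ₜ b 1) (1 ⊗ₜ b 2) (wp σ ^ 3) := by
  have h3 := h.primitive.pow_eq_one
  have ha : a⁻¹ = a ^ 2 := inv_eq_of_mul_eq_one_left (by rw [← h3]; ring)
  rw [show wp σ ^ 3 = wp σ * wp σ ^ 2 by ring]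
  -- The class of `1` modulo `3` has least admissible pole order `4`, that of `℘²`.
  refine h.isNormalForm ρ hb (n₁ := 2) (n₂ := 4) h.actFun_wpDeriv_three h.order_lift_wpDeriv
    ?_ h.order_lift_wp (fun N h1 h2 => ?_) ?_ ?_ (fun N h1 h2 => ?_)
  · rw [h.actFun_wp, ha]
  · change N % 3 = 2 % 3 at h2; omega
  · rw [map_pow, h.actFun_wp, _root_.smul_pow, ← pow_mul, show a ^ (2 * 2) = a ^ 3 * a by ring, h3,
      one_mul]
  · rw [pow_two, h.order_lift_mul, h.order_lift_wp]; rfl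
  · change N % 3 = 4 % 3 at h2; omega

theorem nonempty_equiv_three (h : IsRotation σ s a 3) {ρ : Γ →* lieAut sl2}
    {b : Module.Basis (Fin 3) ℂ sl2}
    (hb : sl2.IsEigenbasis (ρ s).1 a b) : Nonempty (automorphicLieAlgebra ρ σ ≃ₗ⁅ℂ⁆ Onsager) := by
  have hg₂ : L.g₂ = 0 := by
    rw [PeriodPair.g₂, IsReg.G_eq_zero h.ne_zero h.mul_mem_iff, mul_zero]
    exact fun h' => absurd (h.primitive.dvd_of_pow_eq_one _ h') (by norm_num)
  have hg₃ := (IsReg.g₂_ne_zero_or_g₃_ne_zero L).resolve_left (not_not.mpr hg₂)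
  -- With `g₂ = 0` one has `p = ℘³ = (℘'² + g₃) / 4`, with roots `±r` in `J = ℘'`.
  obtain ⟨r, hr⟩ : ∃ r : ℂ, r ^ 2 = -L.g₃ := IsAlgClosed.exists_pow_nat_eq _ two_pos
  have hr0 : r ≠ 0 := by rintro rfl; apply hg₃; linear_combination hr
  have key := h.isNormalForm_three hb
  rw [h.invariantFunctions_three] at key
  have hsq := wpDeriv_sq h.fixes_zero
  rw [hg₂, zero_smul, sub_zero] at hsq
  obtain ⟨e⟩ := IsNormalForm.nonempty_equiv (J := wpDeriv σ)
    (P := C (1 / 4) * ((X - C r) * (X - C (-r)))) (by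
      convert key using 1
      rw [show (X - C r) * (X - C (-r)) = X ^ 2 - C (r ^ 2) by
        rw [C_neg, C_pow]; ring, hr, map_mul, map_sub, map_pow, aeval_X, aeval_C, aeval_C, hsq,
        map_neg, sub_neg_eq_add, sub_add_cancel, ← Algebra.smul_def,
        show (4 : Functions σ) = algebraMap ℂ _ 4 from (map_ofNat _ 4).symm, ← Algebra.smul_def,
        smul_smul]
      norm_num)
    (h.aeval_injective h.order_lift_wpDeriv)
  obtain ⟨e₂⟩ := Onsager.nonempty_equiv_of_quadratic (a := 1 / 4) (r := r) (s := -r) (by norm_num)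
    (fun h' => hr0 (self_eq_neg.mp h')) rfl
  exact ⟨e.trans e₂⟩

theorem actFun_wp_sq (h : IsRotation σ s a 4) : actFun σ s (wp σ ^ 2) = wp σ ^ 2 := by
  rw [map_pow, h.actFun_wp, _root_.smul_pow, ← pow_mul, h.primitive.pow_eq_one, one_smul]

theorem order_lift_wp_sq (h : IsRotation σ s a 4) :
    meromorphicOrderAt (lift (wp σ ^ 2)) 0 = ((-(4 : ℕ) : ℤ) : WithTop ℤ) := by
  rw [pow_two, h.order_lift_mul, h.order_lift_wp]; rfl

theorem invariantFunctions_four (h : IsRotation σ s a 4) :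
    invariantFunctions σ = Algebra.adjoin ℂ {wp σ ^ 2} :=
  h.invariantFunctions_eq h.actFun_wp_sq h.order_lift_wp_sq

theorem isNormalForm_four (h : IsRotation σ s a 4) {ρ : Γ →* lieAut sl2}
    {b : Module.Basis (Fin 3) ℂ sl2}
    (hb : sl2.IsEigenbasis (ρ s).1 a b) :
    IsNormalForm (automorphicLieAlgebra ρ σ) (invariantFunctions σ)
      (wpDeriv σ ⊗ₜ b 0) ((wp σ * wpDeriv σ) ⊗ₜ b 1) (1 ⊗ₜ b 2) (wp σ * wpDeriv σ ^ 2) := by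
  have h4 := h.primitive.pow_eq_one
  have ha : a⁻¹ = a ^ 3 := inv_eq_of_mul_eq_one_left (by rw [← h4]; ring)
  rw [show wp σ * wpDeriv σ ^ 2 = wpDeriv σ * (wp σ * wpDeriv σ) by ring]
  -- The class of `1` modulo `4` starts at `5`, the pole order of `℘ ℘'`.
  refine h.isNormalForm ρ hb (n₁ := 3) (n₂ := 5) h.actFun_wp_sq h.order_lift_wp_sq
    ?_ h.order_lift_wpDeriv (fun N h1 h2 => ?_) ?_ ?_ (fun N h1 h2 => ?_)
  · rw [h.actFun_wpDeriv, ha]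
  · change N % 4 = 3 % 4 at h2; omega
  · rw [map_mul, h.actFun_wp, h.actFun_wpDeriv, smul_mul_smul_comm,
      show a ^ 2 * a ^ 3 = a ^ 4 * a by ring, h4, one_mul]
  · rw [h.order_lift_mul, h.order_lift_wp, h.order_lift_wpDeriv]; rfl
  · change N % 4 = 5 % 4 at h2; omega

theorem nonempty_equiv_four (h : IsRotation σ s a 4) {ρ : Γ →* lieAut sl2}
    {b : Module.Basis (Fin 3) ℂ sl2}
    (hb : sl2.IsEigenbasis (ρ s).1 a b) : Nonempty (automorphicLieAlgebra ρ σ ≃ₗ⁅ℂ⁆ Onsager) := by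
  have hg₃ : L.g₃ = 0 := by
    rw [PeriodPair.g₃, IsReg.G_eq_zero h.ne_zero h.mul_mem_iff, mul_zero]
    exact fun h' => absurd (h.primitive.dvd_of_pow_eq_one _ h') (by norm_num)
  have hg₂ := (IsReg.g₂_ne_zero_or_g₃_ne_zero L).resolve_right (not_not.mpr hg₃)
  have key := h.isNormalForm_four hb
  rw [h.invariantFunctions_four] at key
  have hsq := wpDeriv_sq h.fixes_zero
  rw [hg₃, map_zero, sub_zero] at hsq
  -- With `g₃ = 0` and `J = ℘²`, `p = ℘ ℘'² = 4 J² - g₂ J` has roots `0` and `g₂ / 4`.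
  obtain ⟨t, ht⟩ : ∃ t, L.g₂ = 4 * t := ⟨L.g₂ / 4, by ring⟩
  rw [ht] at hg₂ hsq
  obtain ⟨e⟩ := IsNormalForm.nonempty_equiv (J := wp σ ^ 2)
    (P := C 4 * ((X - C 0) * (X - C t))) (by
      convert key using 1
      rw [hsq]
      simp only [map_mul, map_sub, aeval_X, aeval_C, map_zero, sub_zero, map_ofNat]
      rw [Algebra.smul_def, map_mul, map_ofNat]
      ring)
    (h.aeval_injective h.order_lift_wp_sq)
  obtain ⟨e₂⟩ := Onsager.nonempty_equiv_of_quadratic (a := 4) (r := 0) (s := t) (by norm_num)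
    (by rintro rfl; simp at hg₂) rfl
  exact ⟨e.trans e₂⟩

theorem actFun_wp_cube (h : IsRotation σ s a 6) : actFun σ s (wp σ ^ 3) = wp σ ^ 3 := by
  rw [map_pow, h.actFun_wp, _root_.smul_pow, ← pow_mul, h.primitive.pow_eq_one, one_smul]

theorem order_lift_wp_cube (h : IsRotation σ s a 6) :
    meromorphicOrderAt (lift (wp σ ^ 3)) 0 = ((-(6 : ℕ) : ℤ) : WithTop ℤ) := by
  rw [pow_succ, pow_two, h.order_lift_mul, h.order_lift_mul, h.order_lift_wp]; rfl

theorem invariantFunctions_six (h : IsRotation σ s a 6) :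
    invariantFunctions σ = Algebra.adjoin ℂ {wp σ ^ 3} :=
  h.invariantFunctions_eq h.actFun_wp_cube h.order_lift_wp_cube

theorem isNormalForm_six (h : IsRotation σ s a 6) {ρ : Γ →* lieAut sl2}
    {b : Module.Basis (Fin 3) ℂ sl2}
    (hb : sl2.IsEigenbasis (ρ s).1 a b) :
    IsNormalForm (automorphicLieAlgebra ρ σ) (invariantFunctions σ)
      ((wp σ * wpDeriv σ) ⊗ₜ b 0) ((wp σ ^ 2 * wpDeriv σ) ⊗ₜ b 1) (1 ⊗ₜ b 2)
      (wp σ ^ 3 * wpDeriv σ ^ 2) := by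
  have h6 := h.primitive.pow_eq_one
  have ha : a⁻¹ = a ^ 5 := inv_eq_of_mul_eq_one_left (by rw [← h6]; ring)
  rw [show wp σ ^ 3 * wpDeriv σ ^ 2 = (wp σ * wpDeriv σ) * (wp σ ^ 2 * wpDeriv σ) by ring]
  -- The class of `1` modulo `6` starts at `7`, the pole order of `℘² ℘'`.
  refine h.isNormalForm ρ hb (n₁ := 5) (n₂ := 7) h.actFun_wp_cube h.order_lift_wp_cube
    ?_ ?_ (fun N h1 h2 => ?_) ?_ ?_ (fun N h1 h2 => ?_)
  · rw [map_mul, h.actFun_wp, h.actFun_wpDeriv, smul_mul_smul_comm, ha, ← pow_add]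
  · rw [h.order_lift_mul, h.order_lift_wp, h.order_lift_wpDeriv]; rfl
  · change N % 6 = 5 % 6 at h2; omega
  · rw [map_mul, map_pow, h.actFun_wp, h.actFun_wpDeriv, _root_.smul_pow, smul_mul_smul_comm,
      show (a ^ 2) ^ 2 * a ^ 3 = a ^ 6 * a by ring, h6, one_mul]
  · rw [pow_two, h.order_lift_mul, h.order_lift_mul, h.order_lift_wp, h.order_lift_wpDeriv]; rfl
  · change N % 6 = 7 % 6 at h2; omega

theorem nonempty_equiv_six (h : IsRotation σ s a 6) {ρ : Γ →* lieAut sl2}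
    {b : Module.Basis (Fin 3) ℂ sl2}
    (hb : sl2.IsEigenbasis (ρ s).1 a b) : Nonempty (automorphicLieAlgebra ρ σ ≃ₗ⁅ℂ⁆ Onsager) := by
  have hg₂ : L.g₂ = 0 := by
    rw [PeriodPair.g₂, IsReg.G_eq_zero h.ne_zero h.mul_mem_iff, mul_zero]
    exact fun h' => absurd (h.primitive.dvd_of_pow_eq_one _ h') (by norm_num)
  have hg₃ := (IsReg.g₂_ne_zero_or_g₃_ne_zero L).resolve_left (not_not.mpr hg₂)
  have key := h.isNormalForm_six hb
  rw [h.invariantFunctions_six] at key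
  have hsq := wpDeriv_sq h.fixes_zero
  rw [hg₂, zero_smul, sub_zero] at hsq
  -- With `g₂ = 0` and `J = ℘³`, `p = ℘³ ℘'² = 4 J² - g₃ J` has roots `0` and `g₃ / 4`.
  obtain ⟨t, ht⟩ : ∃ t, L.g₃ = 4 * t := ⟨L.g₃ / 4, by ring⟩
  rw [ht] at hg₃ hsq
  obtain ⟨e⟩ := IsNormalForm.nonempty_equiv (J := wp σ ^ 3)
    (P := C 4 * ((X - C 0) * (X - C t))) (by
      convert key using 1
      rw [hsq]
      simp only [map_mul, map_sub, aeval_X, aeval_C, map_zero, sub_zero]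
      rw [map_ofNat]
      ring)
    (h.aeval_injective h.order_lift_wp_cube)
  obtain ⟨e₂⟩ := Onsager.nonempty_equiv_of_quadratic (a := 4) (r := 0) (s := t) (by norm_num)
    (by rintro rfl; simp at hg₃) rfl
  exact ⟨e.trans e₂⟩

/-- For the orders that occur, a primitive root of unity is determined up to inversion. -/
theorem exists_isEigenbasis {m : ℕ} (hm : m ∈ ({2, 3, 4, 6} : Set ℕ)) {a : ℂ}
    (ha : IsPrimitiveRoot a m) {φ : sl2 ≃ₗ[ℂ] sl2} (hφ : φ ∈ lieAut sl2) (ho : orderOf φ = m) :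
    ∃ b, sl2.IsEigenbasis φ a b := by
  have hm0 : 0 < m := by rcases hm with rfl | rfl | rfl | rfl <;> norm_num
  obtain ⟨b, hb, ζ, hζ, h0, h1, h2⟩ := sl2.exists_diagonal hφ hm0 (ho ▸ pow_orderOf_eq_one φ)
  have hζm : IsPrimitiveRoot ζ m := by
    rw [← ho, sl2.orderOf_eq_of_diagonal h0 h1 h2]
    exact IsPrimitiveRoot.orderOf ζ
  have : NeZero m := ⟨hm0.ne'⟩
  obtain ⟨i, hi, rfl⟩ := ha.eq_pow_of_pow_eq_one hζm.pow_eq_one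
  have hco := (ha.pow_iff_coprime hm0 i).mp hζm
  -- For these `m` the only units modulo `m` are `1` and `-1`; in the second case the eigenvalue is
  -- `a⁻¹`, and exchanging `e` and `f` repairs it.
  have hcase : i = 1 ∨ i + 1 = m := by
    rcases hm with rfl | rfl | rfl | rfl <;> interval_cases i <;> simp_all (decide := true)
  rcases hcase with rfl | hi1
  · rw [pow_one] at h0 h1
    exact ⟨b, hb, h0, h1, h2⟩
  · have hinv : a ^ i = a⁻¹ := eq_inv_of_mul_eq_one_left (by
      rw [← pow_succ, hi1, ha.pow_eq_one])
    rw [hinv] at h0 h1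
    rw [inv_inv] at h1
    obtain ⟨b', hb', e0, e1, e2⟩ := hb.exists_swap
    exact ⟨b', hb', by rw [e0, h1], by rw [e1, h0], by rw [e2, map_neg, h2]⟩

end IsRotation

/-! ### Trivial group -/

/-- Each of `e, f, h` is a bracket in `𝔰𝔩₂`, and the coefficient `f` can be placed in one of the two
factors. -/
theorem tensor_sl2_perfect (R : Type*) [CommRing R] [Algebra ℂ R] :
    Submodule.span ℂ {m | ∃ x y : R ⊗[ℂ] sl2, ⁅x, y⁆ = m} = ⊤ := by
  obtain ⟨b, hb, -⟩ := sl2.isStandard_matrices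
  rw [eq_top_iff]
  rintro x -
  induction x using TensorProduct.induction_on with
  | zero => exact zero_mem _
  | add x y hx hy => exact add_mem hx hy
  | tmul f A =>
    have hspan : ∀ i, f ⊗ₜ[ℂ] b i ∈
        Submodule.span ℂ {m | ∃ x y : R ⊗[ℂ] sl2, ⁅x, y⁆ = m} := by
      intro i
      apply Submodule.subset_span
      fin_cases i
      · refine ⟨1 ⊗ₜ b 2, ((1 / 2 : ℂ) • f) ⊗ₜ b 0, ?_⟩
        rw [LieAlgebra.ExtendScalars.bracket_tmul, hb.lie_h_e, one_mul, TensorProduct.tmul_smul,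
          TensorProduct.smul_tmul', smul_smul]
        norm_num
      · refine ⟨1 ⊗ₜ b 2, ((-1 / 2 : ℂ) • f) ⊗ₜ b 1, ?_⟩
        rw [LieAlgebra.ExtendScalars.bracket_tmul, hb.lie_h_f, one_mul, TensorProduct.tmul_smul,
          TensorProduct.smul_tmul', smul_smul]
        norm_num
      · refine ⟨1 ⊗ₜ b 0, f ⊗ₜ b 1, ?_⟩
        rw [LieAlgebra.ExtendScalars.bracket_tmul, hb.lie_e_f, one_mul]
        rfl
    rw [← b.sum_repr A, TensorProduct.tmul_sum]
    refine sum_mem fun i _ => ?_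
    rw [TensorProduct.tmul_smul]
    exact Submodule.smul_mem _ _ (hspan i)

theorem not_equiv_of_subsingleton [Subsingleton Γ] (ρ : Γ →* lieAut sl2) :
    ¬ Nonempty (automorphicLieAlgebra ρ σ ≃ₗ⁅ℂ⁆ Onsager) := by
  have htop : automorphicLieAlgebra ρ σ = ⊤ := by
    rw [eq_top_iff]
    intro x _ γ
    rw [Subsingleton.elim γ 1, actCurrent_one]
  rintro ⟨e⟩
  rw [htop] at e
  exact Onsager.not_equiv_of_perfect (tensor_sl2_perfect (Functions σ))
    ⟨LieSubalgebra.topEquiv.symm.trans e⟩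

/-! ### The theorem -/

theorem exists_isRotation [IsCyclic Γ] (hσ : Function.Injective σ)
    (hrot : ∀ γ, act σ γ 0 = 0) : ∃ s a, IsRotation σ s a (Nat.card Γ) := by
  obtain ⟨s, hs⟩ := IsCyclic.exists_generator (α := Γ)
  obtain ⟨a, -, h1, h2⟩ := exists_rotation (hrot s)
  refine ⟨s, a, hs, hrot, ?_, Nat.card_pos, h1, h2⟩
  rw [← orderOf_eq_card_of_forall_mem_zpowers hs, orderOf_eq_of_rotation hσ h1]
  exact IsPrimitiveRoot.orderOf a

theorem IsRotation.of_generator {m : ℕ} (hΓ : Nat.card Γ = m) (hrot : ∀ γ, act σ γ 0 = 0)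
    (hs : ∀ γ, γ ∈ Subgroup.zpowers s) (ha : IsPrimitiveRoot a m)
    (h : ∀ z, act σ s (proj L z) = proj L (a * z)) : IsRotation σ s a m :=
  ⟨hs, hrot, ha, hΓ ▸ Nat.card_pos, h,
    mem_lattice_iff_of_injective (b := 0) (act_injective σ s) fun z => by rw [h, add_zero]⟩

theorem natDegree_weierstrassCubic (g h : ℂ) :
    (4 * X ^ 3 - C g * X - C h : ℂ[X]).natDegree = 3 := by
  rw [show (4 : ℂ[X]) = C 4 from (map_ofNat C 4).symm]
  compute_degree!

theorem nonempty_equiv_of_torusIso {L' : PeriodPair} (h : TorusIso L L') :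
    Nonempty (TwistedSl2 (4 * X ^ 3 - C L.g₂ * X - C L.g₃) ≃ₗ⁅ℂ⁆
      TwistedSl2 (4 * X ^ 3 - C L'.g₂ * X - C L'.g₃)) := by
  obtain ⟨a, ha, hL⟩ := h.exists_mul
  have e2 : L.g₂ = a ^ 4 * L'.g₂ := by
    rw [PeriodPair.g₂, PeriodPair.g₂, G_eq_mul_of_mul ha hL]; ring
  have e3 : L.g₃ = a ^ 6 * L'.g₃ := by
    rw [PeriodPair.g₃, PeriodPair.g₃, G_eq_mul_of_mul ha hL]; ring
  -- Since `g₂` and `g₃` scale by `a ^ 4` and `a ^ 6`, substituting `a² X` multiplies the cubic of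
  -- `L'` by `a ^ 6`.
  refine ⟨TwistedSl2.affineEquiv _ _ (a ^ 2) 0 (a ^ 6) (pow_ne_zero _ ha) (pow_ne_zero _ ha) ?_⟩
  rw [e2, e3]
  simp only [sub_comp, mul_comp, pow_comp, X_comp, C_comp, ofNat_comp, C_mul, C_pow, C_0, add_zero]
  ring

theorem isEigenbasis_matrices {φ : sl2 ≃ₗ[ℂ] sl2} (h : ∀ A : sl2, (φ A).1 =
      !![A.1 0 0, a * A.1 0 1; a⁻¹ * A.1 1 0, A.1 1 1]) :
    ∃ b, sl2.IsEigenbasis φ a b ∧ b 0 = matE ∧ b 1 = matF ∧ b 2 = matH := by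
  obtain ⟨b, hb, e0, e1, e2⟩ := sl2.isStandard_matrices
  refine ⟨b, ⟨hb, ?_, ?_, ?_⟩, e0, e1, e2⟩
  · rw [e0]; apply sl2.ext <;> simp [h, sl2.smul_apply]
  · rw [e1]; apply sl2.ext <;> simp [h, sl2.smul_apply]
  · rw [e2]; apply sl2.ext <;> simp [h]

end

end ALia

end

/-! ### Assembly of the cases `ℓ = 1, 2, 3, 4, 6` -/

theorem mainTheorem3 (L : PeriodPair) (ℓ : ℕ) (Γ : Type*) [Group Γ] [Finite Γ] [IsCyclic Γ]
    (hΓ : Nat.card Γ = ℓ)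
    (ρ : Γ →* ALia.lieAut ALia.sl2) (hρ : Function.Injective ρ)
    (σ : Γ →* ALia.torusAut L) (hσ : Function.Injective σ)
    (hrot : ∀ γ, ALia.act σ γ 0 = 0)
    (hgenus : ALia.QuotientHasGenusZero σ) :
    -- isomorphic to the Onsager algebra exactly for `ℓ = 3, 4, 6`
    (Nonempty (ALia.automorphicLieAlgebra ρ σ ≃ₗ⁅ℂ⁆ ALia.Onsager) ↔ ℓ ∈ ({3, 4, 6} : Set ℕ)) ∧
    -- for `ℓ = 2` it is `𝔖_τ`, where `T ≅ T_τ`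
    (ℓ = 2 →
      (∃ τ : UpperHalfPlane, ALia.TorusIso L (ALia.tauPeriods τ)) ∧
      ∀ τ : UpperHalfPlane, ALia.TorusIso L (ALia.tauPeriods τ) →
        Nonempty (ALia.automorphicLieAlgebra ρ σ ≃ₗ⁅ℂ⁆ ALia.SLie τ)) ∧
    -- explicit normal forms when a generator `s` acts in the standard way
    (∀ s : Γ, (∀ γ, γ ∈ Subgroup.zpowers s) →
      (∀ A : ALia.sl2, ((ρ s).1 A).1 =
        !![A.1 0 0, ALia.omega ℓ * A.1 0 1; (ALia.omega ℓ)⁻¹ * A.1 1 0, A.1 1 1]) →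
      (∀ z : ℂ, ALia.act σ s (ALia.proj L z) = ALia.proj L (ALia.omega ℓ * z)) →
      (ℓ = 3 →
        ALia.invariantFunctions σ = Algebra.adjoin ℂ {ALia.wpDeriv σ} ∧
        ALia.IsNormalForm (ALia.automorphicLieAlgebra ρ σ) (ALia.invariantFunctions σ)
          (ALia.wp σ ⊗ₜ ALia.matE) ((ALia.wp σ ^ 2) ⊗ₜ ALia.matF) (1 ⊗ₜ ALia.matH)
          (ALia.wp σ ^ 3)) ∧
      (ℓ = 4 →
        ALia.invariantFunctions σ = Algebra.adjoin ℂ {ALia.wp σ ^ 2} ∧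
        ALia.IsNormalForm (ALia.automorphicLieAlgebra ρ σ) (ALia.invariantFunctions σ)
          (ALia.wpDeriv σ ⊗ₜ ALia.matE) ((ALia.wp σ * ALia.wpDeriv σ) ⊗ₜ ALia.matF) (1 ⊗ₜ ALia.matH)
          (ALia.wp σ * ALia.wpDeriv σ ^ 2)) ∧
      (ℓ = 6 →
        ALia.invariantFunctions σ = Algebra.adjoin ℂ {ALia.wp σ ^ 3} ∧
        ALia.IsNormalForm (ALia.automorphicLieAlgebra ρ σ) (ALia.invariantFunctions σ)
          ((ALia.wp σ * ALia.wpDeriv σ) ⊗ₜ ALia.matE) ((ALia.wp σ ^ 2 * ALia.wpDeriv σ) ⊗ₜ ALia.matF)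
          (1 ⊗ₜ ALia.matH) (ALia.wp σ ^ 3 * ALia.wpDeriv σ ^ 2))) := by
  have hord : ∀ s : Γ, (∀ γ, γ ∈ Subgroup.zpowers s) → orderOf (ρ s).1 = ℓ := fun s hs =>
    (ALia.orderOf_rho hρ hs).trans hΓ
  refine ⟨?_, ?_, ?_⟩
  · obtain ⟨s, a, h⟩ := ALia.exists_isRotation hσ hrot
    rw [hΓ] at h
    have hb : ℓ ∈ ({2, 3, 4, 6} : Set ℕ) → _ := fun hm =>
      ALia.IsRotation.exists_isEigenbasis hm h.primitive (ρ s).2 (hord s h.generates)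
    rcases ALia.orderOf_rotation h.pos h.primitive (fun z hz => (h.mul_mem_iff z).mpr hz) with
      rfl | rfl | rfl | rfl | rfl
    · have : Subsingleton Γ := (Nat.card_eq_one_iff_unique.mp hΓ).1
      exact iff_of_false (ALia.not_equiv_of_subsingleton ρ) (by simp)
    · obtain ⟨b, hb⟩ := hb (by simp)
      obtain ⟨e⟩ := h.nonempty_equiv_two hb
      refine iff_of_false (fun ⟨e'⟩ => ?_) (by simp)
      exact ALia.Onsager.not_equiv_of_cubic (ALia.natDegree_weierstrassCubic _ _)
        ⟨e.symm.trans e'⟩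
    · obtain ⟨b, hb⟩ := hb (by simp)
      exact iff_of_true (h.nonempty_equiv_three hb) (by simp)
    · obtain ⟨b, hb⟩ := hb (by simp)
      exact iff_of_true (h.nonempty_equiv_four hb) (by simp)
    · obtain ⟨b, hb⟩ := hb (by simp)
      exact iff_of_true (h.nonempty_equiv_six hb) (by simp)
  · rintro rfl
    refine ⟨ALia.exists_torusIso_tauPeriods L, fun τ hτ => ?_⟩
    obtain ⟨s, a, h⟩ := ALia.exists_isRotation hσ hrot
    rw [hΓ] at h
    obtain ⟨b, hb⟩ := ALia.IsRotation.exists_isEigenbasis (by simp) h.primitive (ρ s).2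
      (hord s h.generates)
    obtain ⟨e⟩ := h.nonempty_equiv_two hb
    obtain ⟨e'⟩ := ALia.nonempty_equiv_of_torusIso hτ
    exact ⟨e.trans e'⟩
  · intro s hs hρs hσs
    have hℓ : ℓ ≠ 0 := hΓ ▸ Nat.card_pos.ne'
    have h := ALia.IsRotation.of_generator hΓ hrot hs (Complex.isPrimitiveRoot_exp ℓ hℓ) hσs
    obtain ⟨b, hb, e0, e1, e2⟩ := ALia.isEigenbasis_matrices hρs
    rw [← e0, ← e1, ← e2]
    refine ⟨?_, ?_, ?_⟩ <;> rintro rfl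
    · exact ⟨h.invariantFunctions_three, h.isNormalForm_three hb⟩
    · exact ⟨h.invariantFunctions_four, h.isNormalForm_four hb⟩
    · exact ⟨h.invariantFunctions_six, h.isNormalForm_six hb⟩
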